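/- **Setting.** Let $M$ be a smooth (Hausdorff, second countable, finite-dimensional) manifold and $p:E\to M$ a smooth real vector bundle of finite rank carrying a Lie algebroid structure $(E,\rho_E,[\cdot,\cdot]_E)$: a smooth bundle map $\rho_E:E\to TM$ and a real Lie algebra bracket on $\Gamma(E)$ with $\rho_E([s,t]_E)=[\rho_E(s),\rho_E(t)]$ and $[s,ft]_E=f[s,t]_E+\rho_E(s)(f)\,t$ for $s,t\in\Gamma(E)$, $f\in C^\infty(M)$. *Almost complex Poisson structures.* An almost complex structure on a Lie algebroid $(A,\rho_A,[\cdot,\cdot]_A)$ is a bundle endomorphism $J_A$ of $A$ with $J_A^2=-\mathrm{id}$; it is integrable if $N_{J_A}(s,t)=[J_As,J_At]_A-J_A[s,J_At]_A-J_A[J_As,t]_A-[s,t]_A$ vanishes for all $s,t\in\Gamma(A)$. The complex sections of type $(1,0)$ are the sections $s-iJ_As$, $s\in\Gamma(A)$, and $\mathcal V^{2,0}(A)$ is the complex span of their wedge products in $\Gamma(\bigwedge^2A)\otimes_{\mathbb R}\mathbb C$. The Schouten–Nijenhuis bracket of bisections is given by $$[s_1\wedge s_2,t_1\wedge t_2]_A=-\sum_{i,j=1}^{2}(-1)^{i+j}[s_i,t_j]_A\wedge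 s_{3-i}\wedge t_{3-j}$$ and extended complex bilinearly. A pair $(J_A,\pi^{2,0}_A)$ with $J_A$ an almost complex structure on $A$ and $\pi_A^{2,0}\in\mathcal V^{2,0}(A)$ is an almost complex Poisson structure on $A$ if $[\pi^{2,0}_A,\pi^{2,0}_A]_A=0$ and $[\pi^{2,0}_A,\overline{\pi^{2,0}_A}]_A=0$. *Prolongation and lifts.* The prolongation of $E$ over its projection is the vector bundle $\mathcal L^p(E)\to E$ with total space $\{(u,z)\in E\times TE:\rho_E(u)=p_*(z)\}$, where the fibre over $y\in E$ consists of the pairs with $u\in E_{p(y)}$ and $z\in T_yE$. Its anchor is $(u,z)\mapsto z$. Let $(x^i)$ be local coordinates on $M$, $\{e_a\}$ a local basis of sections of $E$, $(x^i,y^a)$ the induced coordinates on $E$, $\rho_E(e_a)=\rho_a^i\,\partial/\partial x^i$ and $[e_a,e_b]_E=C^c_{ab}e_c$. Then $\mathcal X_a=(e_a\circ p,\rho_a^i\,\partial/\partial x^i)$ and $\mathcal V_a=(0,\partial/\partial y^a)$ form a local basis of $\Gamma(\mathcal L^p(E))$. The vertical and complete lifts of $s=s^ae_a\in\Gamma(E)$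 are the global sections of $\mathcal L^p(E)$ given locally by $$s^v=s^a\mathcal V_a,\qquad s^c=s^a\mathcal X_a+\bigl(\rho_E(e_c)(s^a)-C^a_{bc}s^b\bigr)y^c\,\mathcal V_a .$$ The bracket on $\Gamma(\mathcal L^p(E))$ is the unique skew-symmetric $\mathbb R$-bilinear one that obeys the Leibniz rule for the anchor and satisfies $[s^v,t^v]=0$, $[s^v,t^c]=[s,t]_E^v$, $[s^c,t^c]=[s,t]_E^c$ for all $s,t\in\Gamma(E)$. For a bundle endomorphism $J_E$ of $E$, the complete lift $J_E^c$ is the unique bundle endomorphism of $\mathcal L^p(E)$ with $J_E^cs^v=(J_Es)^v$ and $J_E^cs^c=(J_Es)^c$ for all $s\in\Gamma(E)$. The complete lift of bisections is the complex linear map determined by $(s\wedge t)^c=s^c\wedge t^v+s^v\wedge t^c$ for $s,t\in\Gamma(E)$. **Statement.** Let $J_E$ be an almost complex structure on $E$. Then: 1. $\mathcal L^p(E)$ with the above anchor and bracket is a Lie algebroid over $E$. 2. $J_E^c$ is an almost complex structure on $\mathcal L^p(E)$. 3. $J_E^c$ is integrable if and only if $J_E$ is integrable. 4. For every $\pi_E^{2,0}\in\mathcal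 V^{2,0}(E)$, if $(J_E,\pi_E^{2,0})$ is an almost complex Poisson structure on $E$, then $(J_E^c,(\pi_E^{2,0})^c)$ is an almost complex Poisson structure on $\mathcal L^p(E)$. -/

import Mathlib

open Bundle
open scoped Manifold ContDiff TensorProduct

noncomputable section

set_option linter.unusedSectionVars false

section Wedge

variable {A L : Type*} [CommRing A] [AddCommGroup L] [Module A L]

/-- The product `s ∧ t` of two sections, as a bisection. -/
def wedge (A : Type*) {L : Type*} [CommRing A] [AddCommGroup L] [Module A L] (s t : L) :
    ⋀[A]^2 L :=
  exteriorPower.ιMulti A 2 ![s, t]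

lemma coe_wedge (s t : L) :
    (wedge A s t : ExteriorAlgebra A L) = ExteriorAlgebra.ι A s * ExteriorAlgebra.ι A t := by
  simp [wedge, ExteriorAlgebra.ιMulti_apply]

lemma ι_mul_swap (s t : L) : ExteriorAlgebra.ι A s * ExteriorAlgebra.ι A t =
    -(ExteriorAlgebra.ι A t * ExteriorAlgebra.ι A s) :=
  eq_neg_of_add_eq_zero_left (ExteriorAlgebra.ι_add_mul_swap s t)

lemma ι_mul_swap₃ (s t u : L) :
    ExteriorAlgebra.ι A s * ExteriorAlgebra.ι A t * ExteriorAlgebra.ι A u =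
      -(ExteriorAlgebra.ι A u * ExteriorAlgebra.ι A t * ExteriorAlgebra.ι A s) := by
  rw [ι_mul_swap s t, neg_mul, mul_assoc, ι_mul_swap s u, mul_neg, neg_neg, ← mul_assoc,
    ι_mul_swap t u, neg_mul]

lemma wedge_self (s : L) : wedge A s s = 0 := by
  apply Subtype.ext; rw [coe_wedge]; simp

end Wedge

section Algebra

variable {A L : Type*} [CommRing A] [Algebra ℝ A] [AddCommGroup L] [Module A L] [Module ℝ L]
  [IsScalarTower ℝ A L]

/-- A skew-symmetric bracket and an anchor on the `A`-module `L`, related by the Leibniz rule.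
For a vector bundle, `A` is the ring of smooth functions on the base and `L` the module of
smooth sections. -/
structure AnchoredBracket (A L : Type*) [CommRing A] [Algebra ℝ A] [AddCommGroup L] [Module A L]
    [Module ℝ L] where
  anchor : L →ₗ[A] Derivation ℝ A A
  bracket : L →ₗ[ℝ] L →ₗ[ℝ] L
  bracket_self : ∀ s, bracket s s = 0
  bracket_smul : ∀ (s : L) (f : A) (t : L),
    bracket s (f • t) = f • bracket s t + anchor s f • t

/-- The product of sections as an `ℝ`-bilinear map. -/
def wedgeₗ (A L : Type*) [CommRing A] [Algebra ℝ A] [AddCommGroup L] [Module A L] [Module ℝ L]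
    [IsScalarTower ℝ A L] : L →ₗ[ℝ] L →ₗ[ℝ] ⋀[A]^2 L :=
  LinearMap.mk₂ ℝ (wedge A)
    (fun s s' t => by apply Subtype.ext; simp [coe_wedge, add_mul])
    (fun c s t => by
      apply Subtype.ext
      rw [← algebraMap_smul A c s, ← algebraMap_smul A c]
      simp [coe_wedge])
    (fun s t t' => by apply Subtype.ext; simp [coe_wedge, mul_add])
    (fun c s t => by
      apply Subtype.ext
      rw [← algebraMap_smul A c t, ← algebraMap_smul A c]
      simp [coe_wedge])

/-- An `ℝ`-bilinear map that is alternating and balanced over `A`, though not necessarily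
`A`-bilinear, factors through the exterior square over `A`. -/
lemma exists_bisectionLift {P : Type*} [AddCommGroup P] [Module ℝ P] (f : L →ₗ[ℝ] L →ₗ[ℝ] P)
    (h_bal : ∀ (r : A) s t, f (r • s) t = f s (r • t)) (h_alt : ∀ (r : A) s, f (r • s) s = 0) :
    ∃ φ : ⋀[A]^2 L →ₗ[ℝ] P, ∀ s t, φ (wedge A s t) = f s t := by
  let N : Submodule A (L ⊗[A] L) := Submodule.span A (Set.range fun s : L => s ⊗ₜ[A] s)
  let m : L →ₗ[A] L →ₗ[A] (L ⊗[A] L) ⧸ N := (TensorProduct.mk A L L).compr₂ N.mkQ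
  have hm : ∀ s, m s s = 0 := fun s => by
    simp only [m, LinearMap.compr₂_apply, TensorProduct.mk_apply, Submodule.mkQ_apply,
      Submodule.Quotient.mk_eq_zero]
    exact Submodule.subset_span ⟨s, rfl⟩
  let mm : MultilinearMap A (fun _ : Fin 2 => L) ((L ⊗[A] L) ⧸ N) :=
    { toFun := fun v => m (v 0) (v 1)
      map_update_add' := by
        intro _ v i x y
        fin_cases i <;> simp [Function.update]
      map_update_smul' := by
        intro _ v i c x
        fin_cases i <;> simp [Function.update] }
  let am : L [⋀^Fin 2]→ₗ[A] ((L ⊗[A] L) ⧸ N) :=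
    { mm with
      map_eq_zero_of_eq' := by
        intro v i j hv hij
        change m (v 0) (v 1) = 0
        fin_cases i <;> fin_cases j <;> simp_all }
  let g : L ⊗[A] L →+ P := TensorProduct.liftAddHom
    (LinearMap.toAddMonoidHom'.comp f.toAddMonoidHom) h_bal
  have hg : ∀ s t, g (s ⊗ₜ t) = f s t := fun s t => rfl
  have hN : N.toAddSubgroup ≤ g.ker := by
    intro x hx
    refine Submodule.span_induction (p := fun x _ => ∀ r : A, g (r • x) = 0) ?_ ?_ ?_ ?_ hx 1
      |> fun h => by simpa using h
    · rintro _ ⟨s, rfl⟩ r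
      change g (r • (s ⊗ₜ[A] s)) = 0
      rw [TensorProduct.smul_tmul', hg, h_alt]
    · simp
    · intro x y _ _ hx hy r
      rw [smul_add, map_add, hx, hy, add_zero]
    · intro a x _ hx r
      rw [smul_smul, hx]
  let q : (L ⊗[A] L) ⧸ N →+ P := QuotientAddGroup.lift N.toAddSubgroup g hN
  have hq : ∀ s t, q (m s t) = f s t := fun s t => rfl
  have key : ∀ s t, q (exteriorPower.alternatingMapLinearEquiv am (wedge A s t)) = f s t := by
    intro s t
    rw [wedge, exteriorPower.alternatingMapLinearEquiv_apply_ιMulti]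
    exact hq s t
  refine ⟨{ toFun := fun x => q (exteriorPower.alternatingMapLinearEquiv am x)
            map_add' := fun x y => by simp
            map_smul' := ?_ }, key⟩
  intro c x
  have hx : x ∈ Submodule.span A (Set.range (exteriorPower.ιMulti A 2 (M := L))) := by
    rw [exteriorPower.ιMulti_span]; trivial
  have main : ∀ r : A, q (exteriorPower.alternatingMapLinearEquiv am (c • r • x)) =
      c • q (exteriorPower.alternatingMapLinearEquiv am (r • x)) := by
    induction hx using Submodule.span_induction with
    | mem x h =>
      obtain ⟨v, rfl⟩ := h
      intro r
      have hv : exteriorPower.ιMulti A 2 v = wedge A (v 0) (v 1) := by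
        rw [wedge]; congr 1; ext i; fin_cases i <;> rfl
      have h1 : r • wedge A (v 0) (v 1) = wedge A (r • v 0) (v 1) := by
        apply Subtype.ext; simp [coe_wedge]
      have h2 : c • wedge A (r • v 0) (v 1) = wedge A (c • r • v 0) (v 1) :=
        ((wedgeₗ A L).map_smul₂ c (r • v 0) (v 1)).symm
      rw [hv, h1, h2, key, key, LinearMap.map_smul₂]
    | zero => simp
    | add x y _ _ hx hy =>
      intro r
      simp only [smul_add, map_add, hx r, hy r]
    | smul a x _ hx =>
      intro r
      rw [smul_smul]; exact hx _
  simpa using main 1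

/-- The `ℝ`-linear extension to bisections of a map given on products `s ∧ t`. -/
def bisectionLift {P : Type*} [AddCommGroup P] [Module ℝ P] (f : L →ₗ[ℝ] L →ₗ[ℝ] P)
    (h_bal : ∀ (r : A) s t, f (r • s) t = f s (r • t)) (h_alt : ∀ (r : A) s, f (r • s) s = 0) :
    ⋀[A]^2 L →ₗ[ℝ] P :=
  (exists_bisectionLift f h_bal h_alt).choose

lemma bisectionLift_wedge {P : Type*} [AddCommGroup P] [Module ℝ P] (f : L →ₗ[ℝ] L →ₗ[ℝ] P)
    (h_bal : ∀ (r : A) s t, f (r • s) t = f s (r • t)) (h_alt : ∀ (r : A) s, f (r • s) s = 0)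
    (s t : L) : bisectionLift f h_bal h_alt (wedge A s t) = f s t :=
  (exists_bisectionLift f h_bal h_alt).choose_spec s t

/-- Products of sections span the bisections over `ℝ`. -/
lemma bisection_induction {p : ⋀[A]^2 L → Prop} (h_wedge : ∀ s t, p (wedge A s t))
    (h_zero : p 0) (h_add : ∀ x y, p x → p y → p (x + y)) (x : ⋀[A]^2 L) : p x := by
  have hx : x ∈ Submodule.span A (Set.range (exteriorPower.ιMulti A 2 (M := L))) := by
    rw [exteriorPower.ιMulti_span]; trivial
  have main : ∀ r : A, p (r • x) := by
    induction hx using Submodule.span_induction with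
    | mem x h =>
      obtain ⟨v, rfl⟩ := h
      intro r
      have hv : exteriorPower.ιMulti A 2 v = wedge A (v 0) (v 1) := by
        rw [wedge]; congr 1; ext i; fin_cases i <;> rfl
      have h1 : r • wedge A (v 0) (v 1) = wedge A (r • v 0) (v 1) := by
        apply Subtype.ext; simp [coe_wedge]
      rw [hv, h1]; exact h_wedge _ _
    | zero => simpa using h_zero
    | add x y _ _ hx hy => intro r; rw [smul_add]; exact h_add _ _ (hx r) (hy r)
    | smul a x _ hx => intro r; rw [smul_smul]; exact hx _
  simpa using main 1

lemma bisection_ext {P : Type*} [AddCommGroup P] [Module ℝ P] {φ ψ : ⋀[A]^2 L →ₗ[ℝ] P}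
    (h : ∀ s t, φ (wedge A s t) = ψ (wedge A s t)) : φ = ψ := by
  ext x
  induction x using bisection_induction with
  | h_wedge s t => exact h s t
  | h_zero => simp
  | h_add x y hx hy => simp [hx, hy]

namespace AnchoredBracket

variable (𝔟 : AnchoredBracket A L)

lemma bracket_swap (s t : L) : 𝔟.bracket s t = - 𝔟.bracket t s := by
  have h := 𝔟.bracket_self (s + t)
  simp only [map_add, LinearMap.add_apply, 𝔟.bracket_self, zero_add, add_zero] at h
  exact eq_neg_of_add_eq_zero_right h

lemma smul_bracket (f : A) (s t : L) :
    𝔟.bracket (f • s) t = f • 𝔟.bracket s t - 𝔟.anchor t f • s := by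
  rw [𝔟.bracket_swap, 𝔟.bracket_smul, 𝔟.bracket_swap t s]
  rw [neg_add, smul_neg, neg_neg, sub_eq_add_neg]

open ExteriorAlgebra in
/-- The Schouten-Nijenhuis bracket `[s ∧ s', t ∧ t']` of two decomposable bisections. -/
def schoutenWedge (s s' t t' : L) : ExteriorAlgebra A L :=
  -(ι A (𝔟.bracket s t) * ι A s' * ι A t' - ι A (𝔟.bracket s t') * ι A s' * ι A t
    - ι A (𝔟.bracket s' t) * ι A s * ι A t' + ι A (𝔟.bracket s' t') * ι A s * ι A t)

lemma ι_smul_real (c : ℝ) (s : L) :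
    ExteriorAlgebra.ι A (c • s) = c • ExteriorAlgebra.ι A s := by
  rw [← algebraMap_smul A c s, ← algebraMap_smul A c, map_smul]

/-- `[· , t ∧ t']` on bisections. -/
def schoutenAux (t t' : L) : ⋀[A]^2 L →ₗ[ℝ] ExteriorAlgebra A L :=
  bisectionLift (LinearMap.mk₂ ℝ (fun s s' => 𝔟.schoutenWedge s s' t t')
    (fun s₁ s₂ s' => by simp [schoutenWedge, add_mul, mul_add]; abel)
    (fun c s s' => by
      simp only [schoutenWedge, map_smul, LinearMap.smul_apply, ι_smul_real, smul_mul_assoc,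
        mul_smul_comm, smul_neg, smul_add, smul_sub])
    (fun s s₁ s₂ => by simp [schoutenWedge, add_mul, mul_add]; abel)
    (fun c s s' => by
      simp only [schoutenWedge, map_smul, LinearMap.smul_apply, ι_smul_real, smul_mul_assoc,
        mul_smul_comm, smul_neg, smul_add, smul_sub]))
    (fun r s s' => by
      simp only [LinearMap.mk₂_apply, schoutenWedge, smul_bracket, map_sub, map_smul, sub_mul,
        smul_mul_assoc, mul_smul_comm]
      have h := ExteriorAlgebra.ι_add_mul_swap (R := A) s s'
      rw [add_eq_zero_iff_eq_neg] at h
      rw [h]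
      simp only [neg_mul, smul_neg]
      abel)
    (fun r s => by
      simp only [LinearMap.mk₂_apply, schoutenWedge, smul_bracket, map_sub, map_smul, sub_mul,
        smul_mul_assoc, mul_smul_comm, ExteriorAlgebra.ι_sq_zero]
      simp)

/-- The Schouten-Nijenhuis bracket of two bisections. Its values are trisections, that is,
elements of degree three in the exterior algebra. -/
def schouten : ⋀[A]^2 L →ₗ[ℝ] ⋀[A]^2 L →ₗ[ℝ] ExteriorAlgebra A L :=
  LinearMap.flip <| bisectionLift (LinearMap.mk₂ ℝ (fun t t' => 𝔟.schoutenAux t t')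
    (fun t₁ t₂ t' => bisection_ext fun s s' => by
      simp [schoutenAux, bisectionLift_wedge, schoutenWedge, add_mul, mul_add]; abel)
    (fun c t t' => bisection_ext fun s s' => by
      simp only [schoutenAux, bisectionLift_wedge, LinearMap.smul_apply, LinearMap.mk₂_apply,
        schoutenWedge, map_smul, ι_smul_real, smul_mul_assoc,
        mul_smul_comm, smul_neg, smul_add, smul_sub])
    (fun t t₁ t₂ => bisection_ext fun s s' => by
      simp [schoutenAux, bisectionLift_wedge, schoutenWedge, add_mul, mul_add]; abel)
    (fun c t t' => bisection_ext fun s s' => by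
      simp only [schoutenAux, bisectionLift_wedge, LinearMap.smul_apply, LinearMap.mk₂_apply,
        schoutenWedge, map_smul, ι_smul_real, smul_mul_assoc,
        mul_smul_comm, smul_neg, smul_add, smul_sub]))
    (fun r t t' => bisection_ext fun s s' => by
      simp only [schoutenAux, bisectionLift_wedge, LinearMap.mk₂_apply, schoutenWedge,
        bracket_smul, map_add, map_smul, add_mul, smul_mul_assoc, mul_smul_comm]
      rw [ι_mul_swap₃ t s' t', ι_mul_swap₃ t s t']
      simp only [smul_neg]
      abel)
    (fun r t => bisection_ext fun s s' => by
      simp only [schoutenAux, bisectionLift_wedge, LinearMap.mk₂_apply, schoutenWedge,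
        bracket_smul, map_add, map_smul, add_mul, smul_mul_assoc, mul_smul_comm]
      have h : ∀ u : L, ExteriorAlgebra.ι A t * ExteriorAlgebra.ι A u * ExteriorAlgebra.ι A t
          = 0 := fun u => by
        rw [ι_mul_swap t u, neg_mul, mul_assoc, ExteriorAlgebra.ι_sq_zero, mul_zero, neg_zero]
      simp [h])

lemma schouten_wedge (s s' t t' : L) :
    𝔟.schouten (wedge A s s') (wedge A t t') = 𝔟.schoutenWedge s s' t t' := by
  simp [schouten, bisectionLift_wedge, schoutenAux]

end AnchoredBracket
end Algebra

section AlgebraStructures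

variable {A L : Type*} [CommRing A] [Algebra ℝ A] [AddCommGroup L] [Module A L] [Module ℝ L]
  [IsScalarTower ℝ A L]

namespace AnchoredBracket

/-- The bracket is a Lie bracket and the anchor respects brackets. -/
structure IsLie (𝔟 : AnchoredBracket A L) : Prop where
  jacobi : ∀ s t u, 𝔟.bracket s (𝔟.bracket t u) =
    𝔟.bracket (𝔟.bracket s t) u + 𝔟.bracket t (𝔟.bracket s u)
  anchor_bracket : ∀ s t, 𝔟.anchor (𝔟.bracket s t) = ⁅𝔟.anchor s, 𝔟.anchor t⁆

/-- The Nijenhuis tensor of an endomorphism. -/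
def nijenhuis (𝔟 : AnchoredBracket A L) (J : L →ₗ[A] L) (s t : L) : L :=
  𝔟.bracket (J s) (J t) - J (𝔟.bracket s (J t)) - J (𝔟.bracket (J s) t) - 𝔟.bracket s t

/-- Integrability of an almost complex structure. -/
def IsIntegrable (𝔟 : AnchoredBracket A L) (J : L →ₗ[A] L) : Prop :=
  ∀ s t, 𝔟.nijenhuis J s t = 0

end AnchoredBracket

/-- `J` is an almost complex structure. -/
def IsAlmostComplex (J : L →ₗ[A] L) : Prop := ∀ s, J (J s) = -s

/-- Complex conjugation on a complexification. -/
def complexConj (X : Type*) [AddCommGroup X] [Module ℝ X] : ℂ ⊗[ℝ] X →ₗ[ℝ] ℂ ⊗[ℝ] X :=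
  LinearMap.rTensor X Complex.conjAe.toLinearMap

/-- The complex section `s - i J s`. These are the sections of type `(1,0)`. -/
def section10 (J : L →ₗ[A] L) (s : L) : ℂ ⊗[ℝ] L := 1 ⊗ₜ s - Complex.I ⊗ₜ J s

/-- The product of two complex sections. -/
def wedgeC (A L : Type*) [CommRing A] [Algebra ℝ A] [AddCommGroup L] [Module A L] [Module ℝ L]
    [IsScalarTower ℝ A L] : ℂ ⊗[ℝ] L →ₗ[ℂ] ℂ ⊗[ℝ] L →ₗ[ℂ] ℂ ⊗[ℝ] ⋀[A]^2 L :=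
  LinearMap.BilinMap.baseChange ℂ (wedgeₗ A L)

/-- The complex bisections of type `(2,0)`. -/
def bisections20 (J : L →ₗ[A] L) : Submodule ℂ (ℂ ⊗[ℝ] ⋀[A]^2 L) :=
  Submodule.span ℂ {P | ∃ s t : L, P = wedgeC A L (section10 J s) (section10 J t)}

/-- The complex bilinear extension of the Schouten-Nijenhuis bracket of bisections. -/
def AnchoredBracket.schoutenC (𝔟 : AnchoredBracket A L) :
    ℂ ⊗[ℝ] ⋀[A]^2 L →ₗ[ℂ] ℂ ⊗[ℝ] ⋀[A]^2 L →ₗ[ℂ] ℂ ⊗[ℝ] ExteriorAlgebra A L :=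
  LinearMap.BilinMap.baseChange ℂ 𝔟.schouten

/-- `(J, P)` is an almost complex Poisson structure. -/
structure AnchoredBracket.IsAlmostComplexPoisson (𝔟 : AnchoredBracket A L) (J : L →ₗ[A] L)
    (P : ℂ ⊗[ℝ] ⋀[A]^2 L) : Prop where
  almostComplex : IsAlmostComplex J
  mem : P ∈ bisections20 J
  schouten_self : 𝔟.schoutenC P P = 0
  schouten_conj : 𝔟.schoutenC P (complexConj _ P) = 0
end AlgebraStructures

section VectorFields
variable {E H N : Type*} [NormedAddCommGroup E] [NormedSpace ℝ E] [TopologicalSpace H]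
  {I : ModelWithCorners ℝ E H} [TopologicalSpace N] [ChartedSpace H N] [IsManifold I ∞ N]

lemma contMDiff_vectorField_apply {X : ∀ x : N, TangentSpace I x}
    (hX : ContMDiff I I.tangent ∞ (fun x => (⟨x, X x⟩ : TangentBundle I N)))
    (f : C^∞⟮I, N; ℝ⟯) : ContMDiff I 𝓘(ℝ) ∞ (fun x => mvfderiv I f x (X x)) := by
  have h1 : ContMDiff I 𝓘(ℝ).tangent ∞ (fun x => tangentMap I 𝓘(ℝ) f ⟨x, X x⟩) :=
    (f.contMDiff.contMDiff_tangentMap (m := ∞) (by simp)).comp hX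
  exact (contMDiff_snd_tangentBundle_modelSpace ℝ 𝓘(ℝ)).comp h1

/-- The action of a smooth vector field on smooth functions. -/
def vectorFieldDerivation (X : ∀ x : N, TangentSpace I x)
    (hX : ContMDiff I I.tangent ∞ (fun x => (⟨x, X x⟩ : TangentBundle I N))) :
    Derivation ℝ C^∞⟮I, N; ℝ⟯ C^∞⟮I, N; ℝ⟯ :=
  Derivation.mk'
    { toFun := fun f => ⟨fun x => mvfderiv I f x (X x), contMDiff_vectorField_apply hX f⟩
      map_add' := fun f g => by
        ext x
        change mvfderiv I (⇑f + ⇑g) x (X x) = _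
        rw [mvfderiv_add (f.contMDiff.mdifferentiable (by simp) x)
          (g.contMDiff.mdifferentiable (by simp) x)]
        rfl
      map_smul' := fun c f => by
        ext x
        change mvfderiv I ((fun _ : N => c) • (fun y => f y)) x (X x) = _
        rw [mvfderiv_smul mdifferentiableAt_const (f.contMDiff.mdifferentiable (by simp) x)]
        simp only [mvfderiv_const]
        simp
        rfl }
    (fun f g => by
        ext x
        change mvfderiv I (⇑f * ⇑g) x (X x) = _
        rw [mvfderiv_mul (f.contMDiff.mdifferentiable (by simp) x)
          (g.contMDiff.mdifferentiable (by simp) x)]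
        simp
        rfl)

open VectorField in
/-- The commutator formula for the Lie bracket of vector fields. -/
lemma mvfderiv_mlieBracket [CompleteSpace E] {X Y : ∀ x : N, TangentSpace I x}
    (hX : ContMDiff I I.tangent ∞ (fun x => (⟨x, X x⟩ : TangentBundle I N)))
    (hY : ContMDiff I I.tangent ∞ (fun x => (⟨x, Y x⟩ : TangentBundle I N)))
    (f : C^∞⟮I, N; ℝ⟯) (x : N) :
    mvfderiv I f x (mlieBracket I X Y x) =
      mvfderiv I (fun y => mvfderiv I f y (Y y)) x (X x)
        - mvfderiv I (fun y => mvfderiv I f y (X y)) x (Y x) := by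
  have : IsManifold I (minSmoothness ℝ 3) N := IsManifold.of_le (n := ∞)
    (by rw [minSmoothness_of_isRCLikeNormedField]; exact ENat.LEInfty.out)
  have : IsManifold I (minSmoothness ℝ 2) N := IsManifold.of_le (n := ∞)
    (by rw [minSmoothness_of_isRCLikeNormedField]; exact ENat.LEInfty.out)
  have : IsManifold I (((⊤ : ℕ∞) : WithTop ℕ∞) + 1) N := IsManifold.of_le (n := ∞) (by simp)
  by_cases hw : ∃ w : TangentSpace I x, w ≠ 0
  swap
  · push Not at hw
    rw [hw (mlieBracket I X Y x), hw (X x), hw (Y x)]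
    simp
  obtain ⟨w, hw⟩ := hw
  let W : ∀ y : N, TangentSpace I y := FiberBundle.extend E w
  have hWx : W x = w := FiberBundle.extend_apply_self E w
  have hW : ContMDiffAt I I.tangent ∞ (fun y => (⟨y, W y⟩ : TangentBundle I N)) x :=
    FiberBundle.contMDiffAt_extend I E w
  have hfd : ∀ y, MDifferentiableAt I 𝓘(ℝ) f y := f.contMDiff.mdifferentiable (by simp)
  let Xf : N → ℝ := fun y => mvfderiv I f y (X y)
  let Yf : N → ℝ := fun y => mvfderiv I f y (Y y)
  have hXf : MDifferentiableAt I 𝓘(ℝ) Xf x :=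
    (contMDiff_vectorField_apply hX f).mdifferentiable (by simp) x
  have hYf : MDifferentiableAt I 𝓘(ℝ) Yf x :=
    (contMDiff_vectorField_apply hY f).mdifferentiable (by simp) x
  have h2 : ((minSmoothness ℝ 2 : WithTop ℕ∞)) ≤ ∞ := by
    rw [minSmoothness_of_isRCLikeNormedField]; exact ENat.LEInfty.out
  have hbr : ∀ {Z : ∀ y : N, TangentSpace I y},
      ContMDiff I I.tangent ∞ (fun y => (⟨y, Z y⟩ : TangentBundle I N)) →
      ContMDiffAt I I.tangent ∞ (fun y => (⟨y, mlieBracket I Z W y⟩ : TangentBundle I N)) x :=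
    fun hZ => (hZ x).mlieBracket_vectorField (m := ⊤) (n := ⊤) hW
      (by rw [minSmoothness_of_isRCLikeNormedField]; simp)
  have hWd : ∀ᶠ y in nhds x, MDifferentiableAt I I.tangent
      (fun y => (⟨y, W y⟩ : TangentBundle I N)) y := by
    obtain ⟨u, hu, hWu⟩ := (contMDiffAt_iff_contMDiffOn_nhds (n := 1) (by simp)).mp
      (hW.of_le (m := 1) ENat.LEInfty.out)
    obtain ⟨v, hvu, hv, hxv⟩ := mem_nhds_iff.mp hu
    filter_upwards [hv.mem_nhds hxv] with y hy
    exact ((hWu y (hvu hy)).contMDiffAt (Filter.mem_of_superset (hv.mem_nhds hy) hvu)).mdifferentiableAt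
      (by simp)
  have hev : ∀ {Z : ∀ y : N, TangentSpace I y},
      mlieBracket I Z (⇑f • W) =ᶠ[nhds x]
        (fun y => mvfderiv I f y (Z y)) • W + ⇑f • mlieBracket I Z W := by
    intro Z
    filter_upwards [hWd] with y hy
    exact mlieBracket_smul_right (hfd y) hy
  have hfW : ContMDiffAt I I.tangent ∞ (fun y => (⟨y, (⇑f • W) y⟩ : TangentBundle I N)) x :=
    (f.contMDiff x).smul_section hW
  have hd : ∀ {Z : ∀ y : N, TangentSpace I y},
      ContMDiffAt I I.tangent ∞ (fun y => (⟨y, Z y⟩ : TangentBundle I N)) x →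
      MDifferentiableAt I I.tangent (fun y => (⟨y, Z y⟩ : TangentBundle I N)) x :=
    fun h => h.mdifferentiableAt (by simp)
  have key := leibniz_identity_mlieBracket_apply (I := I) ((hX x).of_le h2) ((hY x).of_le h2)
    (hfW.of_le h2)
  have key' := leibniz_identity_mlieBracket_apply (I := I) ((hX x).of_le h2) ((hY x).of_le h2)
    (hW.of_le h2)
  have e1 : mlieBracket I X (mlieBracket I Y (⇑f • W)) x =
      mlieBracket I X (Yf • W + ⇑f • mlieBracket I Y W) x :=
    Filter.EventuallyEq.mlieBracket_vectorField_eq Filter.EventuallyEq.rfl (hev (Z := Y))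
  have e2 : mlieBracket I Y (mlieBracket I X (⇑f • W)) x =
      mlieBracket I Y (Xf • W + ⇑f • mlieBracket I X W) x :=
    Filter.EventuallyEq.mlieBracket_vectorField_eq Filter.EventuallyEq.rfl (hev (Z := X))
  rw [e1, e2,
    mlieBracket_add_right (hYf.smul_section (hd hW)) ((hfd x).smul_section (hd (hbr hY))),
    mlieBracket_add_right (hXf.smul_section (hd hW)) ((hfd x).smul_section (hd (hbr hX))),
    mlieBracket_smul_right (hfd x) (hd hW), mlieBracket_smul_right hYf (hd hW),
    mlieBracket_smul_right (hfd x) (hd (hbr hY)), mlieBracket_smul_right hXf (hd hW),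
    mlieBracket_smul_right (hfd x) (hd (hbr hX)), key'] at key
  rw [hWx] at key
  have key2 : (mvfderiv I f x (mlieBracket I X Y x) -
      (mvfderiv I Yf x (X x) - mvfderiv I Xf x (Y x))) • w = 0 := by
    simp only [Xf, Yf] at key ⊢
    rw [sub_smul, sub_smul]
    rw [← sub_eq_zero] at key
    rw [← neg_inj, neg_zero, ← key]
    module
  have := (smul_eq_zero.mp key2).resolve_right hw
  exact sub_eq_zero.mp this
end VectorFields

section Separation
variable {EB M : Type*} [NormedAddCommGroup EB] [NormedSpace ℝ EB] [FiniteDimensional ℝ EB]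
  [TopologicalSpace M] [ChartedSpace EB M] [IsManifold 𝓘(ℝ, EB) ∞ M] [T2Space M]

lemma exists_bump {x : M} {U : Set M} (hU : U ∈ nhds x) :
    ∃ χ : C^∞⟮𝓘(ℝ, EB), M; ℝ⟯, (∀ᶠ y in nhds x, χ y = 1) ∧ tsupport χ ⊆ U := by
  obtain ⟨f, -, hf⟩ := (SmoothBumpFunction.nhds_basis_tsupport (I := 𝓘(ℝ, EB)) x).mem_iff.mp hU
  exact ⟨⟨f, f.contMDiff⟩, f.eventuallyEq_one, hf⟩

/-- A function which is smooth near a point agrees near that point with a global smooth one. -/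
lemma exists_global_fun {x : M} {U : Set M} (hU : U ∈ nhds x) {f : M → ℝ}
    (hf : ContMDiffOn 𝓘(ℝ, EB) 𝓘(ℝ) ∞ f U) :
    ∃ g : C^∞⟮𝓘(ℝ, EB), M; ℝ⟯, ∀ᶠ y in nhds x, g y = f y := by
  obtain ⟨χ, h1, h2⟩ := exists_bump (EB := EB) (interior_mem_nhds.mpr hU)
  refine ⟨⟨fun y => χ y * f y, contMDiff_of_tsupport fun y hy => ?_⟩, ?_⟩
  · have hy' : y ∈ interior U := h2 (tsupport_mul_subset_left hy)
    exact (χ.contMDiff y).mul (hf.contMDiffAt (mem_interior_iff_mem_nhds.mp hy'))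
  · filter_upwards [h1] with y hy
    change χ y * f y = f y
    rw [hy, one_mul]

/-- Smooth functions separate tangent vectors. -/
lemma tangent_ext {x : M} {v w : TangentSpace 𝓘(ℝ, EB) x}
    (h : ∀ f : C^∞⟮𝓘(ℝ, EB), M; ℝ⟯, mvfderiv 𝓘(ℝ, EB) f x v = mvfderiv 𝓘(ℝ, EB) f x w) : v = w := by
  have hinj : Function.Injective (mfderiv 𝓘(ℝ, EB) 𝓘(ℝ, EB) (extChartAt 𝓘(ℝ, EB) x) x) :=
    (isInvertible_mfderiv_extChartAt (mem_extChartAt_source x)).injective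
  apply hinj
  have hd : MDifferentiableAt 𝓘(ℝ, EB) 𝓘(ℝ, EB) (extChartAt 𝓘(ℝ, EB) x) x :=
    mdifferentiableAt_extChartAt (mem_chart_source _ x)
  by_contra hne
  obtain ⟨l, hl⟩ := SeparatingDual.exists_separating_of_ne (R := ℝ) (V := EB) hne
  have hsm : ContMDiffOn 𝓘(ℝ, EB) 𝓘(ℝ) ∞ (fun y => l (extChartAt 𝓘(ℝ, EB) x y))
      (chartAt EB x).source :=
    l.contMDiff.comp_contMDiffOn contMDiffOn_extChartAt
  obtain ⟨g, hg⟩ := exists_global_fun ((chartAt EB x).open_source.mem_nhds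
    (mem_chart_source EB x)) hsm
  apply hl
  have hg' : mvfderiv 𝓘(ℝ, EB) g x =
      l.comp (mfderiv 𝓘(ℝ, EB) 𝓘(ℝ, EB) (extChartAt 𝓘(ℝ, EB) x) x) := by
    have h1 : mfderiv 𝓘(ℝ, EB) 𝓘(ℝ) g x =
        mfderiv 𝓘(ℝ, EB) 𝓘(ℝ) (l ∘ extChartAt 𝓘(ℝ, EB) x) x :=
      Filter.EventuallyEq.mfderiv_eq hg
    have h2 := mfderiv_comp x (l.mdifferentiableAt (x := extChartAt 𝓘(ℝ, EB) x x)) hd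
    rw [h2, ContinuousLinearMap.mfderiv_eq] at h1
    ext u
    exact DFunLike.congr_fun h1 u
  have := h g
  rw [hg'] at this
  exact this
end Separation

section SectionModule
variable {EB : Type*} [NormedAddCommGroup EB] [NormedSpace ℝ EB]
  {M : Type*} [TopologicalSpace M] [ChartedSpace EB M]
  {F : Type*} [NormedAddCommGroup F] [NormedSpace ℝ F]
  {V : M → Type*} [TopologicalSpace (TotalSpace F V)] [∀ x, AddCommGroup (V x)]
  [∀ x, Module ℝ (V x)] [∀ x, TopologicalSpace (V x)] [FiberBundle F V] [VectorBundle ℝ F V]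

instance : Module C^∞⟮𝓘(ℝ, EB), M; ℝ⟯ Cₛ^∞⟮𝓘(ℝ, EB); F, V⟯ where
  smul f s := ⟨fun x => f x • s x, fun x => (f.contMDiff x).smul_section (s.contMDiff x)⟩
  one_smul s := by ext x; exact one_smul ℝ (s x)
  mul_smul f g s := by ext x; exact mul_smul (f x) (g x) (s x)
  smul_zero f := by ext x; exact smul_zero (f x)
  smul_add f s t := by ext x; exact smul_add (f x) (s x) (t x)
  add_smul f g s := by ext x; exact add_smul (f x) (g x) (s x)
  zero_smul s := by ext x; exact zero_smul ℝ (s x)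

lemma section_smul_apply (f : C^∞⟮𝓘(ℝ, EB), M; ℝ⟯) (s : Cₛ^∞⟮𝓘(ℝ, EB); F, V⟯) (x : M) :
    (f • s) x = f x • s x := rfl

instance : IsScalarTower ℝ C^∞⟮𝓘(ℝ, EB), M; ℝ⟯ Cₛ^∞⟮𝓘(ℝ, EB); F, V⟯ where
  smul_assoc c f s := by ext x; exact smul_assoc c (f x) (s x)

variable (EB F V) in
/-- A Lie algebroid structure on the vector bundle `V` over `M`: an anchor, which is a smooth
bundle map to the tangent bundle, and a Lie bracket on smooth sections. -/
structure LieAlgebroid [IsManifold 𝓘(ℝ, EB) ∞ M] where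
  anchor : ∀ x : M, V x →ₗ[ℝ] TangentSpace 𝓘(ℝ, EB) x
  contMDiff_anchor : ContMDiff (𝓘(ℝ, EB).prod 𝓘(ℝ, F)) 𝓘(ℝ, EB).tangent ∞
    (fun u : TotalSpace F V => (⟨u.proj, anchor u.proj u.2⟩ : TangentBundle 𝓘(ℝ, EB) M))
  bracket : Cₛ^∞⟮𝓘(ℝ, EB); F, V⟯ →ₗ[ℝ] Cₛ^∞⟮𝓘(ℝ, EB); F, V⟯ →ₗ[ℝ] Cₛ^∞⟮𝓘(ℝ, EB); F, V⟯
  bracket_self : ∀ s, bracket s s = 0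
  jacobi : ∀ s t u, bracket s (bracket t u) = bracket (bracket s t) u + bracket t (bracket s u)
  anchor_bracket : ∀ s t (x : M), anchor x (bracket s t x) =
    VectorField.mlieBracket 𝓘(ℝ, EB) (fun y => anchor y (s y)) (fun y => anchor y (t y)) x
  leibniz : ∀ s (f : C^∞⟮𝓘(ℝ, EB), M; ℝ⟯) t (x : M), bracket s (f • t) x =
    f x • bracket s t x + mvfderiv 𝓘(ℝ, EB) f x (anchor x (s x)) • t x

namespace LieAlgebroid
variable [IsManifold 𝓘(ℝ, EB) ∞ M] (𝔏 : LieAlgebroid EB F V)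

lemma contMDiff_anchor_section (s : Cₛ^∞⟮𝓘(ℝ, EB); F, V⟯) :
    ContMDiff 𝓘(ℝ, EB) 𝓘(ℝ, EB).tangent ∞
      (fun x => (⟨x, 𝔏.anchor x (s x)⟩ : TangentBundle 𝓘(ℝ, EB) M)) :=
  𝔏.contMDiff_anchor.comp s.contMDiff

/-- The bracket of a Lie algebroid, with the anchor read as the action of sections on smooth
functions. -/
def anchoredBracket : AnchoredBracket C^∞⟮𝓘(ℝ, EB), M; ℝ⟯ Cₛ^∞⟮𝓘(ℝ, EB); F, V⟯ where
  anchor :=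
    { toFun := fun s => vectorFieldDerivation _ (𝔏.contMDiff_anchor_section s)
      map_add' := fun s t => by
        ext f x
        change mvfderiv _ f x (𝔏.anchor x (s x + t x)) = mvfderiv _ f x (𝔏.anchor x (s x)) +
          mvfderiv _ f x (𝔏.anchor x (t x))
        rw [map_add, map_add]
      map_smul' := fun g s => by
        ext f x
        change mvfderiv _ f x (𝔏.anchor x (g x • s x)) =
          g x • mvfderiv _ f x (𝔏.anchor x (s x))
        rw [map_smul, map_smul] }
  bracket := 𝔏.bracket
  bracket_self := 𝔏.bracket_self
  bracket_smul s f t := by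
    ext x
    exact 𝔏.leibniz s f t x

lemma smul_bracket_apply (f : C^∞⟮𝓘(ℝ, EB), M; ℝ⟯) (s t) (x : M) :
    𝔏.bracket (f • s) t x = f x • 𝔏.bracket s t x
      - mvfderiv 𝓘(ℝ, EB) f x (𝔏.anchor x (t x)) • s x :=
  congrArg (fun u : Cₛ^∞⟮𝓘(ℝ, EB); F, V⟯ => u x) (𝔏.anchoredBracket.smul_bracket f s t)

end LieAlgebroid
end SectionModule

section Tot
variable {EB : Type*} [NormedAddCommGroup EB] [NormedSpace ℝ EB]
  {M : Type*} [TopologicalSpace M] [ChartedSpace EB M] [IsManifold 𝓘(ℝ, EB) ∞ M]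
  {F : Type*} [NormedAddCommGroup F] [NormedSpace ℝ F]
  {V : M → Type*} [TopologicalSpace (TotalSpace F V)] [∀ x, AddCommGroup (V x)]
  [∀ x, Module ℝ (V x)] [∀ x, TopologicalSpace (V x)] [FiberBundle F V] [VectorBundle ℝ F V]
  [ContMDiffVectorBundle ∞ F V 𝓘(ℝ, EB)]

lemma tangentBundle_mk_congr {E H N : Type*} [NormedAddCommGroup E] [NormedSpace ℝ E]
    [TopologicalSpace H] {I : ModelWithCorners ℝ E H} [TopologicalSpace N] [ChartedSpace H N]
    {a b : N} {v w : E} (h : a = b) (h' : v = w) :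
    (⟨a, (v : TangentSpace I a)⟩ : TangentBundle I N) = ⟨b, (w : TangentSpace I b)⟩ := by
  subst h h'
  rfl

lemma contMDiffAt_tangentMap {E H N : Type*} [NormedAddCommGroup E] [NormedSpace ℝ E]
    [TopologicalSpace H] {I : ModelWithCorners ℝ E H} [TopologicalSpace N] [ChartedSpace H N]
    {E' H' N' : Type*} [NormedAddCommGroup E'] [NormedSpace ℝ E']
    [TopologicalSpace H'] {I' : ModelWithCorners ℝ E' H'} [TopologicalSpace N'] [ChartedSpace H' N']
    [IsManifold I 1 N] [IsManifold I' 1 N']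
    {f : N → N'} {U : Set N} (hU : IsOpen U) (hf : ContMDiffOn I I' ∞ f U)
    {v : TangentBundle I N} (hv : v.proj ∈ U) :
    ContMDiffAt I.tangent I'.tangent ∞ (tangentMap I I' f) v := by
  have h := hf.contMDiffOn_tangentMapWithin (m := ∞) (by simp) hU.uniqueMDiffOn
  have ho : IsOpen (TotalSpace.proj ⁻¹' U : Set (TangentBundle I N)) :=
    hU.preimage (FiberBundle.continuous_proj E (TangentSpace I))
  refine (h.contMDiffAt (ho.mem_nhds hv)).congr_of_eventuallyEq ?_
  filter_upwards [ho.mem_nhds hv] with w hw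
  exact (tangentMapWithin_eq_tangentMap (hU.uniqueMDiffOn _ hw)
    ((hf.contMDiffAt (hU.mem_nhds hw)).mdifferentiableAt (by simp))).symm

/-- The tangent map `p_*` of the projection `p` of a vector bundle. -/
def dproj (EB : Type*) [NormedAddCommGroup EB] [NormedSpace ℝ EB] {M : Type*} [TopologicalSpace M]
    [ChartedSpace EB M] {F : Type*} [NormedAddCommGroup F] [NormedSpace ℝ F]
    {V : M → Type*} [TopologicalSpace (TotalSpace F V)] [∀ x, TopologicalSpace (V x)]
    [FiberBundle F V] (y : TotalSpace F V) :
    TangentSpace (𝓘(ℝ, EB).prod 𝓘(ℝ, F)) y →L[ℝ] TangentSpace 𝓘(ℝ, EB) y.proj :=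
  mfderiv (𝓘(ℝ, EB).prod 𝓘(ℝ, F)) 𝓘(ℝ, EB) (TotalSpace.proj : TotalSpace F V → M) y

/-- The derivative of the fibre coordinate of a local trivialization. -/
def dfib (EB : Type*) [NormedAddCommGroup EB] [NormedSpace ℝ EB] {M : Type*} [TopologicalSpace M]
    [ChartedSpace EB M] {F : Type*} [NormedAddCommGroup F] [NormedSpace ℝ F]
    {V : M → Type*} [TopologicalSpace (TotalSpace F V)] [∀ x, TopologicalSpace (V x)]
    [FiberBundle F V] (e : Trivialization F (TotalSpace.proj : TotalSpace F V → M))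
    (y : TotalSpace F V) :
    TangentSpace (𝓘(ℝ, EB).prod 𝓘(ℝ, F)) y →L[ℝ] F :=
  mvfderiv (𝓘(ℝ, EB).prod 𝓘(ℝ, F)) (fun y' => (e y').2) y

variable (e : Trivialization F (TotalSpace.proj : TotalSpace F V → M)) [MemTrivializationAtlas e]

lemma contMDiffAt_fib {y : TotalSpace F V} (hy : y.proj ∈ e.baseSet) :
    ContMDiffAt (𝓘(ℝ, EB).prod 𝓘(ℝ, F)) 𝓘(ℝ, F) ∞ (fun y' : TotalSpace F V => (e y').2) y :=
  ((Trivialization.contMDiffAt_iff (IB := 𝓘(ℝ, EB)) (e := e) (e.mem_source.mpr hy)).mp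
    contMDiffAt_id).2

lemma mfderiv_triv {y : TotalSpace F V} (hy : y.proj ∈ e.baseSet)
    (z : TangentSpace (𝓘(ℝ, EB).prod 𝓘(ℝ, F)) y) :
    mfderiv (𝓘(ℝ, EB).prod 𝓘(ℝ, F)) (𝓘(ℝ, EB).prod 𝓘(ℝ, F)) e y z =
      (dproj EB y z, dfib EB e y z) := by
  have h1 : mfderiv (𝓘(ℝ, EB).prod 𝓘(ℝ, F)) (𝓘(ℝ, EB).prod 𝓘(ℝ, F)) e y =
      mfderiv (𝓘(ℝ, EB).prod 𝓘(ℝ, F)) (𝓘(ℝ, EB).prod 𝓘(ℝ, F)) (fun y' => (y'.proj, (e y').2)) y := by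
    apply Filter.EventuallyEq.mfderiv_eq
    filter_upwards [e.open_source.mem_nhds (e.mem_source.mpr hy)] with y' hy'
    exact Prod.ext (e.coe_fst hy') rfl
  have h2 := mfderiv_prodMk (I := 𝓘(ℝ, EB).prod 𝓘(ℝ, F)) (I' := 𝓘(ℝ, EB)) (I'' := 𝓘(ℝ, F))
    (((Bundle.contMDiff_proj (n := ∞) (IB := 𝓘(ℝ, EB)) V).mdifferentiable (by simp)) y)
    ((contMDiffAt_fib e hy).mdifferentiableAt (by simp))
  rw [h2] at h1
  exact DFunLike.congr_fun h1 z

lemma mdiff_triv_symm {y : TotalSpace F V} (hy : y.proj ∈ e.baseSet) :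
    ContMDiffAt (𝓘(ℝ, EB).prod 𝓘(ℝ, F)) (𝓘(ℝ, EB).prod 𝓘(ℝ, F)) ∞
      e.toOpenPartialHomeomorph.symm (e y) :=
  (Trivialization.contMDiffOn_symm (IB := 𝓘(ℝ, EB)) (n := ∞) e).contMDiffAt
    (e.open_target.mem_nhds (e.map_source (e.mem_source.mpr hy)))

lemma mdiff_triv {y : TotalSpace F V} (hy : y.proj ∈ e.baseSet) :
    ContMDiffAt (𝓘(ℝ, EB).prod 𝓘(ℝ, F)) (𝓘(ℝ, EB).prod 𝓘(ℝ, F)) ∞ e y :=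
  (Trivialization.contMDiffOn (IB := 𝓘(ℝ, EB)) (n := ∞) e).contMDiffAt
    (e.open_source.mem_nhds (e.mem_source.mpr hy))

lemma mfderiv_symm_triv {y : TotalSpace F V} (hy : y.proj ∈ e.baseSet)
    (z : TangentSpace (𝓘(ℝ, EB).prod 𝓘(ℝ, F)) y) :
    (mfderiv (𝓘(ℝ, EB).prod 𝓘(ℝ, F)) (𝓘(ℝ, EB).prod 𝓘(ℝ, F))
      e.toOpenPartialHomeomorph.symm (e y) (dproj EB y z, dfib EB e y z) : EB × F) = z := by
  have h := mfderiv_comp y ((mdiff_triv_symm (EB := EB) e hy).mdifferentiableAt (by simp))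
    ((mdiff_triv (EB := EB) e hy).mdifferentiableAt (by simp))
  have h3 : (e.toOpenPartialHomeomorph.symm ∘ e) =ᶠ[nhds y] id := by
    filter_upwards [e.open_source.mem_nhds (e.mem_source.mpr hy)] with y' hy'
    exact e.toOpenPartialHomeomorph.left_inv hy'
  have h4 := h3.mfderiv_eq (I := 𝓘(ℝ, EB).prod 𝓘(ℝ, F)) (I' := 𝓘(ℝ, EB).prod 𝓘(ℝ, F))
  rw [mfderiv_id] at h4
  have h5 := h.symm.trans h4
  have h6 := mfderiv_triv e hy z
  exact (congrArg (mfderiv (𝓘(ℝ, EB).prod 𝓘(ℝ, F)) (𝓘(ℝ, EB).prod 𝓘(ℝ, F))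
      e.toOpenPartialHomeomorph.symm (e y)) h6.symm).trans (DFunLike.congr_fun h5 z)

/-- A tangent vector of the total space is determined by its two coordinates. -/
lemma tot_ext {y : TotalSpace F V} (hy : y.proj ∈ e.baseSet)
    {z z' : TangentSpace (𝓘(ℝ, EB).prod 𝓘(ℝ, F)) y} (h1 : dproj EB y z = dproj EB y z')
    (h2 : dfib EB e y z = dfib EB e y z') : z = z' := by
  rw [← mfderiv_symm_triv e hy z, ← mfderiv_symm_triv e hy z', h1, h2]

lemma contMDiffAt_totalField {y : TotalSpace F V} (hy : y.proj ∈ e.baseSet)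
    {Z : ∀ y : TotalSpace F V, TangentSpace (𝓘(ℝ, EB).prod 𝓘(ℝ, F)) y}
    (h1 : ContMDiffAt (𝓘(ℝ, EB).prod 𝓘(ℝ, F)) 𝓘(ℝ, EB).tangent ∞
      (fun y' => (⟨y'.proj, dproj EB y' (Z y')⟩ : TangentBundle 𝓘(ℝ, EB) M)) y)
    (h2 : ContMDiffAt (𝓘(ℝ, EB).prod 𝓘(ℝ, F)) 𝓘(ℝ, F) ∞ (fun y' => dfib EB e y' (Z y')) y) :
    ContMDiffAt (𝓘(ℝ, EB).prod 𝓘(ℝ, F)) (𝓘(ℝ, EB).prod 𝓘(ℝ, F)).tangent ∞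
      (fun y' => (⟨y', Z y'⟩ : TangentBundle (𝓘(ℝ, EB).prod 𝓘(ℝ, F)) (TotalSpace F V))) y := by
  have : IsManifold 𝓘(ℝ, EB) 1 M := IsManifold.of_le (n := ∞) (by simp)
  have h3 : ContMDiffAt (𝓘(ℝ, EB).prod 𝓘(ℝ, F)) 𝓘(ℝ, F).tangent ∞
      (fun y' => (⟨(e y').2, dfib EB e y' (Z y')⟩ : TangentBundle 𝓘(ℝ, F) F)) y :=
    by
    rw [Bundle.contMDiffAt_totalSpace]
    refine ⟨contMDiffAt_fib e hy, ?_⟩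
    simpa using h2
  have h4 := (contMDiff_equivTangentBundleProd_symm (n := ∞) (I := 𝓘(ℝ, EB)) (M := M)
    (I' := 𝓘(ℝ, F)) (M' := F)).contMDiffAt.comp y (h1.prodMk h3)
  have h5 : ContMDiffAt (𝓘(ℝ, EB).prod 𝓘(ℝ, F)).tangent (𝓘(ℝ, EB).prod 𝓘(ℝ, F)).tangent ∞
      (tangentMap (𝓘(ℝ, EB).prod 𝓘(ℝ, F)) (𝓘(ℝ, EB).prod 𝓘(ℝ, F))
        e.toOpenPartialHomeomorph.symm)
      ((equivTangentBundleProd 𝓘(ℝ, EB) M 𝓘(ℝ, F) F).symm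
        (⟨y.proj, dproj EB y (Z y)⟩, ⟨(e y).2, dfib EB e y (Z y)⟩)) := by
    refine contMDiffAt_tangentMap (e.open_target)
      (Trivialization.contMDiffOn_symm (IB := 𝓘(ℝ, EB)) (n := ∞) e) ?_
    change (y.proj, (e y).2) ∈ e.target
    rw [e.mk_proj_snd' hy]
    exact e.map_source (e.mem_source.mpr hy)
  refine (h5.comp y h4).congr_of_eventuallyEq ?_
  filter_upwards [e.open_source.mem_nhds (e.mem_source.mpr hy)] with y' hy'
  have hb : y'.proj ∈ e.baseSet := e.mem_source.mp hy'
  have h6 := mfderiv_symm_triv e hb (Z y')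
  have key : ∀ q : M × F, q = e y' → (⟨y', Z y'⟩ : TangentBundle (𝓘(ℝ, EB).prod 𝓘(ℝ, F))
      (TotalSpace F V)) = ⟨e.toOpenPartialHomeomorph.symm q,
        mfderiv (𝓘(ℝ, EB).prod 𝓘(ℝ, F)) (𝓘(ℝ, EB).prod 𝓘(ℝ, F))
        e.toOpenPartialHomeomorph.symm q (dproj EB y' (Z y'), dfib EB e y' (Z y'))⟩ := by
    rintro _ rfl
    exact tangentBundle_mk_congr (e.toOpenPartialHomeomorph.left_inv hy').symm h6.symm
  exact key _ (e.mk_proj_snd' hb)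
end Tot

section Local
variable {EB : Type*} [NormedAddCommGroup EB] [NormedSpace ℝ EB]
  {M : Type*} [TopologicalSpace M] [ChartedSpace EB M] [IsManifold 𝓘(ℝ, EB) ∞ M]
  {F : Type*} [NormedAddCommGroup F] [NormedSpace ℝ F]
  {V : M → Type*} [TopologicalSpace (TotalSpace F V)] [∀ x, AddCommGroup (V x)]
  [∀ x, Module ℝ (V x)] [∀ x, TopologicalSpace (V x)] [FiberBundle F V] [VectorBundle ℝ F V]
  [ContMDiffVectorBundle ∞ F V 𝓘(ℝ, EB)]
  (e : Trivialization F (TotalSpace.proj : TotalSpace F V → M)) [MemTrivializationAtlas e]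

lemma fib_eq {x : M} (hx : x ∈ e.baseSet) (v : V x) :
    (e ⟨x, v⟩).2 = e.linearMapAt ℝ x v := by
  rw [e.linearMapAt_apply, if_pos hx]

lemma fib_add {x : M} (hx : x ∈ e.baseSet) (v w : V x) :
    (e ⟨x, v + w⟩).2 = (e ⟨x, v⟩).2 + (e ⟨x, w⟩).2 := by
  simp only [fib_eq e hx, map_add]

lemma fib_smul {x : M} (hx : x ∈ e.baseSet) (c : ℝ) (v : V x) :
    (e ⟨x, c • v⟩).2 = c • (e ⟨x, v⟩).2 := by
  simp only [fib_eq e hx, map_smul]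

lemma fib_sub {x : M} (hx : x ∈ e.baseSet) (v w : V x) :
    (e ⟨x, v - w⟩).2 = (e ⟨x, v⟩).2 - (e ⟨x, w⟩).2 := by
  simp only [fib_eq e hx, map_sub]

lemma fib_zero {x : M} (hx : x ∈ e.baseSet) : (e ⟨x, (0 : V x)⟩).2 = 0 := by
  simp only [fib_eq e hx, map_zero]

lemma fib_sum {x : M} (hx : x ∈ e.baseSet) {ι : Type*} (S : Finset ι) (v : ι → V x) :
    (e ⟨x, ∑ i ∈ S, v i⟩).2 = ∑ i ∈ S, (e ⟨x, v i⟩).2 := by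
  simp only [fib_eq e hx, map_sum]

lemma fib_inj {x : M} (hx : x ∈ e.baseSet) {v w : V x} (h : (e ⟨x, v⟩).2 = (e ⟨x, w⟩).2) :
    v = w := by
  rw [fib_eq e hx, fib_eq e hx] at h
  rw [← e.symmₗ_linearMapAt (R := ℝ) hx v, h, e.symmₗ_linearMapAt hx]

lemma contMDiffAt_fib_section (s : Cₛ^∞⟮𝓘(ℝ, EB); F, V⟯) {x : M} (hx : x ∈ e.baseSet) :
    ContMDiffAt 𝓘(ℝ, EB) 𝓘(ℝ, F) ∞ (fun x' => (e ⟨x', s x'⟩).2) x :=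
  (e.contMDiffAt_section_iff hx).mp (s.contMDiff x)

lemma section_sum {ι : Type*} (S : Finset ι) (E : ι → Cₛ^∞⟮𝓘(ℝ, EB); F, V⟯) (x : M) :
    (∑ i ∈ S, E i) x = ∑ i ∈ S, E i x := by
  have := map_sum (ContMDiffSection.coeAddHom 𝓘(ℝ, EB) F ∞ V) E S
  have := congrFun this x
  rw [Finset.sum_apply] at this
  exact this

lemma section_sub_sum {ι : Type*} (S : Finset ι) (r : Cₛ^∞⟮𝓘(ℝ, EB); F, V⟯)
    (G : ι → C^∞⟮𝓘(ℝ, EB), M; ℝ⟯) (E : ι → Cₛ^∞⟮𝓘(ℝ, EB); F, V⟯) (x : M) :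
    (r - ∑ i ∈ S, G i • E i) x = r x - ∑ i ∈ S, G i x • E i x := by
  rw [ContMDiffSection.coe_sub, Pi.sub_apply, section_sum]
  rfl

lemma mvfderiv_sum_smul_const {E H N : Type*} [NormedAddCommGroup E] [NormedSpace ℝ E]
    [TopologicalSpace H] {I : ModelWithCorners ℝ E H} [TopologicalSpace N] [ChartedSpace H N]
    {ι : Type*} (S : Finset ι) {G : ι → N → ℝ} {x : N}
    (hd : ∀ i, MDifferentiableAt I 𝓘(ℝ) (G i) x) (b : ι → F) (v : TangentSpace I x) :
    mvfderiv I (fun x' => ∑ i ∈ S, G i x' • b i) x v = ∑ i ∈ S, mvfderiv I (G i) x v • b i := by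
  have main : MDifferentiableAt I 𝓘(ℝ, F) (fun x' => ∑ i ∈ S, G i x' • b i) x ∧
    mvfderiv I (fun x' => ∑ i ∈ S, G i x' • b i) x v = ∑ i ∈ S, mvfderiv I (G i) x v • b i := by
    classical
    induction S using Finset.induction_on with
    | empty =>
      simp only [Finset.sum_empty, mvfderiv_const]
      exact ⟨mdifferentiableAt_const, rfl⟩
    | insert i S hi ih =>
      have h1 : MDifferentiableAt I 𝓘(ℝ, F) (fun x' => G i x' • b i) x :=
        (hd i).smul mdifferentiableAt_const
      have h2 : mvfderiv I (fun x' => G i x' • b i) x v = mvfderiv I (G i) x v • b i := by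
        have := mvfderiv_smul (hd i) (mdifferentiableAt_const (c := b i) (I := I) (x := x))
        have := DFunLike.congr_fun this v
        exact this.trans (by simp [mvfderiv_const])
      simp only [Finset.sum_insert hi]
      refine ⟨h1.add ih.1, ?_⟩
      have := DFunLike.congr_fun (mvfderiv_add h1 ih.1) v
      exact this.trans (congrArg₂ (· + ·) h2 ih.2)
  exact main.2

variable [T2Space M] [FiniteDimensional ℝ EB]

lemma exists_const_section {x : M} (hx : x ∈ e.baseSet) (a : F) :
    ∃ E : Cₛ^∞⟮𝓘(ℝ, EB); F, V⟯, ∀ᶠ x' in nhds x, (e ⟨x', E x'⟩).2 = a := by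
  obtain ⟨χ, h1, h2⟩ := exists_bump (EB := EB) (e.open_baseSet.mem_nhds hx)
  have hs : ContMDiffOn 𝓘(ℝ, EB) (𝓘(ℝ, EB).prod 𝓘(ℝ, F)) ∞
      (fun x' => (⟨x', e.symm x' a⟩ : TotalSpace F V)) e.baseSet := by
    intro x' hx'
    refine (ContMDiffAt.contMDiffWithinAt ?_)
    rw [e.contMDiffAt_section_iff hx']
    refine (contMDiffAt_const (c := a)).congr_of_eventuallyEq ?_
    filter_upwards [e.open_baseSet.mem_nhds hx'] with z hz
    rw [e.apply_mk_symm hz]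
  refine ⟨⟨_, ContMDiffOn.smul_section_of_tsupport χ.contMDiff.contMDiffOn e.open_baseSet h2 hs⟩, ?_⟩
  filter_upwards [h1, e.open_baseSet.mem_nhds hx] with z hz hz'
  change (e ⟨z, χ z • e.symm z a⟩).2 = a
  rw [hz, one_smul, e.apply_mk_symm hz']

variable (EB) in
lemma exists_section_eq (y : TotalSpace F V) :
    ∃ t : Cₛ^∞⟮𝓘(ℝ, EB); F, V⟯, t y.proj = y.2 := by
  have hx := mem_baseSet_trivializationAt F V y.proj
  obtain ⟨E, hE⟩ := exists_const_section (EB := EB) (trivializationAt F V y.proj) hx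
    ((trivializationAt F V y.proj) y).2
  exact ⟨E, fib_inj _ hx hE.self_of_nhds⟩

variable (EB) in
/-- A global smooth section through a given point of the total space. -/
def sectionThrough (y : TotalSpace F V) : Cₛ^∞⟮𝓘(ℝ, EB); F, V⟯ := (exists_section_eq EB y).choose

lemma sectionThrough_apply (y : TotalSpace F V) : sectionThrough EB y y.proj = y.2 :=
  (exists_section_eq EB y).choose_spec

lemma LieAlgebroid.bracket_eq_zero (𝔏 : LieAlgebroid EB F V) (s r : Cₛ^∞⟮𝓘(ℝ, EB); F, V⟯) {x : M}
    (hr : ∀ᶠ x' in nhds x, r x' = 0) : 𝔏.bracket s r x = 0 := by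
  obtain ⟨χ, h1, h2⟩ := exists_bump (EB := EB) hr
  have hr' : r = (1 - χ) • r := by
    ext x'
    change r x' = (1 - χ x') • r x'
    by_cases h : x' ∈ tsupport χ
    · rw [show r x' = 0 from h2 h, smul_zero]
    · rw [image_eq_zero_of_notMem_tsupport h, sub_zero, one_smul]
  rw [hr', 𝔏.leibniz]
  rw [hr.self_of_nhds, smul_zero, add_zero]
  change (1 - χ x) • _ = 0
  rw [h1.self_of_nhds, sub_self, zero_smul]

variable [FiniteDimensional ℝ F]

lemma LieAlgebroid.fib_bracket (𝔏 : LieAlgebroid EB F V) (s r : Cₛ^∞⟮𝓘(ℝ, EB); F, V⟯) {x : M}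
    (hx : x ∈ e.baseSet) (hr : r x = 0) : (e ⟨x, 𝔏.bracket s r x⟩).2 =
      mvfderiv 𝓘(ℝ, EB) (fun x' => (e ⟨x', r x'⟩).2) x (𝔏.anchor x (s x)) := by
  let b := Module.finBasis ℝ F
  have hco : ∀ i, ContMDiffOn 𝓘(ℝ, EB) 𝓘(ℝ) ∞
      (fun x' => (b.coord i).toContinuousLinearMap (e ⟨x', r x'⟩).2) e.baseSet := fun i x' hx' =>
    ((b.coord i).toContinuousLinearMap.contMDiff.contMDiffAt.comp x'
      (contMDiffAt_fib_section e r hx')).contMDiffWithinAt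
  choose G hG using fun i => exists_global_fun (e.open_baseSet.mem_nhds hx) (hco i)
  choose E hE using fun i => exists_const_section (EB := EB) e hx (b i)
  have hq : ∀ᶠ x' in nhds x, (r - ∑ i, G i • E i) x' = 0 := by
    filter_upwards [Filter.eventually_all.mpr hG, Filter.eventually_all.mpr hE,
      e.open_baseSet.mem_nhds hx] with x' h1 h2 h3
    apply fib_inj e h3
    rw [section_sub_sum, fib_sub e h3, fib_sum e h3, fib_zero e h3]
    simp only [fib_smul e h3, h1, h2]
    rw [sub_eq_zero]
    exact (b.sum_repr _).symm
  have h1 : 𝔏.bracket s r x = ∑ i, mvfderiv 𝓘(ℝ, EB) (G i) x (𝔏.anchor x (s x)) • E i x := by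
    have h2 := 𝔏.bracket_eq_zero s _ hq
    rw [map_sub, map_sum, ContMDiffSection.coe_sub, Pi.sub_apply, section_sum, sub_eq_zero] at h2
    rw [h2]
    refine Finset.sum_congr rfl fun i _ => ?_
    have : G i x = 0 := by
      rw [(hG i).self_of_nhds, hr, fib_zero e hx, map_zero]
    rw [𝔏.leibniz, this, zero_smul, zero_add]
  rw [h1, fib_sum e hx]
  have h4 : (fun x' => (e ⟨x', r x'⟩).2) =ᶠ[nhds x] fun x' => ∑ i, G i x' • b i := by
    filter_upwards [Filter.eventually_all.mpr hG] with x' h1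
    simp only [h1]
    exact (b.sum_repr _).symm
  have hd : ∀ i, MDifferentiableAt 𝓘(ℝ, EB) 𝓘(ℝ) (G i) x := fun i =>
    (G i).contMDiff.mdifferentiable (by simp) x
  have h5 : mvfderiv 𝓘(ℝ, EB) (fun x' => (e ⟨x', r x'⟩).2) x =
      mvfderiv 𝓘(ℝ, EB) (fun x' => ∑ i, G i x' • b i) x := h4.mfderiv_eq
  rw [h5, mvfderiv_sum_smul_const _ hd]
  refine Finset.sum_congr rfl fun i _ => ?_
  rw [fib_smul e hx, (hE i).self_of_nhds]
end Local

section Prolong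
variable {EB : Type*} [NormedAddCommGroup EB] [NormedSpace ℝ EB]
  {M : Type*} [TopologicalSpace M] [ChartedSpace EB M] [IsManifold 𝓘(ℝ, EB) ∞ M]
  {F : Type*} [NormedAddCommGroup F] [NormedSpace ℝ F]
  {V : M → Type*} [TopologicalSpace (TotalSpace F V)] [∀ x, AddCommGroup (V x)]
  [∀ x, Module ℝ (V x)] [∀ x, TopologicalSpace (V x)] [FiberBundle F V] [VectorBundle ℝ F V]
  [ContMDiffVectorBundle ∞ F V 𝓘(ℝ, EB)]
  (e : Trivialization F (TotalSpace.proj : TotalSpace F V → M)) [MemTrivializationAtlas e]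

section Aux
variable {E H N : Type*} [NormedAddCommGroup E] [NormedSpace ℝ E]
    [TopologicalSpace H] {I : ModelWithCorners ℝ E H} [TopologicalSpace N] [ChartedSpace H N]

lemma dproj_mfderiv {g : N → TotalSpace F V} {n : N} {y : TotalSpace F V} (h : g n = y)
    (hg : MDifferentiableAt I (𝓘(ℝ, EB).prod 𝓘(ℝ, F)) g n) (v : TangentSpace I n) :
    (dproj EB y (mfderiv I (𝓘(ℝ, EB).prod 𝓘(ℝ, F)) g n v : EB × F) : EB) =
      mfderiv I 𝓘(ℝ, EB) (fun n' => (g n').proj) n v := by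
  subst h
  have h1 := mfderiv_comp n (((Bundle.contMDiff_proj (n := ∞) (IB := 𝓘(ℝ, EB)) V).mdifferentiable
    (by simp)) (g n)) hg
  exact (DFunLike.congr_fun h1 v).symm

lemma dfib_mfderiv {g : N → TotalSpace F V} {n : N} {y : TotalSpace F V} (h : g n = y)
    (hy : y.proj ∈ e.baseSet)
    (hg : MDifferentiableAt I (𝓘(ℝ, EB).prod 𝓘(ℝ, F)) g n) (v : TangentSpace I n) :
    dfib EB e y (mfderiv I (𝓘(ℝ, EB).prod 𝓘(ℝ, F)) g n v : EB × F) =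
      mvfderiv I (fun n' => (e (g n')).2) n v := by
  subst h
  have h1 := mfderiv_comp n ((contMDiffAt_fib (EB := EB) e hy).mdifferentiableAt (by simp)) hg
  exact (DFunLike.congr_fun h1 v).symm
end Aux

variable (EB) in
/-- The tangent vector at `y` of the curve `ε ↦ y + ε w` in the fibre through `y`. -/
def verticalVector (y : TotalSpace F V) (w : V y.proj) :
    TangentSpace (𝓘(ℝ, EB).prod 𝓘(ℝ, F)) y :=
  (mfderiv 𝓘(ℝ) (𝓘(ℝ, EB).prod 𝓘(ℝ, F))
    (fun ε : ℝ => (⟨y.proj, y.2 + ε • w⟩ : TotalSpace F V)) 0 (1 : ℝ) : EB × F)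

lemma line_zero (y : TotalSpace F V) (w : V y.proj) :
    (fun ε : ℝ => (⟨y.proj, y.2 + ε • w⟩ : TotalSpace F V)) 0 = y := by
  simp

lemma mdiff_line (y : TotalSpace F V) (w : V y.proj) :
    MDifferentiableAt 𝓘(ℝ) (𝓘(ℝ, EB).prod 𝓘(ℝ, F))
      (fun ε : ℝ => (⟨y.proj, y.2 + ε • w⟩ : TotalSpace F V)) 0 := by
  have hx := mem_baseSet_trivializationAt F V y.proj
  refine ContMDiffAt.mdifferentiableAt (n := ∞) ?_ (by simp)
  rw [Trivialization.contMDiffAt_iff (e := trivializationAt F V y.proj)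
    (((trivializationAt F V y.proj)).mem_source.mpr hx)]
  refine ⟨contMDiffAt_const, ?_⟩
  simp only [fib_add _ hx, fib_smul _ hx]
  exact (contDiff_const.add (contDiff_id.smul contDiff_const)).contMDiff.contMDiffAt

lemma dproj_verticalVector (y : TotalSpace F V) (w : V y.proj) :
    dproj EB y (verticalVector EB y w) = 0 := by
  refine (dproj_mfderiv (y := y) (I := 𝓘(ℝ)) (g := fun ε : ℝ => (⟨y.proj, y.2 + ε • w⟩ : TotalSpace F V)) (n := (0 : ℝ))
    (line_zero y w) (mdiff_line (EB := EB) y w) (1 : ℝ)).trans ?_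
  exact DFunLike.congr_fun (mfderiv_const (I := 𝓘(ℝ)) (I' := 𝓘(ℝ, EB)) (c := y.proj)) (1 : ℝ)

lemma dfib_verticalVector {y : TotalSpace F V} (hy : y.proj ∈ e.baseSet) (w : V y.proj) :
    dfib EB e y (verticalVector EB y w) = (e ⟨y.proj, w⟩).2 := by
  refine (dfib_mfderiv (y := y) (I := 𝓘(ℝ)) (g := fun ε : ℝ => (⟨y.proj, y.2 + ε • w⟩ : TotalSpace F V)) (n := (0 : ℝ))
    e (line_zero y w) hy (mdiff_line (EB := EB) y w) (1 : ℝ)).trans ?_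
  simp only [fib_add _ hy, fib_smul _ hy]
  have h : HasFDerivAt (fun ε : ℝ => (e ⟨y.proj, y.2⟩).2 + ε • (e ⟨y.proj, w⟩).2)
      ((ContinuousLinearMap.id ℝ ℝ).smulRight (e ⟨y.proj, w⟩).2) 0 :=
    ((hasFDerivAt_id (0 : ℝ)).smul_const _).const_add _
  have h2 := h.hasMFDerivAt.mfderiv
  refine (DFunLike.congr_fun h2 (1 : ℝ)).trans ?_
  exact one_smul ℝ _

/-- The fibre at `y` of the prolongation: the pairs `(u, z)` with `ρ(u) = p_*(z)`. -/
def LieAlgebroid.prolongFiber (𝔏 : LieAlgebroid EB F V) (y : TotalSpace F V) :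
    Submodule ℝ (V y.proj × TangentSpace (𝓘(ℝ, EB).prod 𝓘(ℝ, F)) y) where
  carrier := {w | 𝔏.anchor y.proj w.1 = dproj EB y w.2}
  add_mem' {a b} ha hb := by
    simp only [Set.mem_ofPred_eq, Prod.fst_add, Prod.snd_add, map_add] at *
    rw [ha, hb]
  zero_mem' := by simp
  smul_mem' c a ha := by
    simp only [Set.mem_ofPred_eq, Prod.smul_fst, Prod.smul_snd, map_smul] at *
    rw [ha]

lemma contMDiff_base_iff {σ : ∀ y : TotalSpace F V, V y.proj} :
    ContMDiff (𝓘(ℝ, EB).prod 𝓘(ℝ, F)) (𝓘(ℝ, EB).prod 𝓘(ℝ, F)) ∞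
        (fun y => (⟨y.proj, σ y⟩ : TotalSpace F V)) ↔
      ∀ y₀ : TotalSpace F V, ContMDiffAt (𝓘(ℝ, EB).prod 𝓘(ℝ, F)) 𝓘(ℝ, F) ∞
        (fun y => (trivializationAt F V y₀.proj ⟨y.proj, σ y⟩).2) y₀ := by
  refine forall_congr' fun y₀ => ?_
  rw [Trivialization.contMDiffAt_iff (e := trivializationAt F V y₀.proj)
    ((trivializationAt F V y₀.proj).mem_source.mpr (mem_baseSet_trivializationAt F V y₀.proj))]
  exact and_iff_right ((Bundle.contMDiff_proj (n := ∞) (IB := 𝓘(ℝ, EB)) V) y₀)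

lemma eventually_mem_baseSet {y : TotalSpace F V} (hy : y.proj ∈ e.baseSet) :
    ∀ᶠ y' in nhds y, y'.proj ∈ e.baseSet :=
  (FiberBundle.continuous_proj F V).continuousAt.eventually (e.open_baseSet.mem_nhds hy)

lemma contMDiff_base_add {σ τ : ∀ y : TotalSpace F V, V y.proj}
    (hσ : ContMDiff (𝓘(ℝ, EB).prod 𝓘(ℝ, F)) (𝓘(ℝ, EB).prod 𝓘(ℝ, F)) ∞
        (fun y => (⟨y.proj, σ y⟩ : TotalSpace F V)))
    (hτ : ContMDiff (𝓘(ℝ, EB).prod 𝓘(ℝ, F)) (𝓘(ℝ, EB).prod 𝓘(ℝ, F)) ∞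
        (fun y => (⟨y.proj, τ y⟩ : TotalSpace F V))) :
    ContMDiff (𝓘(ℝ, EB).prod 𝓘(ℝ, F)) (𝓘(ℝ, EB).prod 𝓘(ℝ, F)) ∞
        (fun y => (⟨y.proj, σ y + τ y⟩ : TotalSpace F V)) := by
  rw [contMDiff_base_iff] at *
  intro y₀
  refine ((hσ y₀).add (hτ y₀)).congr_of_eventuallyEq ?_
  filter_upwards [eventually_mem_baseSet _ (mem_baseSet_trivializationAt F V y₀.proj)] with y hy
  exact fib_add _ hy _ _

lemma contMDiff_base_smul {f : TotalSpace F V → ℝ} {σ : ∀ y : TotalSpace F V, V y.proj}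
    (hf : ContMDiff (𝓘(ℝ, EB).prod 𝓘(ℝ, F)) 𝓘(ℝ) ∞ f)
    (hσ : ContMDiff (𝓘(ℝ, EB).prod 𝓘(ℝ, F)) (𝓘(ℝ, EB).prod 𝓘(ℝ, F)) ∞
        (fun y => (⟨y.proj, σ y⟩ : TotalSpace F V))) :
    ContMDiff (𝓘(ℝ, EB).prod 𝓘(ℝ, F)) (𝓘(ℝ, EB).prod 𝓘(ℝ, F)) ∞
        (fun y => (⟨y.proj, f y • σ y⟩ : TotalSpace F V)) := by
  rw [contMDiff_base_iff] at *
  intro y₀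
  refine ((hf y₀).smul (hσ y₀)).congr_of_eventuallyEq ?_
  filter_upwards [eventually_mem_baseSet _ (mem_baseSet_trivializationAt F V y₀.proj)] with y hy
  exact fib_smul _ hy _ _

lemma contMDiff_base_zero :
    ContMDiff (𝓘(ℝ, EB).prod 𝓘(ℝ, F)) (𝓘(ℝ, EB).prod 𝓘(ℝ, F)) ∞
        (fun y : TotalSpace F V => (⟨y.proj, 0⟩ : TotalSpace F V)) := by
  rw [contMDiff_base_iff]
  intro y₀
  refine (contMDiffAt_const (c := 0)).congr_of_eventuallyEq ?_
  filter_upwards [eventually_mem_baseSet _ (mem_baseSet_trivializationAt F V y₀.proj)] with y hy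
  exact fib_zero _ hy

/-- The smooth sections of the prolongation `L^p(V)`, a vector bundle over the total space of
`V`. -/
def LieAlgebroid.prolongSections (𝔏 : LieAlgebroid EB F V) :
    Submodule ℝ (∀ y : TotalSpace F V, V y.proj × TangentSpace (𝓘(ℝ, EB).prod 𝓘(ℝ, F)) y) where
  carrier := {σ | (∀ y, σ y ∈ 𝔏.prolongFiber y) ∧
    ContMDiff (𝓘(ℝ, EB).prod 𝓘(ℝ, F)) (𝓘(ℝ, EB).prod 𝓘(ℝ, F)) ∞
      (fun y => (⟨y.proj, (σ y).1⟩ : TotalSpace F V)) ∧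
    ContMDiff (𝓘(ℝ, EB).prod 𝓘(ℝ, F)) (𝓘(ℝ, EB).prod 𝓘(ℝ, F)).tangent ∞
      (fun y => (⟨y, (σ y).2⟩ : TangentBundle (𝓘(ℝ, EB).prod 𝓘(ℝ, F)) (TotalSpace F V)))}
  add_mem' ha hb := ⟨fun y => add_mem (ha.1 y) (hb.1 y), contMDiff_base_add ha.2.1 hb.2.1,
    ha.2.2.add_section hb.2.2⟩
  zero_mem' := ⟨fun _ => zero_mem _, contMDiff_base_zero, Bundle.contMDiff_zeroSection _ _⟩
  smul_mem' c _ ha := ⟨fun y => Submodule.smul_mem _ c (ha.1 y),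
    contMDiff_base_smul contMDiff_const ha.2.1, ContMDiff.smul_section contMDiff_const ha.2.2⟩

variable {𝔏 : LieAlgebroid EB F V}

instance : Module C^∞⟮𝓘(ℝ, EB).prod 𝓘(ℝ, F), TotalSpace F V; ℝ⟯ 𝔏.prolongSections where
  smul f σ := ⟨fun y => f y • σ.1 y, fun y => Submodule.smul_mem _ (f y) (σ.2.1 y),
    contMDiff_base_smul f.contMDiff σ.2.2.1, f.contMDiff.smul_section σ.2.2.2⟩
  one_smul σ := Subtype.ext <| funext fun y => one_smul ℝ (σ.1 y)
  mul_smul f g σ := Subtype.ext <| funext fun y => mul_smul (f y) (g y) (σ.1 y)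
  smul_zero f := Subtype.ext <| funext fun y => smul_zero (f y)
  smul_add f σ τ := Subtype.ext <| funext fun y => smul_add (f y) (σ.1 y) (τ.1 y)
  add_smul f g σ := Subtype.ext <| funext fun y => add_smul (f y) (g y) (σ.1 y)
  zero_smul σ := Subtype.ext <| funext fun y => zero_smul ℝ (σ.1 y)

lemma prolong_smul_apply (f : C^∞⟮𝓘(ℝ, EB).prod 𝓘(ℝ, F), TotalSpace F V; ℝ⟯)
    (σ : 𝔏.prolongSections) (y : TotalSpace F V) : (f • σ).1 y = f y • σ.1 y := rfl

instance : IsScalarTower ℝ C^∞⟮𝓘(ℝ, EB).prod 𝓘(ℝ, F), TotalSpace F V; ℝ⟯ 𝔏.prolongSections where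
  smul_assoc c f σ := Subtype.ext <| funext fun y => smul_assoc c (f y) (σ.1 y)

lemma contMDiffAt_fib_comp (s : Cₛ^∞⟮𝓘(ℝ, EB); F, V⟯) {y : TotalSpace F V}
    (hy : y.proj ∈ e.baseSet) : ContMDiffAt (𝓘(ℝ, EB).prod 𝓘(ℝ, F)) 𝓘(ℝ, F) ∞
      (fun y' : TotalSpace F V => (e ⟨y'.proj, s y'.proj⟩).2) y :=
  (contMDiffAt_fib_section e s hy).comp y
    ((Bundle.contMDiff_proj (n := ∞) (IB := 𝓘(ℝ, EB)) V) y)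

lemma contMDiff_base_comp (s : Cₛ^∞⟮𝓘(ℝ, EB); F, V⟯) :
    ContMDiff (𝓘(ℝ, EB).prod 𝓘(ℝ, F)) (𝓘(ℝ, EB).prod 𝓘(ℝ, F)) ∞
        (fun y : TotalSpace F V => (⟨y.proj, s y.proj⟩ : TotalSpace F V)) :=
  s.contMDiff.comp (Bundle.contMDiff_proj (n := ∞) (IB := 𝓘(ℝ, EB)) V)

lemma contMDiff_verticalVector (s : Cₛ^∞⟮𝓘(ℝ, EB); F, V⟯) :
    ContMDiff (𝓘(ℝ, EB).prod 𝓘(ℝ, F)) (𝓘(ℝ, EB).prod 𝓘(ℝ, F)).tangent ∞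
      (fun y => (⟨y, verticalVector EB y (s y.proj)⟩ :
        TangentBundle (𝓘(ℝ, EB).prod 𝓘(ℝ, F)) (TotalSpace F V))) := by
  intro y₀
  have hx := mem_baseSet_trivializationAt F V y₀.proj
  refine contMDiffAt_totalField (trivializationAt F V y₀.proj) hx ?_ ?_
  · simp only [dproj_verticalVector]
    exact ((Bundle.contMDiff_zeroSection ℝ (TangentSpace 𝓘(ℝ, EB))).comp
      (Bundle.contMDiff_proj (n := ∞) (IB := 𝓘(ℝ, EB)) V)) y₀
  · refine (contMDiffAt_fib_comp (trivializationAt F V y₀.proj) s hx).congr_of_eventuallyEq ?_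
    filter_upwards [eventually_mem_baseSet _ hx] with y hy
    exact dfib_verticalVector _ hy _

/-- The vertical lift of a section of `V`, as a section of the prolongation. -/
def LieAlgebroid.verticalLift (𝔏 : LieAlgebroid EB F V) :
    Cₛ^∞⟮𝓘(ℝ, EB); F, V⟯ →ₗ[ℝ] 𝔏.prolongSections where
  toFun s := ⟨fun y => (0, verticalVector EB y (s y.proj)), fun y => by
      change 𝔏.anchor y.proj 0 = dproj EB y _
      rw [dproj_verticalVector, map_zero],
    contMDiff_base_zero, contMDiff_verticalVector s⟩
  map_add' s t := by
    refine Subtype.ext <| funext fun y => Prod.ext (add_zero _).symm ?_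
    have hx := mem_baseSet_trivializationAt F V y.proj
    refine tot_ext _ hx ?_ ?_
    · change dproj EB y (verticalVector EB y (s y.proj + t y.proj)) = dproj EB y
        (verticalVector EB y (s y.proj) + verticalVector EB y (t y.proj))
      rw [map_add]
      simp only [dproj_verticalVector, add_zero]
    · change dfib EB _ y (verticalVector EB y (s y.proj + t y.proj)) = dfib EB _ y
        (verticalVector EB y (s y.proj) + verticalVector EB y (t y.proj))
      rw [map_add]
      simp only [dfib_verticalVector _ hx, fib_add _ hx]
  map_smul' c s := by
    refine Subtype.ext <| funext fun y => Prod.ext (smul_zero _).symm ?_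
    have hx := mem_baseSet_trivializationAt F V y.proj
    refine tot_ext _ hx ?_ ?_
    · change dproj EB y (verticalVector EB y (c • s y.proj)) = dproj EB y
        (c • verticalVector EB y (s y.proj))
      rw [map_smul]
      simp only [dproj_verticalVector, smul_zero]
    · change dfib EB _ y (verticalVector EB y (c • s y.proj)) = dfib EB _ y
        (c • verticalVector EB y (s y.proj))
      rw [map_smul]
      simp only [dfib_verticalVector _ hx, fib_smul _ hx]

end Prolong

section Complete
variable {EB : Type*} [NormedAddCommGroup EB] [NormedSpace ℝ EB]
  {M : Type*} [TopologicalSpace M] [ChartedSpace EB M] [IsManifold 𝓘(ℝ, EB) ∞ M]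
  {F : Type*} [NormedAddCommGroup F] [NormedSpace ℝ F]
  {V : M → Type*} [TopologicalSpace (TotalSpace F V)] [∀ x, AddCommGroup (V x)]
  [∀ x, Module ℝ (V x)] [∀ x, TopologicalSpace (V x)] [FiberBundle F V] [VectorBundle ℝ F V]
  [ContMDiffVectorBundle ∞ F V 𝓘(ℝ, EB)]
  (e : Trivialization F (TotalSpace.proj : TotalSpace F V → M)) [MemTrivializationAtlas e]

/-- The image of `v` under the tangent map of a section `t` with `t(p(y)) = y`. -/
def sectionTangent (t : Cₛ^∞⟮𝓘(ℝ, EB); F, V⟯) (y : TotalSpace F V)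
    (v : TangentSpace 𝓘(ℝ, EB) y.proj) : TangentSpace (𝓘(ℝ, EB).prod 𝓘(ℝ, F)) y :=
  (mfderiv 𝓘(ℝ, EB) (𝓘(ℝ, EB).prod 𝓘(ℝ, F))
      (fun x => (⟨x, t x⟩ : TotalSpace F V)) y.proj v : EB × F)

lemma dproj_tangentSection (t : Cₛ^∞⟮𝓘(ℝ, EB); F, V⟯) {y : TotalSpace F V} (h : t y.proj = y.2)
    (v : TangentSpace 𝓘(ℝ, EB) y.proj) :
    dproj EB y (sectionTangent t y v) = v := by
  refine (dproj_mfderiv (y := y) (g := fun x => (⟨x, t x⟩ : TotalSpace F V))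
    (by rw [h]) (t.contMDiff.mdifferentiable (by simp) y.proj) v).trans ?_
  exact DFunLike.congr_fun (mfderiv_id (I := 𝓘(ℝ, EB)) (x := y.proj)) v

lemma dfib_tangentSection (t : Cₛ^∞⟮𝓘(ℝ, EB); F, V⟯) {y : TotalSpace F V} (h : t y.proj = y.2)
    (hy : y.proj ∈ e.baseSet) (v : TangentSpace 𝓘(ℝ, EB) y.proj) :
    dfib EB e y (sectionTangent t y v) =
        mvfderiv 𝓘(ℝ, EB) (fun x => (e ⟨x, t x⟩).2) y.proj v :=
  dfib_mfderiv (y := y) e (g := fun x => (⟨x, t x⟩ : TotalSpace F V))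
    (by rw [h]) hy (t.contMDiff.mdifferentiable (by simp) y.proj) v

/-- The function `f ∘ p` on the total space. -/
def verticalLiftFun (F : Type*) [NormedAddCommGroup F] [NormedSpace ℝ F]
    (V : M → Type*) [TopologicalSpace (TotalSpace F V)] [∀ x, AddCommGroup (V x)]
    [∀ x, Module ℝ (V x)] [∀ x, TopologicalSpace (V x)] [FiberBundle F V] [VectorBundle ℝ F V]
    [ContMDiffVectorBundle ∞ F V 𝓘(ℝ, EB)] (f : C^∞⟮𝓘(ℝ, EB), M; ℝ⟯) :
    C^∞⟮𝓘(ℝ, EB).prod 𝓘(ℝ, F), TotalSpace F V; ℝ⟯ :=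
  ⟨fun y => f y.proj, f.contMDiff.comp (Bundle.contMDiff_proj (n := ∞) (IB := 𝓘(ℝ, EB)) V)⟩

/-- The function `u ↦ ρ(u) f` on the total space. -/
def LieAlgebroid.completeLiftFun (𝔏 : LieAlgebroid EB F V) (f : C^∞⟮𝓘(ℝ, EB), M; ℝ⟯) :
    C^∞⟮𝓘(ℝ, EB).prod 𝓘(ℝ, F), TotalSpace F V; ℝ⟯ :=
  ⟨fun y => mvfderiv 𝓘(ℝ, EB) f y.proj (𝔏.anchor y.proj y.2),
    (contMDiff_snd_tangentBundle_modelSpace ℝ 𝓘(ℝ)).comp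
      ((f.contMDiff.contMDiff_tangentMap (m := ∞) (by simp)).comp 𝔏.contMDiff_anchor)⟩

lemma verticalLift_smul (𝔏 : LieAlgebroid EB F V) (f : C^∞⟮𝓘(ℝ, EB), M; ℝ⟯)
    (s : Cₛ^∞⟮𝓘(ℝ, EB); F, V⟯) :
    𝔏.verticalLift (f • s) = verticalLiftFun F V f • 𝔏.verticalLift s := by
  refine Subtype.ext <| funext fun y => Prod.ext (smul_zero _).symm ?_
  have hx := mem_baseSet_trivializationAt F V y.proj
  refine tot_ext _ hx ?_ ?_
  · change dproj EB y (verticalVector EB y (f y.proj • s y.proj)) = dproj EB y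
      (f y.proj • verticalVector EB y (s y.proj))
    rw [map_smul]
    simp only [dproj_verticalVector, smul_zero]
  · change dfib EB _ y (verticalVector EB y (f y.proj • s y.proj)) = dfib EB _ y
      (f y.proj • verticalVector EB y (s y.proj))
    rw [map_smul]
    simp only [dfib_verticalVector _ hx, fib_smul _ hx]

variable [T2Space M] [FiniteDimensional ℝ EB]

/-- The value at `y` of the vector field underlying the complete lift of `s`: if `t` is a section
with `t(x) = y`, then it is the image of `ρ(s)(x)` under the tangent map of `t`, minus the vertical
vector at `y` given by `[s, t](x)`. This does not depend on `t`. -/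
def LieAlgebroid.completeVector (𝔏 : LieAlgebroid EB F V) (s : Cₛ^∞⟮𝓘(ℝ, EB); F, V⟯)
    (y : TotalSpace F V) : TangentSpace (𝓘(ℝ, EB).prod 𝓘(ℝ, F)) y :=
  sectionTangent (sectionThrough EB y) y (𝔏.anchor y.proj (s y.proj)) -
    verticalVector EB y (𝔏.bracket s (sectionThrough EB y) y.proj)

variable (𝔏 : LieAlgebroid EB F V)

lemma dproj_completeVector (s : Cₛ^∞⟮𝓘(ℝ, EB); F, V⟯) (y : TotalSpace F V) :
    dproj EB y (𝔏.completeVector s y) = 𝔏.anchor y.proj (s y.proj) := by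
  rw [LieAlgebroid.completeVector, map_sub, dproj_verticalVector, sub_zero]
  exact dproj_tangentSection _ (sectionThrough_apply y) _

variable [FiniteDimensional ℝ F]

lemma fib_bracket_sub (s t t' : Cₛ^∞⟮𝓘(ℝ, EB); F, V⟯) {x : M} (hx : x ∈ e.baseSet)
    (h : t x = t' x) :
    mvfderiv 𝓘(ℝ, EB) (fun x => (e ⟨x, t x⟩).2) x (𝔏.anchor x (s x)) -
      (e ⟨x, 𝔏.bracket s t x⟩).2 =
    mvfderiv 𝓘(ℝ, EB) (fun x => (e ⟨x, t' x⟩).2) x (𝔏.anchor x (s x)) -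
      (e ⟨x, 𝔏.bracket s t' x⟩).2 := by
  have h1 := 𝔏.fib_bracket e s (t - t') hx (by
    rw [ContMDiffSection.coe_sub, Pi.sub_apply, h, sub_self])
  rw [map_sub, ContMDiffSection.coe_sub, Pi.sub_apply, fib_sub e hx] at h1
  have h2 : (fun x' => (e ⟨x', (t - t') x'⟩).2) =ᶠ[nhds x]
      ((fun x' => (e ⟨x', t x'⟩).2) - fun x' => (e ⟨x', t' x'⟩).2) := by
    filter_upwards [e.open_baseSet.mem_nhds hx] with x' hx'
    exact fib_sub e hx' _ _
  have h3 : mvfderiv 𝓘(ℝ, EB) (fun x' => (e ⟨x', (t - t') x'⟩).2) x = _ := h2.mfderiv_eq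
  have h4 := mvfderiv_sub ((contMDiffAt_fib_section e t hx).mdifferentiableAt (by simp))
    ((contMDiffAt_fib_section e t' hx).mdifferentiableAt (by simp))
  rw [h3] at h1
  have h5 := h1.trans (DFunLike.congr_fun h4 (𝔏.anchor x (s x)))
  rw [sub_apply] at h5
  rw [sub_eq_sub_iff_sub_eq_sub, h5]

lemma dfib_completeVector (s t : Cₛ^∞⟮𝓘(ℝ, EB); F, V⟯) {y : TotalSpace F V}
    (hy : y.proj ∈ e.baseSet) (h : t y.proj = y.2) :
    dfib EB e y (𝔏.completeVector s y) =
      mvfderiv 𝓘(ℝ, EB) (fun x => (e ⟨x, t x⟩).2) y.proj (𝔏.anchor y.proj (s y.proj)) -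
        (e ⟨y.proj, 𝔏.bracket s t y.proj⟩).2 := by
  rw [LieAlgebroid.completeVector, map_sub, dfib_verticalVector e hy, fib_bracket_sub e 𝔏 s t (sectionThrough EB y) hy
    (h.trans (sectionThrough_apply y).symm)]
  congr 1
  exact dfib_tangentSection e _ (sectionThrough_apply y) hy _

lemma contMDiff_completeVector (s : Cₛ^∞⟮𝓘(ℝ, EB); F, V⟯) :
    ContMDiff (𝓘(ℝ, EB).prod 𝓘(ℝ, F)) (𝓘(ℝ, EB).prod 𝓘(ℝ, F)).tangent ∞
      (fun y => (⟨y, 𝔏.completeVector s y⟩ :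
        TangentBundle (𝓘(ℝ, EB).prod 𝓘(ℝ, F)) (TotalSpace F V))) := by
  intro y₀
  set e := trivializationAt F V y₀.proj
  have hx : y₀.proj ∈ e.baseSet := mem_baseSet_trivializationAt F V y₀.proj
  refine contMDiffAt_totalField e hx ?_ ?_
  · simp only [dproj_completeVector]
    exact ((𝔏.contMDiff_anchor_section s).comp
      (Bundle.contMDiff_proj (n := ∞) (IB := 𝓘(ℝ, EB)) V)) y₀
  let b := Module.finBasis ℝ F
  choose E hE using fun i => exists_const_section (EB := EB) e hx (b i)
  have hE' : ∀ᶠ y : TotalSpace F V in nhds y₀, ∀ᶠ x' in nhds y.proj, ∀ i, (e ⟨x', E i x'⟩).2 = b i :=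
    (FiberBundle.continuous_proj F V).continuousAt.eventually
      (Filter.eventually_all.mpr hE).eventually_nhds
  have main : (fun y => dfib EB e y (𝔏.completeVector s y)) =ᶠ[nhds y₀]
      fun y => - ∑ i, (b.coord i).toContinuousLinearMap (e y).2 •
        (e ⟨y.proj, 𝔏.bracket s (E i) y.proj⟩).2 := by
    filter_upwards [hE', eventually_mem_baseSet _ hx] with y h1 hy
    set t : Cₛ^∞⟮𝓘(ℝ, EB); F, V⟯ := ∑ i, b.repr (e y).2 i • E i
    have ht : ∀ᶠ x' in nhds y.proj, (e ⟨x', t x'⟩).2 = (e y).2 := by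
      filter_upwards [h1, e.open_baseSet.mem_nhds hy] with x' h2 h3
      rw [section_sum, fib_sum e h3]
      refine Eq.trans ?_ (b.sum_repr (e y).2)
      refine Finset.sum_congr rfl fun i _ => ?_
      change (e ⟨x', b.repr (e y).2 i • E i x'⟩).2 = _
      rw [fib_smul e h3, h2]
    rw [dfib_completeVector e 𝔏 s t hy (fib_inj e hy ht.self_of_nhds)]
    have h4 : mvfderiv 𝓘(ℝ, EB) (fun x => (e ⟨x, t x⟩).2) y.proj =
      mvfderiv 𝓘(ℝ, EB) (fun _ => (e y).2) y.proj := Filter.EventuallyEq.mfderiv_eq ht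
    rw [h4, mvfderiv_const, zero_apply, zero_sub, map_sum, section_sum,
      fib_sum e hy]
    congr 1
    refine Finset.sum_congr rfl fun i _ => ?_
    rw [map_smul]
    exact fib_smul e hy _ _
  refine ContMDiffAt.congr_of_eventuallyEq ?_ main
  refine ContMDiffAt.neg (ContMDiffAt.sum fun i _ => ?_)
  exact ((b.coord i).toContinuousLinearMap.contMDiff.contMDiffAt.comp y₀
    (contMDiffAt_fib e hx)).smul (contMDiffAt_fib_comp e _ hx)

/-- The complete lift of a section of `V`, as a section of the prolongation. -/
def LieAlgebroid.completeLift : Cₛ^∞⟮𝓘(ℝ, EB); F, V⟯ →ₗ[ℝ] 𝔏.prolongSections where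
  toFun s := ⟨fun y => (s y.proj, 𝔏.completeVector s y),
    fun y => (dproj_completeVector 𝔏 s y).symm,
    contMDiff_base_comp s, contMDiff_completeVector 𝔏 s⟩
  map_add' s s' := by
    refine Subtype.ext <| funext fun y => Prod.ext rfl ?_
    have hx := mem_baseSet_trivializationAt F V y.proj
    have ht := sectionThrough_apply (EB := EB) y
    refine tot_ext _ hx ?_ ?_
    · change dproj EB y (𝔏.completeVector (s + s') y) = dproj EB y
        (𝔏.completeVector s y + 𝔏.completeVector s' y)
      rw [map_add]
      simp only [dproj_completeVector]
      exact map_add _ _ _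
    · change dfib EB _ y (𝔏.completeVector (s + s') y) = dfib EB _ y
        (𝔏.completeVector s y + 𝔏.completeVector s' y)
      rw [map_add]
      simp only [dfib_completeVector _ 𝔏 _ _ hx ht, map_add, LinearMap.add_apply,
        ContMDiffSection.coe_add, Pi.add_apply, fib_add _ hx]
      abel
  map_smul' c s := by
    refine Subtype.ext <| funext fun y => Prod.ext rfl ?_
    have hx := mem_baseSet_trivializationAt F V y.proj
    have ht := sectionThrough_apply (EB := EB) y
    refine tot_ext _ hx ?_ ?_
    · change dproj EB y (𝔏.completeVector (c • s) y) = dproj EB y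
        (c • 𝔏.completeVector s y)
      rw [map_smul]
      simp only [dproj_completeVector]
      exact map_smul _ _ _
    · change dfib EB _ y (𝔏.completeVector (c • s) y) = dfib EB _ y
        (c • 𝔏.completeVector s y)
      rw [map_smul]
      simp only [dfib_completeVector _ 𝔏 _ _ hx ht, map_smul, LinearMap.smul_apply,
        ContMDiffSection.coe_smul, Pi.smul_apply, fib_smul _ hx, smul_sub]

lemma completeLift_smul (f : C^∞⟮𝓘(ℝ, EB), M; ℝ⟯) (s : Cₛ^∞⟮𝓘(ℝ, EB); F, V⟯) :
    𝔏.completeLift (f • s) = verticalLiftFun F V f • 𝔏.completeLift s +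
      𝔏.completeLiftFun f • 𝔏.verticalLift s := by
  refine Subtype.ext <| funext fun y => Prod.ext ?_ ?_
  · change f y.proj • s y.proj = f y.proj • s y.proj + 𝔏.completeLiftFun f y • (0 : V y.proj)
    rw [smul_zero, add_zero]
  have hx := mem_baseSet_trivializationAt F V y.proj
  have ht := sectionThrough_apply (EB := EB) y
  refine tot_ext _ hx ?_ ?_
  · change dproj EB y (𝔏.completeVector (f • s) y) = dproj EB y
      (f y.proj • 𝔏.completeVector s y + 𝔏.completeLiftFun f y • verticalVector EB y (s y.proj))
    rw [map_add, map_smul, map_smul]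
    simp only [dproj_completeVector, dproj_verticalVector, smul_zero, add_zero]
    exact map_smul _ _ _
  · change dfib EB _ y (𝔏.completeVector (f • s) y) = dfib EB _ y
      (f y.proj • 𝔏.completeVector s y +
        mvfderiv 𝓘(ℝ, EB) f y.proj (𝔏.anchor y.proj y.2) • verticalVector EB y (s y.proj))
    rw [map_add, map_smul, map_smul]
    simp only [dfib_completeVector _ 𝔏 _ _ hx ht, dfib_verticalVector _ hx, section_smul_apply,
      map_smul, 𝔏.smul_bracket_apply, fib_sub _ hx, fib_smul _ hx, ht, smul_sub]
    abel

end Complete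

section PBracket
variable {EB : Type*} [NormedAddCommGroup EB] [NormedSpace ℝ EB]
  {M : Type*} [TopologicalSpace M] [ChartedSpace EB M] [IsManifold 𝓘(ℝ, EB) ∞ M]
  {F : Type*} [NormedAddCommGroup F] [NormedSpace ℝ F]
  {V : M → Type*} [TopologicalSpace (TotalSpace F V)] [∀ x, AddCommGroup (V x)]
  [∀ x, Module ℝ (V x)] [∀ x, TopologicalSpace (V x)] [FiberBundle F V] [VectorBundle ℝ F V]
  [ContMDiffVectorBundle ∞ F V 𝓘(ℝ, EB)]
  (e : Trivialization F (TotalSpace.proj : TotalSpace F V → M)) [MemTrivializationAtlas e]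

lemma contMDiffAt_mvfderiv {E H N G : Type*} [NormedAddCommGroup E] [NormedSpace ℝ E]
    [TopologicalSpace H] {I : ModelWithCorners ℝ E H} [TopologicalSpace N] [ChartedSpace H N]
    [IsManifold I ∞ N] [NormedAddCommGroup G] [NormedSpace ℝ G] {f : N → G} {U : Set N}
    (hU : IsOpen U) (hf : ContMDiffOn I 𝓘(ℝ, G) ∞ f U) {Z : ∀ x : N, TangentSpace I x} {x : N}
    (hx : x ∈ U) (hZ : ContMDiffAt I I.tangent ∞ (fun x => (⟨x, Z x⟩ : TangentBundle I N)) x) :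
    ContMDiffAt I 𝓘(ℝ, G) ∞ (fun x => mvfderiv I f x (Z x)) x := by
  have : IsManifold I 1 N := IsManifold.of_le (n := ∞) (by simp)
  exact (contMDiff_snd_tangentBundle_modelSpace G 𝓘(ℝ, G)).contMDiffAt.comp x
    ((contMDiffAt_tangentMap hU hf (v := ⟨x, Z x⟩) hx).comp x hZ)

/-- The vertical tangent vector `z` at `y`, as an element of the fibre through `y`. -/
def verticalPart (EB : Type*) [NormedAddCommGroup EB] [NormedSpace ℝ EB] {M : Type*}
    [TopologicalSpace M] [ChartedSpace EB M]
    {F : Type*} [NormedAddCommGroup F] [NormedSpace ℝ F]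
    {V : M → Type*} [TopologicalSpace (TotalSpace F V)] [∀ x, AddCommGroup (V x)]
    [∀ x, Module ℝ (V x)] [∀ x, TopologicalSpace (V x)] [FiberBundle F V]
    (y : TotalSpace F V) (z : TangentSpace (𝓘(ℝ, EB).prod 𝓘(ℝ, F)) y) : V y.proj :=
  (trivializationAt F V y.proj).symm y.proj (dfib EB (trivializationAt F V y.proj) y z)

lemma verticalVector_verticalPart {y : TotalSpace F V}
    {z : TangentSpace (𝓘(ℝ, EB).prod 𝓘(ℝ, F)) y} (hz : dproj EB y z = 0) :
    verticalVector EB y (verticalPart EB y z) = z := by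
  have hx := mem_baseSet_trivializationAt F V y.proj
  refine tot_ext (EB := EB) _ hx ?_ ?_
  · rw [dproj_verticalVector, hz]
  · rw [dfib_verticalVector (EB := EB) _ hx, verticalPart, Trivialization.apply_mk_symm _ hx]

lemma fib_verticalPart {y : TotalSpace F V} (hy : y.proj ∈ e.baseSet)
    {z : TangentSpace (𝓘(ℝ, EB).prod 𝓘(ℝ, F)) y} (hz : dproj EB y z = 0) :
    (e ⟨y.proj, verticalPart EB y z⟩).2 = dfib EB e y z := by
  rw [← dfib_verticalVector (EB := EB) e hy, verticalVector_verticalPart hz]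

/-- The image of `z` under the tangent map of a section `η` of `V` along the projection. -/
def baseTangent (η : ∀ y : TotalSpace F V, V y.proj) (y : TotalSpace F V)
    (z : TangentSpace (𝓘(ℝ, EB).prod 𝓘(ℝ, F)) y) :
    TangentSpace (𝓘(ℝ, EB).prod 𝓘(ℝ, F)) (⟨y.proj, η y⟩ : TotalSpace F V) :=
  mfderiv (𝓘(ℝ, EB).prod 𝓘(ℝ, F)) (𝓘(ℝ, EB).prod 𝓘(ℝ, F))
    (fun y => (⟨y.proj, η y⟩ : TotalSpace F V)) y z

/-- The derivative along `z` of `η - t ∘ p`, a section of `V` along the projection that vanishes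
at `y`. -/
def derivDiff (η : ∀ y : TotalSpace F V, V y.proj) (t : Cₛ^∞⟮𝓘(ℝ, EB); F, V⟯)
    (y : TotalSpace F V) (z : TangentSpace (𝓘(ℝ, EB).prod 𝓘(ℝ, F)) y) : V y.proj :=
  verticalPart EB ⟨y.proj, η y⟩
    (baseTangent η y z - sectionTangent t ⟨y.proj, η y⟩ (dproj EB y z))

lemma dproj_diff {η : ∀ y : TotalSpace F V, V y.proj}
    (hη : ContMDiff (𝓘(ℝ, EB).prod 𝓘(ℝ, F)) (𝓘(ℝ, EB).prod 𝓘(ℝ, F)) ∞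
      (fun y => (⟨y.proj, η y⟩ : TotalSpace F V)))
    {t : Cₛ^∞⟮𝓘(ℝ, EB); F, V⟯} {y : TotalSpace F V} (ht : t y.proj = η y)
    (z : TangentSpace (𝓘(ℝ, EB).prod 𝓘(ℝ, F)) y) :
    dproj EB ⟨y.proj, η y⟩
      (baseTangent η y z - sectionTangent t ⟨y.proj, η y⟩ (dproj EB y z)) = 0 := by
  rw [map_sub, dproj_tangentSection t (y := ⟨y.proj, η y⟩) ht, sub_eq_zero]
  exact dproj_mfderiv (g := fun y => (⟨y.proj, η y⟩ : TotalSpace F V)) rfl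
    (hη.mdifferentiable (by simp) y) z

lemma fib_derivDiff {η : ∀ y : TotalSpace F V, V y.proj}
    (hη : ContMDiff (𝓘(ℝ, EB).prod 𝓘(ℝ, F)) (𝓘(ℝ, EB).prod 𝓘(ℝ, F)) ∞
      (fun y => (⟨y.proj, η y⟩ : TotalSpace F V)))
    {t : Cₛ^∞⟮𝓘(ℝ, EB); F, V⟯} {y : TotalSpace F V} (hy : y.proj ∈ e.baseSet)
    (ht : t y.proj = η y) (z : TangentSpace (𝓘(ℝ, EB).prod 𝓘(ℝ, F)) y) :
    (e ⟨y.proj, derivDiff η t y z⟩).2 =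
      mvfderiv (𝓘(ℝ, EB).prod 𝓘(ℝ, F)) (fun y => (e ⟨y.proj, η y⟩).2) y z -
        mvfderiv 𝓘(ℝ, EB) (fun x => (e ⟨x, t x⟩).2) y.proj (dproj EB y z) := by
  refine (fib_verticalPart e (y := ⟨y.proj, η y⟩) hy (dproj_diff hη ht z)).trans ?_
  rw [map_sub, dfib_tangentSection e t (y := ⟨y.proj, η y⟩) ht hy]
  congr 1
  exact dfib_mfderiv e (g := fun y => (⟨y.proj, η y⟩ : TotalSpace F V)) rfl hy
    (hη.mdifferentiable (by simp) y) z

lemma contMDiffAt_fib_base {η : ∀ y : TotalSpace F V, V y.proj}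
    (hη : ContMDiff (𝓘(ℝ, EB).prod 𝓘(ℝ, F)) (𝓘(ℝ, EB).prod 𝓘(ℝ, F)) ∞
      (fun y => (⟨y.proj, η y⟩ : TotalSpace F V)))
    {y : TotalSpace F V} (hy : y.proj ∈ e.baseSet) :
    ContMDiffAt (𝓘(ℝ, EB).prod 𝓘(ℝ, F)) 𝓘(ℝ, F) ∞ (fun y => (e ⟨y.proj, η y⟩).2) y :=
  ((Trivialization.contMDiffAt_iff (e := e) (f := fun y => (⟨y.proj, η y⟩ : TotalSpace F V))
    (e.mem_source.mpr hy)).mp (hη y)).2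

variable [T2Space M] [FiniteDimensional ℝ EB] (𝔏 : LieAlgebroid EB F V)

/-- The component in `V` of the bracket of two sections of the prolongation. With sections `s` and
`t` of `V` such that `s(x)` and `t(x)` are the components in `V` of `σ(y)` and `τ(y)`, where `x` is
the base point of `y`, it is `[s, t](x)` corrected by the derivatives of `τ - t ∘ p` along `σ` and
of `σ - s ∘ p` along `τ`. This does not depend on the choice of `s` and `t`, and it is `[s, t](x)`
if `σ` and `τ` project to `s` and `t`. -/
def LieAlgebroid.prolongBracketBase (σ τ : 𝔏.prolongSections) (y : TotalSpace F V) : V y.proj :=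
  𝔏.bracket (sectionThrough EB ⟨y.proj, (σ.1 y).1⟩) (sectionThrough EB ⟨y.proj, (τ.1 y).1⟩) y.proj +
    derivDiff (fun y => (τ.1 y).1) (sectionThrough EB ⟨y.proj, (τ.1 y).1⟩) y (σ.1 y).2 -
    derivDiff (fun y => (σ.1 y).1) (sectionThrough EB ⟨y.proj, (σ.1 y).1⟩) y (τ.1 y).2

variable {𝔏}
variable [FiniteDimensional ℝ F]

lemma fib_prolongBracketBase (σ τ : 𝔏.prolongSections) {y : TotalSpace F V}
    (hy : y.proj ∈ e.baseSet) {s t : Cₛ^∞⟮𝓘(ℝ, EB); F, V⟯} (hs : s y.proj = (σ.1 y).1)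
    (ht : t y.proj = (τ.1 y).1) :
    (e ⟨y.proj, 𝔏.prolongBracketBase σ τ y⟩).2 = (e ⟨y.proj, 𝔏.bracket s t y.proj⟩).2 +
      (mvfderiv (𝓘(ℝ, EB).prod 𝓘(ℝ, F)) (fun y => (e ⟨y.proj, (τ.1 y).1⟩).2) y (σ.1 y).2 -
        mvfderiv 𝓘(ℝ, EB) (fun x => (e ⟨x, t x⟩).2) y.proj (𝔏.anchor y.proj (s y.proj))) -
      (mvfderiv (𝓘(ℝ, EB).prod 𝓘(ℝ, F)) (fun y => (e ⟨y.proj, (σ.1 y).1⟩).2) y (τ.1 y).2 -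
        mvfderiv 𝓘(ℝ, EB) (fun x => (e ⟨x, s x⟩).2) y.proj (𝔏.anchor y.proj (t y.proj))) := by
  set s₀ := sectionThrough EB (⟨y.proj, (σ.1 y).1⟩ : TotalSpace F V) with hs₀'
  set t₀ := sectionThrough EB (⟨y.proj, (τ.1 y).1⟩ : TotalSpace F V) with ht₀'
  have hs₀ : s₀ y.proj = (σ.1 y).1 :=
    sectionThrough_apply (EB := EB) (⟨y.proj, (σ.1 y).1⟩ : TotalSpace F V)
  have ht₀ : t₀ y.proj = (τ.1 y).1 :=
    sectionThrough_apply (EB := EB) (⟨y.proj, (τ.1 y).1⟩ : TotalSpace F V)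
  have hσ : dproj EB y (σ.1 y).2 = 𝔏.anchor y.proj (σ.1 y).1 := (σ.2.1 y).symm
  have hτ : dproj EB y (τ.1 y).2 = 𝔏.anchor y.proj (τ.1 y).1 := (τ.2.1 y).symm
  rw [LieAlgebroid.prolongBracketBase, fib_sub e hy, fib_add e hy,
    fib_derivDiff e τ.2.2.1 hy ht₀, fib_derivDiff e σ.2.2.1 hy hs₀, ← hs₀', ← ht₀', hσ, hτ, hs, ht]
  have h1 := fib_bracket_sub e 𝔏 s t t₀ hy (ht.trans ht₀.symm)
  have h2 := fib_bracket_sub e 𝔏 t₀ s s₀ hy (hs.trans hs₀.symm)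
  have h3 : 𝔏.bracket t₀ s = - 𝔏.bracket s t₀ := 𝔏.anchoredBracket.bracket_swap _ _
  have h4 : 𝔏.bracket t₀ s₀ = - 𝔏.bracket s₀ t₀ := 𝔏.anchoredBracket.bracket_swap _ _
  have h5 : ∀ v : V y.proj, (e ⟨y.proj, -v⟩).2 = -(e ⟨y.proj, v⟩).2 := fun v => by
    rw [fib_eq e hy, fib_eq e hy, map_neg]
  rw [h3, h4, ContMDiffSection.coe_neg, ContMDiffSection.coe_neg, Pi.neg_apply, Pi.neg_apply,
    h5, h5] at h2
  rw [hs] at h1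
  rw [ht₀] at h2
  rw [sub_eq_iff_eq_add] at h1 h2
  rw [h1, h2]
  abel
end PBracket

section PBracket2
variable {EB : Type*} [NormedAddCommGroup EB] [NormedSpace ℝ EB]
  {M : Type*} [TopologicalSpace M] [ChartedSpace EB M] [IsManifold 𝓘(ℝ, EB) ∞ M]
  {F : Type*} [NormedAddCommGroup F] [NormedSpace ℝ F]
  {V : M → Type*} [TopologicalSpace (TotalSpace F V)] [∀ x, AddCommGroup (V x)]
  [∀ x, Module ℝ (V x)] [∀ x, TopologicalSpace (V x)] [FiberBundle F V] [VectorBundle ℝ F V]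
  [ContMDiffVectorBundle ∞ F V 𝓘(ℝ, EB)]
  (e : Trivialization F (TotalSpace.proj : TotalSpace F V → M)) [MemTrivializationAtlas e]
variable [T2Space M] [FiniteDimensional ℝ EB] {𝔏 : LieAlgebroid EB F V}
  [FiniteDimensional ℝ F]

lemma contMDiff_prolongBracketBase (σ τ : 𝔏.prolongSections) :
    ContMDiff (𝓘(ℝ, EB).prod 𝓘(ℝ, F)) (𝓘(ℝ, EB).prod 𝓘(ℝ, F)) ∞
      (fun y => (⟨y.proj, 𝔏.prolongBracketBase σ τ y⟩ : TotalSpace F V)) := by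
  rw [contMDiff_base_iff]
  intro y₀
  set e := trivializationAt F V y₀.proj
  have hx : y₀.proj ∈ e.baseSet := mem_baseSet_trivializationAt F V y₀.proj
  let b := Module.finBasis ℝ F
  choose E hE using fun i => exists_const_section (EB := EB) e hx (b i)
  have hE' : ∀ᶠ y : TotalSpace F V in nhds y₀, ∀ᶠ x' in nhds y.proj, ∀ i, (e ⟨x', E i x'⟩).2 = b i :=
    (FiberBundle.continuous_proj F V).continuousAt.eventually
      (Filter.eventually_all.mpr hE).eventually_nhds
  have main : (fun y => (e ⟨y.proj, 𝔏.prolongBracketBase σ τ y⟩).2) =ᶠ[nhds y₀]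
      fun y => (∑ i, ∑ j, ((b.coord i).toContinuousLinearMap (e ⟨y.proj, (σ.1 y).1⟩).2 •
        (b.coord j).toContinuousLinearMap (e ⟨y.proj, (τ.1 y).1⟩).2) •
        (e ⟨y.proj, 𝔏.bracket (E i) (E j) y.proj⟩).2) +
        mvfderiv (𝓘(ℝ, EB).prod 𝓘(ℝ, F)) (fun y => (e ⟨y.proj, (τ.1 y).1⟩).2) y (σ.1 y).2 -
        mvfderiv (𝓘(ℝ, EB).prod 𝓘(ℝ, F)) (fun y => (e ⟨y.proj, (σ.1 y).1⟩).2) y (τ.1 y).2 := by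
    filter_upwards [hE', eventually_mem_baseSet _ hx] with y h1 hy
    have hT : ∀ a : F, ∀ᶠ x' in nhds y.proj, (e ⟨x', (∑ i, b.repr a i • E i :
        Cₛ^∞⟮𝓘(ℝ, EB); F, V⟯) x'⟩).2 = a := by
      intro a
      filter_upwards [h1, e.open_baseSet.mem_nhds hy] with x' h2 h3
      rw [section_sum, fib_sum e h3]
      refine Eq.trans ?_ (b.sum_repr a)
      refine Finset.sum_congr rfl fun i _ => ?_
      change (e ⟨x', b.repr a i • E i x'⟩).2 = _
      rw [fib_smul e h3, h2]
    have hD : ∀ a : F, mvfderiv 𝓘(ℝ, EB) (fun x => (e ⟨x, (∑ i, b.repr a i • E i :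
        Cₛ^∞⟮𝓘(ℝ, EB); F, V⟯) x⟩).2) y.proj = 0 := by
      intro a
      have h4 : mvfderiv 𝓘(ℝ, EB) (fun x => (e ⟨x, (∑ i, b.repr a i • E i :
          Cₛ^∞⟮𝓘(ℝ, EB); F, V⟯) x⟩).2) y.proj = mvfderiv 𝓘(ℝ, EB) (fun _ => a) y.proj :=
        Filter.EventuallyEq.mfderiv_eq (hT a)
      rw [h4, mvfderiv_const]
    rw [fib_prolongBracketBase e σ τ hy (fib_inj e hy (hT _).self_of_nhds)
      (fib_inj e hy (hT _).self_of_nhds), hD, hD, zero_apply, zero_apply, sub_zero, sub_zero]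
    congr 2
    simp only [map_sum, LinearMap.sum_apply, map_smul, LinearMap.smul_apply, section_sum,
      ContMDiffSection.coe_smul, Pi.smul_apply, fib_sum e hy, fib_smul e hy, Finset.smul_sum,
      smul_smul]
    rw [Finset.sum_comm]
    refine Finset.sum_congr rfl fun i _ => Finset.sum_congr rfl fun j _ => ?_
    rw [mul_comm]
    rfl
  refine ContMDiffAt.congr_of_eventuallyEq ?_ main
  have hU : IsOpen {y : TotalSpace F V | y.proj ∈ e.baseSet} :=
    e.open_baseSet.preimage (FiberBundle.continuous_proj F V)
  have hf : ∀ ρ : 𝔏.prolongSections, ContMDiffOn (𝓘(ℝ, EB).prod 𝓘(ℝ, F)) 𝓘(ℝ, F) ∞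
      (fun y => (e ⟨y.proj, (ρ.1 y).1⟩).2) {y : TotalSpace F V | y.proj ∈ e.baseSet} :=
    fun ρ y hy => (contMDiffAt_fib_base e ρ.2.2.1 hy).contMDiffWithinAt
  refine ContMDiffAt.sub (ContMDiffAt.add (ContMDiffAt.sum fun i _ => ContMDiffAt.sum fun j _ =>
    ?_) ?_) ?_
  · have h1 : ContMDiffAt (𝓘(ℝ, EB).prod 𝓘(ℝ, F)) 𝓘(ℝ) ∞ (fun y : TotalSpace F V =>
        (b.coord i).toContinuousLinearMap (e ⟨y.proj, (σ.1 y).1⟩).2) y₀ :=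
      (b.coord i).toContinuousLinearMap.contMDiff.contMDiffAt.comp y₀
        (contMDiffAt_fib_base e σ.2.2.1 hx)
    have h2 : ContMDiffAt (𝓘(ℝ, EB).prod 𝓘(ℝ, F)) 𝓘(ℝ) ∞ (fun y : TotalSpace F V =>
        (b.coord j).toContinuousLinearMap (e ⟨y.proj, (τ.1 y).1⟩).2) y₀ :=
      (b.coord j).toContinuousLinearMap.contMDiff.contMDiffAt.comp y₀
        (contMDiffAt_fib_base e τ.2.2.1 hx)
    exact (h1.smul h2).smul (contMDiffAt_fib_comp e _ hx)
  · exact contMDiffAt_mvfderiv hU (hf τ) hx (σ.2.2.2 y₀)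
  · exact contMDiffAt_mvfderiv hU (hf σ) hx (τ.2.2.2 y₀)

lemma mvfderiv_completeLiftFun_verticalVector (f : C^∞⟮𝓘(ℝ, EB), M; ℝ⟯) (y : TotalSpace F V)
    (w : V y.proj) : mvfderiv (𝓘(ℝ, EB).prod 𝓘(ℝ, F)) (𝔏.completeLiftFun f) y
      (verticalVector EB y w) = 𝔏.completeLiftFun f ⟨y.proj, w⟩ := by
  have h0 := line_zero y w
  have h1 := mvfderiv_comp_apply_of_eq (x := (0 : ℝ)) (y := y)
    (f := fun ε : ℝ => (⟨y.proj, y.2 + ε • w⟩ : TotalSpace F V))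
    ((𝔏.completeLiftFun f).contMDiff.mdifferentiable (by simp) y)
    (mdiff_line (EB := EB) y w) h0 (1 : ℝ)
  refine h1.symm.trans ?_
  have h : HasFDerivAt (fun ε : ℝ => 𝔏.completeLiftFun f y + ε • 𝔏.completeLiftFun f ⟨y.proj, w⟩)
      ((ContinuousLinearMap.id ℝ ℝ).smulRight (𝔏.completeLiftFun f ⟨y.proj, w⟩)) 0 :=
    ((hasFDerivAt_id (0 : ℝ)).smul_const _).const_add _
  have h2 := h.hasMFDerivAt.mfderiv
  have h3 : ((𝔏.completeLiftFun f) ∘ fun ε : ℝ => (⟨y.proj, y.2 + ε • w⟩ : TotalSpace F V)) =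
      fun ε : ℝ => 𝔏.completeLiftFun f y + ε • 𝔏.completeLiftFun f ⟨y.proj, w⟩ := by
    ext ε
    change mvfderiv 𝓘(ℝ, EB) f y.proj (𝔏.anchor y.proj (y.2 + ε • w)) =
      mvfderiv 𝓘(ℝ, EB) f y.proj (𝔏.anchor y.proj y.2) +
        ε • mvfderiv 𝓘(ℝ, EB) f y.proj (𝔏.anchor y.proj w)
    rw [map_add, map_smul, map_add, map_smul]
  rw [h3]
  refine (DFunLike.congr_fun h2 (1 : ℝ)).trans ?_
  exact one_smul ℝ _


lemma completeLiftFun_zero_add (f : C^∞⟮𝓘(ℝ, EB), M; ℝ⟯) {x : M} (u v : V x) :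
    𝔏.completeLiftFun f ⟨x, u + v⟩ = 𝔏.completeLiftFun f ⟨x, u⟩ + 𝔏.completeLiftFun f ⟨x, v⟩ := by
  change mvfderiv 𝓘(ℝ, EB) f x (𝔏.anchor x (u + v)) = _
  rw [map_add, map_add]
  rfl

lemma completeLiftFun_sub (f : C^∞⟮𝓘(ℝ, EB), M; ℝ⟯) {x : M} (u v : V x) :
    𝔏.completeLiftFun f ⟨x, u - v⟩ = 𝔏.completeLiftFun f ⟨x, u⟩ - 𝔏.completeLiftFun f ⟨x, v⟩ := by
  change mvfderiv 𝓘(ℝ, EB) f x (𝔏.anchor x (u - v)) = _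
  rw [map_sub, map_sub]
  rfl

lemma completeLiftFun_derivDiff (f : C^∞⟮𝓘(ℝ, EB), M; ℝ⟯) {η : ∀ y : TotalSpace F V, V y.proj}
    (hη : ContMDiff (𝓘(ℝ, EB).prod 𝓘(ℝ, F)) (𝓘(ℝ, EB).prod 𝓘(ℝ, F)) ∞
      (fun y => (⟨y.proj, η y⟩ : TotalSpace F V))) {t : Cₛ^∞⟮𝓘(ℝ, EB); F, V⟯}
    {y : TotalSpace F V} (ht : t y.proj = η y) (z : TangentSpace (𝓘(ℝ, EB).prod 𝓘(ℝ, F)) y) :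
    𝔏.completeLiftFun f ⟨y.proj, derivDiff η t y z⟩ =
      mvfderiv (𝓘(ℝ, EB).prod 𝓘(ℝ, F)) (fun y => 𝔏.completeLiftFun f ⟨y.proj, η y⟩) y z -
        mvfderiv 𝓘(ℝ, EB) (fun x => 𝔏.completeLiftFun f ⟨x, t x⟩) y.proj (dproj EB y z) := by
  have h1 := mvfderiv_completeLiftFun_verticalVector (𝔏 := 𝔏) f ⟨y.proj, η y⟩ (derivDiff η t y z)
  rw [derivDiff, verticalVector_verticalPart (dproj_diff hη ht z)] at h1
  refine h1.symm.trans ?_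
  rw [map_sub]
  have hd := (𝔏.completeLiftFun f).contMDiff.mdifferentiable (by simp)
  have h2 := mvfderiv_comp_apply (g := ⇑(𝔏.completeLiftFun f))
    (f := fun y => (⟨y.proj, η y⟩ : TotalSpace F V)) y
    (hd ⟨y.proj, η y⟩) (hη.mdifferentiable (by simp) y) z
  have h3 := mvfderiv_comp_apply_of_eq (g := ⇑(𝔏.completeLiftFun f))
    (f := fun x => (⟨x, t x⟩ : TotalSpace F V)) (x := y.proj)
    (y := ⟨y.proj, η y⟩) (hd ⟨y.proj, η y⟩) (t.contMDiff.mdifferentiable (by simp) y.proj)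
    (by rw [ht]) (dproj EB y z)
  rw [Function.comp_def] at h2 h3
  rw [h2, h3]
  rfl

lemma anchor_prolongBracketBase (σ τ : 𝔏.prolongSections) (y : TotalSpace F V) :
    𝔏.anchor y.proj (𝔏.prolongBracketBase σ τ y) =
      dproj EB y (VectorField.mlieBracket (𝓘(ℝ, EB).prod 𝓘(ℝ, F)) (fun y => (σ.1 y).2)
        (fun y => (τ.1 y).2) y) := by
  have : CompleteSpace EB := FiniteDimensional.complete ℝ EB
  have : CompleteSpace F := FiniteDimensional.complete ℝ F
  apply tangent_ext
  intro f
  have hchain : ∀ (y : TotalSpace F V) (z : TangentSpace (𝓘(ℝ, EB).prod 𝓘(ℝ, F)) y),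
      mvfderiv 𝓘(ℝ, EB) f y.proj (dproj EB y z) =
        mvfderiv (𝓘(ℝ, EB).prod 𝓘(ℝ, F)) (verticalLiftFun F V f) y z := fun y z =>
    (mvfderiv_comp_apply (f := (TotalSpace.proj : TotalSpace F V → M)) y
      (f.contMDiff.mdifferentiable (by simp) _)
      ((Bundle.contMDiff_proj (n := ∞) (IB := 𝓘(ℝ, EB)) V).mdifferentiable (by simp) y) z).symm
  have hfun : ∀ ρ : 𝔏.prolongSections,
      (fun y => mvfderiv (𝓘(ℝ, EB).prod 𝓘(ℝ, F)) (verticalLiftFun F V f) y (ρ.1 y).2) =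
        fun y => 𝔏.completeLiftFun f ⟨y.proj, (ρ.1 y).1⟩ := fun ρ => by
    funext y
    rw [← hchain]
    exact congrArg (mvfderiv 𝓘(ℝ, EB) f y.proj) (ρ.2.1 y).symm
  rw [hchain, mvfderiv_mlieBracket σ.2.2.2 τ.2.2.2, hfun σ, hfun τ]
  set s := sectionThrough EB (⟨y.proj, (σ.1 y).1⟩ : TotalSpace F V)
  set t := sectionThrough EB (⟨y.proj, (τ.1 y).1⟩ : TotalSpace F V)
  have hs : s y.proj = (σ.1 y).1 :=
    sectionThrough_apply (EB := EB) (⟨y.proj, (σ.1 y).1⟩ : TotalSpace F V)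
  have ht : t y.proj = (τ.1 y).1 :=
    sectionThrough_apply (EB := EB) (⟨y.proj, (τ.1 y).1⟩ : TotalSpace F V)
  have hσ : dproj EB y (σ.1 y).2 = 𝔏.anchor y.proj (s y.proj) := by rw [hs]; exact (σ.2.1 y).symm
  have hτ : dproj EB y (τ.1 y).2 = 𝔏.anchor y.proj (t y.proj) := by rw [ht]; exact (τ.2.1 y).symm
  change 𝔏.completeLiftFun f ⟨y.proj, 𝔏.prolongBracketBase σ τ y⟩ = _
  rw [LieAlgebroid.prolongBracketBase, completeLiftFun_sub, completeLiftFun_zero_add,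
    completeLiftFun_derivDiff f τ.2.2.1 ht, completeLiftFun_derivDiff f σ.2.2.1 hs, hσ, hτ]
  have h1 : 𝔏.completeLiftFun f ⟨y.proj, 𝔏.bracket s t y.proj⟩ =
      mvfderiv 𝓘(ℝ, EB) (fun x => 𝔏.completeLiftFun f ⟨x, t x⟩) y.proj
        (𝔏.anchor y.proj (s y.proj)) -
      mvfderiv 𝓘(ℝ, EB) (fun x => 𝔏.completeLiftFun f ⟨x, s x⟩) y.proj
        (𝔏.anchor y.proj (t y.proj)) := by
    change mvfderiv 𝓘(ℝ, EB) f y.proj (𝔏.anchor y.proj (𝔏.bracket s t y.proj)) = _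
    rw [𝔏.anchor_bracket, mvfderiv_mlieBracket (𝔏.contMDiff_anchor_section s)
      (𝔏.contMDiff_anchor_section t)]
    rfl
  rw [h1]
  abel

/-- The bracket of two sections of the prolongation. Its component in the tangent bundle is the Lie
bracket of vector fields. -/
def LieAlgebroid.prolongBracketFun (σ τ : 𝔏.prolongSections) : 𝔏.prolongSections :=
  ⟨fun y => (𝔏.prolongBracketBase σ τ y,
      VectorField.mlieBracket (𝓘(ℝ, EB).prod 𝓘(ℝ, F)) (fun y => (σ.1 y).2) (fun y => (τ.1 y).2) y),
    fun y => anchor_prolongBracketBase σ τ y, contMDiff_prolongBracketBase σ τ, by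
      have : CompleteSpace EB := FiniteDimensional.complete ℝ EB
      have : CompleteSpace F := FiniteDimensional.complete ℝ F
      have : IsManifold (𝓘(ℝ, EB).prod 𝓘(ℝ, F)) (minSmoothness ℝ 2) (TotalSpace F V) :=
        IsManifold.of_le (n := ∞)
          (by rw [minSmoothness_of_isRCLikeNormedField]; exact ENat.LEInfty.out)
      have : IsManifold (𝓘(ℝ, EB).prod 𝓘(ℝ, F)) (((⊤ : ℕ∞) : WithTop ℕ∞) + 1) (TotalSpace F V) :=
        IsManifold.of_le (n := ∞) (by simp)
      intro y
      exact (σ.2.2.2 y).mlieBracket_vectorField (m := ⊤) (n := ⊤) (τ.2.2.2 y)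
        (by rw [minSmoothness_of_isRCLikeNormedField]; simp)⟩

lemma prolongBracketFun_swap (σ τ : 𝔏.prolongSections) :
    LieAlgebroid.prolongBracketFun σ τ = - LieAlgebroid.prolongBracketFun τ σ := by
  refine Subtype.ext <| funext fun y => Prod.ext ?_ ?_
  · change 𝔏.prolongBracketBase σ τ y = - 𝔏.prolongBracketBase τ σ y
    have h4 : ∀ s t, 𝔏.bracket s t = - 𝔏.bracket t s := fun s t =>
      𝔏.anchoredBracket.bracket_swap _ _
    rw [LieAlgebroid.prolongBracketBase, LieAlgebroid.prolongBracketBase, h4,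
      ContMDiffSection.coe_neg, Pi.neg_apply]
    abel
  · exact congrFun VectorField.mlieBracket_swap y

end PBracket2

section PBracket3
variable {EB : Type*} [NormedAddCommGroup EB] [NormedSpace ℝ EB]
  {M : Type*} [TopologicalSpace M] [ChartedSpace EB M] [IsManifold 𝓘(ℝ, EB) ∞ M]
  {F : Type*} [NormedAddCommGroup F] [NormedSpace ℝ F]
  {V : M → Type*} [TopologicalSpace (TotalSpace F V)] [∀ x, AddCommGroup (V x)]
  [∀ x, Module ℝ (V x)] [∀ x, TopologicalSpace (V x)] [FiberBundle F V] [VectorBundle ℝ F V]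
  [ContMDiffVectorBundle ∞ F V 𝓘(ℝ, EB)]
variable [T2Space M] [FiniteDimensional ℝ EB] {𝔏 : LieAlgebroid EB F V}
  [FiniteDimensional ℝ F]

lemma mdiff_field (σ : 𝔏.prolongSections) (y : TotalSpace F V) :
    MDifferentiableAt (𝓘(ℝ, EB).prod 𝓘(ℝ, F)) (𝓘(ℝ, EB).prod 𝓘(ℝ, F)).tangent
      (fun y => (⟨y, (σ.1 y).2⟩ : TangentBundle (𝓘(ℝ, EB).prod 𝓘(ℝ, F)) (TotalSpace F V))) y :=
  σ.2.2.2.mdifferentiable (by simp) y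

lemma prolongBracketFun_add (σ τ τ' : 𝔏.prolongSections) :
    LieAlgebroid.prolongBracketFun σ (τ + τ') =
      LieAlgebroid.prolongBracketFun σ τ + LieAlgebroid.prolongBracketFun σ τ' := by
  have : CompleteSpace EB := FiniteDimensional.complete ℝ EB
  have : CompleteSpace F := FiniteDimensional.complete ℝ F
  refine Subtype.ext <| funext fun y => Prod.ext ?_ ?_
  · have hx := mem_baseSet_trivializationAt F V y.proj
    set e := trivializationAt F V y.proj
    obtain ⟨s, hs⟩ := exists_section_eq EB (⟨y.proj, (σ.1 y).1⟩ : TotalSpace F V)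
    obtain ⟨t, ht⟩ := exists_section_eq EB (⟨y.proj, (τ.1 y).1⟩ : TotalSpace F V)
    obtain ⟨t', ht'⟩ := exists_section_eq EB (⟨y.proj, (τ'.1 y).1⟩ : TotalSpace F V)
    have htt : (t + t') y.proj = ((τ + τ').1 y).1 := congrArg₂ (· + ·) ht ht'
    change 𝔏.prolongBracketBase σ (τ + τ') y =
      𝔏.prolongBracketBase σ τ y + 𝔏.prolongBracketBase σ τ' y
    apply fib_inj e hx
    rw [fib_add e hx, fib_prolongBracketBase e σ _ hx hs htt,
      fib_prolongBracketBase e σ _ hx hs ht, fib_prolongBracketBase e σ _ hx hs ht']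
    have e1 : mvfderiv (𝓘(ℝ, EB).prod 𝓘(ℝ, F)) (fun y => (e ⟨y.proj, ((τ + τ').1 y).1⟩).2) y =
        mvfderiv (𝓘(ℝ, EB).prod 𝓘(ℝ, F)) (fun y => (e ⟨y.proj, (τ.1 y).1⟩).2) y +
        mvfderiv (𝓘(ℝ, EB).prod 𝓘(ℝ, F)) (fun y => (e ⟨y.proj, (τ'.1 y).1⟩).2) y := by
      refine Eq.trans (Filter.EventuallyEq.mfderiv_eq ?_) (mvfderiv_add
        ((contMDiffAt_fib_base e τ.2.2.1 hx).mdifferentiableAt (by simp))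
        ((contMDiffAt_fib_base e τ'.2.2.1 hx).mdifferentiableAt (by simp)))
      filter_upwards [eventually_mem_baseSet e hx] with y' hy'
      exact fib_add e hy' _ _
    have e2 : mvfderiv 𝓘(ℝ, EB) (fun x => (e ⟨x, (t + t') x⟩).2) y.proj =
        mvfderiv 𝓘(ℝ, EB) (fun x => (e ⟨x, t x⟩).2) y.proj +
        mvfderiv 𝓘(ℝ, EB) (fun x => (e ⟨x, t' x⟩).2) y.proj := by
      refine Eq.trans (Filter.EventuallyEq.mfderiv_eq ?_) (mvfderiv_add
        ((contMDiffAt_fib_section e t hx).mdifferentiableAt (by simp))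
        ((contMDiffAt_fib_section e t' hx).mdifferentiableAt (by simp)))
      filter_upwards [e.open_baseSet.mem_nhds hx] with y' hy'
      exact fib_add e hy' _ _
    have e3 : ((τ + τ').1 y).2 = (τ.1 y).2 + (τ'.1 y).2 := rfl
    rw [e1, e2, e3, map_add, ContMDiffSection.coe_add, ContMDiffSection.coe_add, Pi.add_apply,
      Pi.add_apply, fib_add e hx, map_add, map_add, map_add, add_apply, add_apply]
    abel
  · exact VectorField.mlieBracket_add_right (mdiff_field τ y) (mdiff_field τ' y)

lemma prolongBracketFun_smul (σ τ : 𝔏.prolongSections)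
    (f : C^∞⟮𝓘(ℝ, EB).prod 𝓘(ℝ, F), TotalSpace F V; ℝ⟯) (y : TotalSpace F V) :
    (LieAlgebroid.prolongBracketFun σ (f • τ)).1 y =
      f y • (LieAlgebroid.prolongBracketFun σ τ).1 y +
        mvfderiv (𝓘(ℝ, EB).prod 𝓘(ℝ, F)) f y (σ.1 y).2 • τ.1 y := by
  have : CompleteSpace EB := FiniteDimensional.complete ℝ EB
  have : CompleteSpace F := FiniteDimensional.complete ℝ F
  have hf : MDifferentiableAt (𝓘(ℝ, EB).prod 𝓘(ℝ, F)) 𝓘(ℝ) f y :=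
    f.contMDiff.mdifferentiable (by simp) y
  refine Prod.ext ?_ ?_
  · have hx := mem_baseSet_trivializationAt F V y.proj
    set e := trivializationAt F V y.proj
    obtain ⟨s, hs⟩ := exists_section_eq EB (⟨y.proj, (σ.1 y).1⟩ : TotalSpace F V)
    obtain ⟨t, ht⟩ := exists_section_eq EB (⟨y.proj, (τ.1 y).1⟩ : TotalSpace F V)
    have htt : (f y • t) y.proj = ((f • τ).1 y).1 := congrArg (f y • ·) ht
    change 𝔏.prolongBracketBase σ (f • τ) y = f y • 𝔏.prolongBracketBase σ τ y +
      mvfderiv (𝓘(ℝ, EB).prod 𝓘(ℝ, F)) f y (σ.1 y).2 • (τ.1 y).1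
    apply fib_inj e hx
    rw [fib_add e hx, fib_smul e hx, fib_smul e hx, fib_prolongBracketBase e σ _ hx hs htt,
      fib_prolongBracketBase e σ _ hx hs ht]
    have e1 : ∀ z, mvfderiv (𝓘(ℝ, EB).prod 𝓘(ℝ, F)) (fun y => (e ⟨y.proj, ((f • τ).1 y).1⟩).2) y z =
        f y • mvfderiv (𝓘(ℝ, EB).prod 𝓘(ℝ, F)) (fun y => (e ⟨y.proj, (τ.1 y).1⟩).2) y z +
        mvfderiv (𝓘(ℝ, EB).prod 𝓘(ℝ, F)) f y z • (e ⟨y.proj, (τ.1 y).1⟩).2 := by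
      intro z
      have h1 := mvfderiv_smul hf
        ((contMDiffAt_fib_base e τ.2.2.1 hx).mdifferentiableAt (by simp))
      have h0 : mvfderiv (𝓘(ℝ, EB).prod 𝓘(ℝ, F)) (fun y => (e ⟨y.proj, ((f • τ).1 y).1⟩).2) y =
          mvfderiv (𝓘(ℝ, EB).prod 𝓘(ℝ, F)) (⇑f • fun y => (e ⟨y.proj, (τ.1 y).1⟩).2) y := by
        refine Filter.EventuallyEq.mfderiv_eq ?_
        filter_upwards [eventually_mem_baseSet e hx] with y' hy'
        exact fib_smul e hy' _ _
      rw [h0]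
      exact DFunLike.congr_fun h1 z
    have e2 : ∀ v, mvfderiv 𝓘(ℝ, EB) (fun x => (e ⟨x, (f y • t) x⟩).2) y.proj v =
        f y • mvfderiv 𝓘(ℝ, EB) (fun x => (e ⟨x, t x⟩).2) y.proj v := by
      intro v
      have h1 := mvfderiv_smul (mdifferentiableAt_const (c := f y) (x := y.proj) (I := 𝓘(ℝ, EB)))
        ((contMDiffAt_fib_section e t hx).mdifferentiableAt (by simp))
      rw [mvfderiv_const] at h1
      have h0 : mvfderiv 𝓘(ℝ, EB) (fun x => (e ⟨x, (f y • t) x⟩).2) y.proj =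
          mvfderiv 𝓘(ℝ, EB) ((fun _ : M => f y) • fun x => (e ⟨x, t x⟩).2) y.proj := by
        refine Filter.EventuallyEq.mfderiv_eq ?_
        filter_upwards [e.open_baseSet.mem_nhds hx] with y' hy'
        exact fib_smul e hy' _ _
      rw [h0]
      exact (DFunLike.congr_fun h1 v).trans (by simp)
    have e3 : ((f • τ).1 y).2 = f y • (τ.1 y).2 := rfl
    rw [e1, e2, e3, map_smul, ContMDiffSection.coe_smul, ContMDiffSection.coe_smul, Pi.smul_apply,
      Pi.smul_apply, fib_smul e hx, map_smul, map_smul, map_smul]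
    module
  · refine (VectorField.mlieBracket_smul_right hf (mdiff_field τ y)).trans ?_
    exact add_comm _ _

/-- The prolongation `L^p(V)` with its anchor `(u, z) ↦ z` and its bracket. -/
def LieAlgebroid.prolongation (𝔏 : LieAlgebroid EB F V) :
    AnchoredBracket C^∞⟮𝓘(ℝ, EB).prod 𝓘(ℝ, F), TotalSpace F V; ℝ⟯ 𝔏.prolongSections where
  anchor :=
    { toFun := fun σ => vectorFieldDerivation (fun y => (σ.1 y).2) σ.2.2.2
      map_add' := fun σ τ => by
        ext f y
        exact map_add (mvfderiv (𝓘(ℝ, EB).prod 𝓘(ℝ, F)) f y) (σ.1 y).2 (τ.1 y).2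
      map_smul' := fun g σ => by
        ext f y
        exact map_smul (mvfderiv (𝓘(ℝ, EB).prod 𝓘(ℝ, F)) f y) (g y) (σ.1 y).2 }
  bracket :=
    have h_smul : ∀ (c : ℝ) (σ τ : 𝔏.prolongSections), prolongBracketFun σ (c • τ) =
        c • prolongBracketFun σ τ := fun c σ τ => by
      refine Subtype.ext <| funext fun y => ?_
      have h := prolongBracketFun_smul σ τ (algebraMap ℝ _ c) y
      have h2 : mvfderiv (𝓘(ℝ, EB).prod 𝓘(ℝ, F)) (algebraMap ℝ
          C^∞⟮𝓘(ℝ, EB).prod 𝓘(ℝ, F), TotalSpace F V; ℝ⟯ c) y = 0 := mvfderiv_const c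
      rw [h2, zero_apply, zero_smul, add_zero] at h
      exact h
    LinearMap.mk₂ ℝ prolongBracketFun
      (fun σ σ' τ => by
        rw [prolongBracketFun_swap, prolongBracketFun_add, neg_add, ← prolongBracketFun_swap,
          ← prolongBracketFun_swap])
      (fun c σ τ => by
        rw [prolongBracketFun_swap, h_smul, prolongBracketFun_swap σ τ]
        exact (smul_neg _ _).symm)
      prolongBracketFun_add h_smul
  bracket_self σ := by
    have h := prolongBracketFun_swap σ σ
    rw [eq_neg_iff_add_eq_zero, ← two_smul ℝ] at h
    exact (smul_eq_zero.mp h).resolve_left two_ne_zero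
  bracket_smul σ f τ := Subtype.ext <| funext fun y => prolongBracketFun_smul σ τ f y
end PBracket3

section LiftEndo
variable {EB : Type*} [NormedAddCommGroup EB] [NormedSpace ℝ EB]
  {M : Type*} [TopologicalSpace M] [ChartedSpace EB M] [IsManifold 𝓘(ℝ, EB) ∞ M]
  {F : Type*} [NormedAddCommGroup F] [NormedSpace ℝ F]
  {V : M → Type*} [TopologicalSpace (TotalSpace F V)] [∀ x, AddCommGroup (V x)]
  [∀ x, Module ℝ (V x)] [∀ x, TopologicalSpace (V x)] [FiberBundle F V] [VectorBundle ℝ F V]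
  [ContMDiffVectorBundle ∞ F V 𝓘(ℝ, EB)]
  (e : Trivialization F (TotalSpace.proj : TotalSpace F V → M)) [MemTrivializationAtlas e]
variable [T2Space M] [FiniteDimensional ℝ EB] {𝔏 : LieAlgebroid EB F V}
  [FiniteDimensional ℝ F]

/-- A section that vanishes at `x` is a combination of sections with coefficients that vanish at
`x`. -/
lemma exists_sum_smul {r : Cₛ^∞⟮𝓘(ℝ, EB); F, V⟯} {x : M} (hr : r x = 0) :
    ∃ (n : ℕ) (f : Fin n → C^∞⟮𝓘(ℝ, EB), M; ℝ⟯) (R : Fin n → Cₛ^∞⟮𝓘(ℝ, EB); F, V⟯),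
      (∀ i, f i x = 0) ∧ r = ∑ i, f i • R i := by
  have hx := mem_baseSet_trivializationAt F V x
  set e := trivializationAt F V x
  let b := Module.finBasis ℝ F
  have hco : ∀ i, ContMDiffOn 𝓘(ℝ, EB) 𝓘(ℝ) ∞
      (fun x' => (b.coord i).toContinuousLinearMap (e ⟨x', r x'⟩).2) e.baseSet := fun i x' hx' =>
    ((b.coord i).toContinuousLinearMap.contMDiff.contMDiffAt.comp x'
      (contMDiffAt_fib_section e r hx')).contMDiffWithinAt
  choose G hG using fun i => exists_global_fun (e.open_baseSet.mem_nhds hx) (hco i)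
  choose E hE using fun i => exists_const_section (EB := EB) e hx (b i)
  have hq : ∀ᶠ x' in nhds x, (r - ∑ i, G i • E i) x' = 0 := by
    filter_upwards [Filter.eventually_all.mpr hG, Filter.eventually_all.mpr hE,
      e.open_baseSet.mem_nhds hx] with x' h1 h2 h3
    apply fib_inj e h3
    rw [section_sub_sum, fib_sub e h3, fib_sum e h3, fib_zero e h3]
    simp only [fib_smul e h3, h1, h2]
    rw [sub_eq_zero]
    exact (b.sum_repr _).symm
  obtain ⟨χ, h1, h2⟩ := exists_bump (EB := EB) hq
  set q := r - ∑ i, G i • E i with hqd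
  have hq' : q = (1 - χ) • q := by
    ext x'
    change q x' = (1 - χ x') • q x'
    by_cases h : x' ∈ tsupport χ
    · rw [show q x' = 0 from h2 h, smul_zero]
    · rw [image_eq_zero_of_notMem_tsupport h, sub_zero, one_smul]
  refine ⟨_, Fin.cons (1 - χ) G, Fin.cons q E, ?_, ?_⟩
  · intro i
    refine Fin.cases ?_ (fun i => ?_) i
    · change 1 - χ x = 0
      rw [h1.self_of_nhds, sub_self]
    · rw [Fin.cons_succ, (hG i).self_of_nhds, hr, fib_zero e hx, map_zero]
  · rw [Fin.sum_univ_succ]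
    simp only [Fin.cons_zero, Fin.cons_succ]
    rw [← hq', hqd, sub_add_cancel]

lemma endo_apply_eq (J : Cₛ^∞⟮𝓘(ℝ, EB); F, V⟯ →ₗ[C^∞⟮𝓘(ℝ, EB), M; ℝ⟯] Cₛ^∞⟮𝓘(ℝ, EB); F, V⟯)
    {s t : Cₛ^∞⟮𝓘(ℝ, EB); F, V⟯} {x : M} (h : s x = t x) : J s x = J t x := by
  obtain ⟨n, f, R, hf, hr⟩ := exists_sum_smul (r := s - t) (x := x) (sub_eq_zero.mpr h)
  have h1 : J (s - t) x = 0 := by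
    rw [hr, map_sum, section_sum]
    refine Finset.sum_eq_zero fun i _ => ?_
    rw [map_smul, section_smul_apply, hf, zero_smul]
  rw [map_sub] at h1
  exact sub_eq_zero.mp h1

lemma endo_smul (J : Cₛ^∞⟮𝓘(ℝ, EB); F, V⟯ →ₗ[C^∞⟮𝓘(ℝ, EB), M; ℝ⟯] Cₛ^∞⟮𝓘(ℝ, EB); F, V⟯)
    (c : ℝ) (s : Cₛ^∞⟮𝓘(ℝ, EB); F, V⟯) : J (c • s) = c • J s :=
  J.map_smul (algebraMap ℝ C^∞⟮𝓘(ℝ, EB), M; ℝ⟯ c) s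

lemma verticalLift_congr {s t : Cₛ^∞⟮𝓘(ℝ, EB); F, V⟯} {y : TotalSpace F V}
    (h : s y.proj = t y.proj) : (𝔏.verticalLift s).1 y = (𝔏.verticalLift t).1 y := by
  change (0, verticalVector EB y (s y.proj)) = (0, verticalVector EB y (t y.proj))
  rw [h]

lemma verticalLift_inj {s t : Cₛ^∞⟮𝓘(ℝ, EB); F, V⟯} {y : TotalSpace F V}
    (h : (𝔏.verticalLift s).1 y = (𝔏.verticalLift t).1 y) : s y.proj = t y.proj := by
  have hx := mem_baseSet_trivializationAt F V y.proj
  have h1 : verticalVector EB y (s y.proj) = verticalVector EB y (t y.proj) := congrArg Prod.snd h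
  apply fib_inj _ hx
  rw [← dfib_verticalVector (EB := EB) _ hx, h1, dfib_verticalVector _ hx]

lemma verticalLift_fst (s : Cₛ^∞⟮𝓘(ℝ, EB); F, V⟯) (y : TotalSpace F V) :
    ((𝔏.verticalLift s).1 y).1 = 0 := rfl

lemma verticalLift_snd (s : Cₛ^∞⟮𝓘(ℝ, EB); F, V⟯) (y : TotalSpace F V) :
    ((𝔏.verticalLift s).1 y).2 = verticalVector EB y (s y.proj) := rfl

lemma completeLift_fst (s : Cₛ^∞⟮𝓘(ℝ, EB); F, V⟯) (y : TotalSpace F V) :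
    ((𝔏.completeLift s).1 y).1 = s y.proj := rfl

lemma completeLift_snd (s : Cₛ^∞⟮𝓘(ℝ, EB); F, V⟯) (y : TotalSpace F V) :
    ((𝔏.completeLift s).1 y).2 = 𝔏.completeVector s y := rfl

lemma prolong_sum {ι : Type*} (S : Finset ι) (σ : ι → 𝔏.prolongSections) (y : TotalSpace F V) :
    (∑ i ∈ S, σ i).1 y = ∑ i ∈ S, (σ i).1 y := by
  rw [Submodule.coe_sum, Finset.sum_apply]

lemma completeLift_sum_smul {n : ℕ} {f : Fin n → C^∞⟮𝓘(ℝ, EB), M; ℝ⟯}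
    {R : Fin n → Cₛ^∞⟮𝓘(ℝ, EB); F, V⟯} {y : TotalSpace F V} (hf : ∀ i, f i y.proj = 0) :
    (𝔏.completeLift (∑ i, f i • R i)).1 y =
      (𝔏.verticalLift (∑ i, 𝔏.completeLiftFun (f i) y • R i)).1 y := by
  rw [map_sum, map_sum, prolong_sum, prolong_sum]
  refine Finset.sum_congr rfl fun i _ => ?_
  rw [completeLift_smul, map_smul]
  change f i y.proj • (𝔏.completeLift (R i)).1 y +
    𝔏.completeLiftFun (f i) y • (𝔏.verticalLift (R i)).1 y = _
  rw [hf, zero_smul, zero_add]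
  rfl

lemma completeLift_endo_eq
    (J : Cₛ^∞⟮𝓘(ℝ, EB); F, V⟯ →ₗ[C^∞⟮𝓘(ℝ, EB), M; ℝ⟯] Cₛ^∞⟮𝓘(ℝ, EB); F, V⟯)
    {r s : Cₛ^∞⟮𝓘(ℝ, EB); F, V⟯} {y : TotalSpace F V} (hr : r y.proj = 0)
    (h : (𝔏.completeLift r).1 y = (𝔏.verticalLift s).1 y) :
    (𝔏.completeLift (J r)).1 y = (𝔏.verticalLift (J s)).1 y := by
  obtain ⟨n, f, R, hf, hr⟩ := exists_sum_smul hr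
  rw [hr, completeLift_sum_smul hf] at h
  have h1 := endo_apply_eq J (verticalLift_inj h)
  rw [← verticalLift_congr h1, hr, map_sum]
  simp only [map_smul]
  rw [completeLift_sum_smul hf]
  simp only [map_sum, endo_smul]

lemma exists_lift_decomp (σ : 𝔏.prolongSections) (y : TotalSpace F V) :
    ∃ p : Cₛ^∞⟮𝓘(ℝ, EB); F, V⟯ × Cₛ^∞⟮𝓘(ℝ, EB); F, V⟯,
      σ.1 y = (𝔏.completeLift p.1).1 y + (𝔏.verticalLift p.2).1 y := by
  obtain ⟨s, hs⟩ := exists_section_eq EB (⟨y.proj, (σ.1 y).1⟩ : TotalSpace F V)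
  obtain ⟨t, ht⟩ := exists_section_eq EB
    (⟨y.proj, verticalPart EB y ((σ.1 y).2 - 𝔏.completeVector s y)⟩ : TotalSpace F V)
  have hs' : s y.proj = (σ.1 y).1 := hs
  have ht' : t y.proj = verticalPart EB y ((σ.1 y).2 - 𝔏.completeVector s y) := ht
  have hd : dproj EB y ((σ.1 y).2 - 𝔏.completeVector s y) = 0 := by
    rw [map_sub, dproj_completeVector, hs', sub_eq_zero]
    exact (σ.2.1 y).symm
  refine ⟨(s, t), Prod.ext ?_ ?_⟩
  · change (σ.1 y).1 = s y.proj + 0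
    rw [hs', add_zero]
  · change (σ.1 y).2 = 𝔏.completeVector s y + verticalVector EB y (t y.proj)
    rw [ht', verticalVector_verticalPart hd, add_sub_cancel]

/-- The value at `y` of the complete lift of `J` applied to `σ`: if `σ` agrees at `y` with
`s^c + t^v`, it is the value at `y` of `(J s)^c + (J t)^v`. -/
def LieAlgebroid.completeLiftEndoFun (𝔏 : LieAlgebroid EB F V)
    (J : Cₛ^∞⟮𝓘(ℝ, EB); F, V⟯ →ₗ[C^∞⟮𝓘(ℝ, EB), M; ℝ⟯] Cₛ^∞⟮𝓘(ℝ, EB); F, V⟯)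
    (σ : 𝔏.prolongSections) (y : TotalSpace F V) :
    V y.proj × TangentSpace (𝓘(ℝ, EB).prod 𝓘(ℝ, F)) y :=
  (𝔏.completeLift (J (exists_lift_decomp σ y).choose.1)).1 y +
    (𝔏.verticalLift (J (exists_lift_decomp σ y).choose.2)).1 y

lemma completeLiftEndoFun_eq
    (J : Cₛ^∞⟮𝓘(ℝ, EB); F, V⟯ →ₗ[C^∞⟮𝓘(ℝ, EB), M; ℝ⟯] Cₛ^∞⟮𝓘(ℝ, EB); F, V⟯)
    {σ : 𝔏.prolongSections} {y : TotalSpace F V} {s t : Cₛ^∞⟮𝓘(ℝ, EB); F, V⟯}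
    (h : σ.1 y = (𝔏.completeLift s).1 y + (𝔏.verticalLift t).1 y) :
    𝔏.completeLiftEndoFun J σ y =
      (𝔏.completeLift (J s)).1 y + (𝔏.verticalLift (J t)).1 y := by
  rw [LieAlgebroid.completeLiftEndoFun]
  have h' := (exists_lift_decomp σ y).choose_spec
  set p := (exists_lift_decomp σ y).choose
  rw [h] at h'
  have h0 : s y.proj = p.1 y.proj := by
    have h1 : s y.proj + 0 = p.1 y.proj + 0 := congrArg Prod.fst h'
    simpa using h1
  have h2 : (𝔏.completeLift (s - p.1)).1 y = (𝔏.verticalLift (p.2 - t)).1 y := by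
    rw [map_sub, map_sub]
    change (𝔏.completeLift s).1 y - (𝔏.completeLift p.1).1 y =
      (𝔏.verticalLift p.2).1 y - (𝔏.verticalLift t).1 y
    rw [sub_eq_sub_iff_add_eq_add, h', add_comm]
  have h3 := completeLift_endo_eq J (sub_eq_zero.mpr h0) h2
  rw [map_sub, map_sub, map_sub, map_sub] at h3
  have h4 : (𝔏.completeLift (J s)).1 y - (𝔏.completeLift (J p.1)).1 y =
      (𝔏.verticalLift (J p.2)).1 y - (𝔏.verticalLift (J t)).1 y := h3
  rw [sub_eq_sub_iff_add_eq_add] at h4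
  rw [h4, add_comm]

lemma contMDiffAt_completeLiftEndoFun
    (J : Cₛ^∞⟮𝓘(ℝ, EB); F, V⟯ →ₗ[C^∞⟮𝓘(ℝ, EB), M; ℝ⟯] Cₛ^∞⟮𝓘(ℝ, EB); F, V⟯)
    (σ : 𝔏.prolongSections) (y₀ : TotalSpace F V) :
    ContMDiffAt (𝓘(ℝ, EB).prod 𝓘(ℝ, F)) (𝓘(ℝ, EB).prod 𝓘(ℝ, F)) ∞
      (fun y => (⟨y.proj, (𝔏.completeLiftEndoFun J σ y).1⟩ : TotalSpace F V)) y₀ ∧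
    ContMDiffAt (𝓘(ℝ, EB).prod 𝓘(ℝ, F)) (𝓘(ℝ, EB).prod 𝓘(ℝ, F)).tangent ∞
      (fun y => (⟨y, (𝔏.completeLiftEndoFun J σ y).2⟩ :
        TangentBundle (𝓘(ℝ, EB).prod 𝓘(ℝ, F)) (TotalSpace F V))) y₀ := by
  have hx := mem_baseSet_trivializationAt F V y₀.proj
  set e := trivializationAt F V y₀.proj
  let b := Module.finBasis ℝ F
  choose E hE using fun i => exists_const_section (EB := EB) e hx (b i)
  have hE' : ∀ᶠ y : TotalSpace F V in nhds y₀, ∀ i, (e ⟨y.proj, E i y.proj⟩).2 = b i :=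
    (FiberBundle.continuous_proj F V).continuousAt.eventually (Filter.eventually_all.mpr hE)
  let a : Fin (Module.finrank ℝ F) → TotalSpace F V → ℝ := fun i y =>
    (b.coord i).toContinuousLinearMap (e ⟨y.proj, (σ.1 y).1⟩).2
  let w : TotalSpace F V → F := fun y =>
    dfib EB e y (σ.1 y).2 - ∑ i, a i y • dfib EB e y (𝔏.completeVector (E i) y)
  let c : Fin (Module.finrank ℝ F) → TotalSpace F V → ℝ := fun i y =>
    (b.coord i).toContinuousLinearMap (w y)
  have hU : IsOpen {y : TotalSpace F V | y.proj ∈ e.baseSet} :=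
    e.open_baseSet.preimage (FiberBundle.continuous_proj F V)
  have hfib : ContMDiffOn (𝓘(ℝ, EB).prod 𝓘(ℝ, F)) 𝓘(ℝ, F) ∞ (fun y : TotalSpace F V => (e y).2)
      {y : TotalSpace F V | y.proj ∈ e.baseSet} :=
    fun y hy => (contMDiffAt_fib e hy).contMDiffWithinAt
  have ha : ∀ i, ContMDiffAt (𝓘(ℝ, EB).prod 𝓘(ℝ, F)) 𝓘(ℝ) ∞ (a i) y₀ := fun i =>
    (b.coord i).toContinuousLinearMap.contMDiff.contMDiffAt.comp y₀
      (contMDiffAt_fib_base e σ.2.2.1 hx)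
  have hw : ContMDiffAt (𝓘(ℝ, EB).prod 𝓘(ℝ, F)) 𝓘(ℝ, F) ∞ w y₀ :=
    (contMDiffAt_mvfderiv hU hfib hx (σ.2.2.2 y₀)).sub (ContMDiffAt.sum fun i _ =>
      (ha i).smul (contMDiffAt_mvfderiv hU hfib hx (contMDiff_completeVector 𝔏 (E i) y₀)))
  have hc : ∀ i, ContMDiffAt (𝓘(ℝ, EB).prod 𝓘(ℝ, F)) 𝓘(ℝ) ∞ (c i) y₀ := fun i =>
    (b.coord i).toContinuousLinearMap.contMDiff.contMDiffAt.comp y₀ hw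
  have main : ∀ᶠ y in nhds y₀, 𝔏.completeLiftEndoFun J σ y =
      (∑ i, a i y • (𝔏.completeLift (J (E i))).1 y) +
        ∑ i, c i y • (𝔏.verticalLift (J (E i))).1 y := by
    filter_upwards [hE', eventually_mem_baseSet e hx] with y h1 hy
    have hb1 : (σ.1 y).1 = ∑ i, a i y • E i y.proj := by
      apply fib_inj e hy
      rw [fib_sum e hy]
      simp only [fib_smul e hy, h1]
      exact (b.sum_repr _).symm
    have key : σ.1 y = (𝔏.completeLift (∑ i, a i y • E i)).1 y +
        (𝔏.verticalLift (∑ i, c i y • E i)).1 y := by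
      rw [map_sum, map_sum, prolong_sum, prolong_sum]
      simp only [map_smul]
      change σ.1 y = (∑ i, a i y • (E i y.proj, 𝔏.completeVector (E i) y)) +
        ∑ i, c i y • ((0 : V y.proj), verticalVector EB y (E i y.proj))
      refine Prod.ext ?_ (tot_ext e hy ?_ ?_)
      · simp only [Prod.fst_add, Prod.fst_sum, Prod.smul_fst, smul_zero, Finset.sum_const_zero,
          add_zero]
        exact hb1
      · simp only [Prod.snd_add, Prod.snd_sum, Prod.smul_snd, map_add, map_sum, map_smul,
          dproj_completeVector, dproj_verticalVector, smul_zero, Finset.sum_const_zero, add_zero]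
        rw [← (σ.2.1 y : 𝔏.anchor y.proj (σ.1 y).1 = _), hb1, map_sum]
        simp only [map_smul]
      · simp only [Prod.snd_add, Prod.snd_sum, Prod.smul_snd, map_add, map_sum, map_smul,
          dfib_verticalVector e hy, h1]
        have hsum : ∑ i, c i y • b i = w y := b.sum_repr (w y)
        rw [hsum]
        exact (add_sub_cancel _ _).symm
    rw [completeLiftEndoFun_eq J key]
    simp only [map_sum, endo_smul, map_smul, prolong_sum]
    rfl
  constructor
  · rw [Trivialization.contMDiffAt_iff (e := e) (e.mem_source.mpr hx)]
    refine ⟨(Bundle.contMDiff_proj (n := ∞) (IB := 𝓘(ℝ, EB)) V) y₀, ?_⟩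
    have h2 : ContMDiffAt (𝓘(ℝ, EB).prod 𝓘(ℝ, F)) 𝓘(ℝ, F) ∞ (fun y : TotalSpace F V =>
        ∑ i, a i y • (e ⟨y.proj, J (E i) y.proj⟩).2) y₀ :=
      ContMDiffAt.sum fun i _ => (ha i).smul (contMDiffAt_fib_comp e _ hx)
    refine h2.congr_of_eventuallyEq ?_
    filter_upwards [main, eventually_mem_baseSet e hx] with y h3 hy
    have h4 : (𝔏.completeLiftEndoFun J σ y).1 = ∑ i, a i y • J (E i) y.proj := by
      rw [h3]
      simp only [Prod.fst_add, Prod.fst_sum, Prod.smul_fst, verticalLift_fst, completeLift_fst,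
        smul_zero, Finset.sum_const_zero, add_zero]
    change (e ⟨y.proj, (𝔏.completeLiftEndoFun J σ y).1⟩).2 = _
    rw [h4, fib_sum e hy]
    simp only [fib_smul e hy]
  · have h2 : ContMDiffAt (𝓘(ℝ, EB).prod 𝓘(ℝ, F)) (𝓘(ℝ, EB).prod 𝓘(ℝ, F)).tangent ∞
        (fun y => (⟨y, (∑ i, a i y • 𝔏.completeVector (J (E i)) y) +
          ∑ i, c i y • verticalVector EB y (J (E i) y.proj)⟩ :
          TangentBundle (𝓘(ℝ, EB).prod 𝓘(ℝ, F)) (TotalSpace F V))) y₀ :=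
      ContMDiffAt.add_section
        (ContMDiffAt.sum_section fun i _ =>
          ContMDiffAt.smul_section (ha i) (contMDiff_completeVector 𝔏 (J (E i)) y₀))
        (ContMDiffAt.sum_section fun i _ =>
          ContMDiffAt.smul_section (hc i) (contMDiff_verticalVector (J (E i)) y₀))
    refine h2.congr_of_eventuallyEq ?_
    filter_upwards [main] with y h3
    have h4 : (𝔏.completeLiftEndoFun J σ y).2 = (∑ i, a i y • 𝔏.completeVector (J (E i)) y) +
          ∑ i, c i y • verticalVector EB y (J (E i) y.proj) := by
      rw [h3]
      simp only [Prod.snd_add, Prod.snd_sum, Prod.smul_snd, verticalLift_snd, completeLift_snd]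
    rw [h4]

lemma completeLiftEndoFun_mem (𝔏 : LieAlgebroid EB F V)
    (J : Cₛ^∞⟮𝓘(ℝ, EB); F, V⟯ →ₗ[C^∞⟮𝓘(ℝ, EB), M; ℝ⟯] Cₛ^∞⟮𝓘(ℝ, EB); F, V⟯)
    (σ : 𝔏.prolongSections) : 𝔏.completeLiftEndoFun J σ ∈ 𝔏.prolongSections := by
  refine ⟨fun y => ?_, fun y => (contMDiffAt_completeLiftEndoFun J σ y).1,
    fun y => (contMDiffAt_completeLiftEndoFun J σ y).2⟩
  obtain ⟨p, hp⟩ := exists_lift_decomp σ y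
  rw [completeLiftEndoFun_eq J hp]
  exact (𝔏.prolongFiber y).add_mem ((𝔏.completeLift (J p.1)).2.1 y)
    ((𝔏.verticalLift (J p.2)).2.1 y)

lemma completeLiftEndoFun_add (𝔏 : LieAlgebroid EB F V)
    (J : Cₛ^∞⟮𝓘(ℝ, EB); F, V⟯ →ₗ[C^∞⟮𝓘(ℝ, EB), M; ℝ⟯] Cₛ^∞⟮𝓘(ℝ, EB); F, V⟯)
    (σ τ : 𝔏.prolongSections) (y : TotalSpace F V) : 𝔏.completeLiftEndoFun J (σ + τ) y =
      𝔏.completeLiftEndoFun J σ y + 𝔏.completeLiftEndoFun J τ y := by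
  obtain ⟨p, hp⟩ := exists_lift_decomp σ y
  obtain ⟨q, hq⟩ := exists_lift_decomp τ y
  have hadd : ∀ α β : 𝔏.prolongSections, (α + β).1 y = α.1 y + β.1 y := fun _ _ => rfl
  have h : (σ + τ).1 y = (𝔏.completeLift (p.1 + q.1)).1 y + (𝔏.verticalLift (p.2 + q.2)).1 y := by
    rw [map_add, map_add, hadd, hadd, hadd, hp, hq, add_add_add_comm]
  rw [completeLiftEndoFun_eq J h, completeLiftEndoFun_eq J hp, completeLiftEndoFun_eq J hq,
    map_add, map_add, map_add, map_add, hadd, hadd, add_add_add_comm]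

lemma completeLiftEndoFun_smul (𝔏 : LieAlgebroid EB F V)
    (J : Cₛ^∞⟮𝓘(ℝ, EB); F, V⟯ →ₗ[C^∞⟮𝓘(ℝ, EB), M; ℝ⟯] Cₛ^∞⟮𝓘(ℝ, EB); F, V⟯)
    (f : C^∞⟮𝓘(ℝ, EB).prod 𝓘(ℝ, F), TotalSpace F V; ℝ⟯)
    (σ : 𝔏.prolongSections) (y : TotalSpace F V) : 𝔏.completeLiftEndoFun J (f • σ) y =
      f y • 𝔏.completeLiftEndoFun J σ y := by
  obtain ⟨p, hp⟩ := exists_lift_decomp σ y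
  have hsmul : ∀ (c : ℝ) (α : 𝔏.prolongSections), (c • α).1 y = c • α.1 y := fun _ _ => rfl
  have h : (f • σ).1 y = (𝔏.completeLift (f y • p.1)).1 y + (𝔏.verticalLift (f y • p.2)).1 y := by
    rw [map_smul, map_smul, hsmul, hsmul, ← smul_add, ← hp, prolong_smul_apply]
  rw [completeLiftEndoFun_eq J h, completeLiftEndoFun_eq J hp, endo_smul, endo_smul, map_smul,
    map_smul, hsmul, hsmul, smul_add]

/-- The complete lift `J^c` of an endomorphism `J`. It is determined by `J^c s^c = (J s)^c` and
`J^c s^v = (J s)^v`. -/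
def LieAlgebroid.completeLiftEndo (𝔏 : LieAlgebroid EB F V)
    (J : Cₛ^∞⟮𝓘(ℝ, EB); F, V⟯ →ₗ[C^∞⟮𝓘(ℝ, EB), M; ℝ⟯] Cₛ^∞⟮𝓘(ℝ, EB); F, V⟯) :
    𝔏.prolongSections →ₗ[C^∞⟮𝓘(ℝ, EB).prod 𝓘(ℝ, F), TotalSpace F V; ℝ⟯] 𝔏.prolongSections where
  toFun σ := ⟨𝔏.completeLiftEndoFun J σ, completeLiftEndoFun_mem 𝔏 J σ⟩
  map_add' σ τ := Subtype.ext <| funext fun y => completeLiftEndoFun_add 𝔏 J σ τ y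
  map_smul' f σ := Subtype.ext <| funext fun y => completeLiftEndoFun_smul 𝔏 J f σ y

lemma completeLiftEndo_completeLift
    (J : Cₛ^∞⟮𝓘(ℝ, EB); F, V⟯ →ₗ[C^∞⟮𝓘(ℝ, EB), M; ℝ⟯] Cₛ^∞⟮𝓘(ℝ, EB); F, V⟯)
    (s : Cₛ^∞⟮𝓘(ℝ, EB); F, V⟯) :
    𝔏.completeLiftEndo J (𝔏.completeLift s) = 𝔏.completeLift (J s) := by
  refine Subtype.ext <| funext fun y => ?_
  have h : (𝔏.completeLift s).1 y = (𝔏.completeLift s).1 y + (𝔏.verticalLift 0).1 y := by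
    rw [map_zero]
    exact (add_zero _).symm
  refine (completeLiftEndoFun_eq J h).trans ?_
  rw [map_zero, map_zero]
  exact add_zero _

lemma completeLiftEndo_verticalLift
    (J : Cₛ^∞⟮𝓘(ℝ, EB); F, V⟯ →ₗ[C^∞⟮𝓘(ℝ, EB), M; ℝ⟯] Cₛ^∞⟮𝓘(ℝ, EB); F, V⟯)
    (s : Cₛ^∞⟮𝓘(ℝ, EB); F, V⟯) :
    𝔏.completeLiftEndo J (𝔏.verticalLift s) = 𝔏.verticalLift (J s) := by
  refine Subtype.ext <| funext fun y => ?_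
  have h : (𝔏.verticalLift s).1 y = (𝔏.completeLift 0).1 y + (𝔏.verticalLift s).1 y := by
    rw [map_zero]
    exact (zero_add _).symm
  refine (completeLiftEndoFun_eq J h).trans ?_
  rw [map_zero, map_zero]
  exact zero_add _
end LiftEndo

section LiftBisection
variable {EB : Type*} [NormedAddCommGroup EB] [NormedSpace ℝ EB]
  {M : Type*} [TopologicalSpace M] [ChartedSpace EB M] [IsManifold 𝓘(ℝ, EB) ∞ M]
  {F : Type*} [NormedAddCommGroup F] [NormedSpace ℝ F]
  {V : M → Type*} [TopologicalSpace (TotalSpace F V)] [∀ x, AddCommGroup (V x)]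
  [∀ x, Module ℝ (V x)] [∀ x, TopologicalSpace (V x)] [FiberBundle F V] [VectorBundle ℝ F V]
  [ContMDiffVectorBundle ∞ F V 𝓘(ℝ, EB)]
variable [T2Space M] [FiniteDimensional ℝ EB] [FiniteDimensional ℝ F]

lemma wedge_smul_left {A L : Type*} [CommRing A] [AddCommGroup L] [Module A L] (f : A) (s t : L) :
    wedge A (f • s) t = f • wedge A s t := by
  apply Subtype.ext
  simp [coe_wedge]

lemma wedge_smul_right {A L : Type*} [CommRing A] [AddCommGroup L] [Module A L] (f : A) (s t : L) :
    wedge A s (f • t) = f • wedge A s t := by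
  apply Subtype.ext
  simp [coe_wedge]

lemma wedge_add_left {A L : Type*} [CommRing A] [AddCommGroup L] [Module A L] (s s' t : L) :
    wedge A (s + s') t = wedge A s t + wedge A s' t := by
  apply Subtype.ext
  simp [coe_wedge, add_mul]

lemma wedge_add_right {A L : Type*} [CommRing A] [AddCommGroup L] [Module A L] (s t t' : L) :
    wedge A s (t + t') = wedge A s t + wedge A s t' := by
  apply Subtype.ext
  simp [coe_wedge, mul_add]

lemma wedge_swap {A L : Type*} [CommRing A] [AddCommGroup L] [Module A L] (s t : L) :
    wedge A s t = - wedge A t s := by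
  apply Subtype.ext
  rw [coe_wedge, ι_mul_swap]
  simp [coe_wedge]

/-- The complete lift of real bisections: `(s ∧ t)^c = s^c ∧ t^v + s^v ∧ t^c`. -/
def LieAlgebroid.completeLiftBisection (𝔏 : LieAlgebroid EB F V) :
    ⋀[C^∞⟮𝓘(ℝ, EB), M; ℝ⟯]^2 Cₛ^∞⟮𝓘(ℝ, EB); F, V⟯ →ₗ[ℝ]
      ⋀[C^∞⟮𝓘(ℝ, EB).prod 𝓘(ℝ, F), TotalSpace F V; ℝ⟯]^2 𝔏.prolongSections :=
  bisectionLift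
    ((wedgeₗ C^∞⟮𝓘(ℝ, EB).prod 𝓘(ℝ, F), TotalSpace F V; ℝ⟯ 𝔏.prolongSections).compl₁₂
        𝔏.completeLift 𝔏.verticalLift +
      (wedgeₗ C^∞⟮𝓘(ℝ, EB).prod 𝓘(ℝ, F), TotalSpace F V; ℝ⟯ 𝔏.prolongSections).compl₁₂
        𝔏.verticalLift 𝔏.completeLift)
    (fun f s t => by
      change wedge _ (𝔏.completeLift (f • s)) (𝔏.verticalLift t) +
          wedge _ (𝔏.verticalLift (f • s)) (𝔏.completeLift t) =
        wedge _ (𝔏.completeLift s) (𝔏.verticalLift (f • t)) +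
          wedge _ (𝔏.verticalLift s) (𝔏.completeLift (f • t))
      simp only [completeLift_smul, verticalLift_smul, wedge_add_left, wedge_add_right,
        wedge_smul_left, wedge_smul_right]
      abel)
    (fun f s => by
      change wedge _ (𝔏.completeLift (f • s)) (𝔏.verticalLift s) +
          wedge _ (𝔏.verticalLift (f • s)) (𝔏.completeLift s) = 0
      simp only [completeLift_smul, verticalLift_smul, wedge_add_left, wedge_smul_left, wedge_self,
        smul_zero, add_zero]
      rw [wedge_swap (𝔏.verticalLift s), smul_neg, add_neg_cancel])

lemma completeLiftBisection_wedge (𝔏 : LieAlgebroid EB F V) (s t : Cₛ^∞⟮𝓘(ℝ, EB); F, V⟯) :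
    𝔏.completeLiftBisection (wedge C^∞⟮𝓘(ℝ, EB), M; ℝ⟯ s t) =
      wedge _ (𝔏.completeLift s) (𝔏.verticalLift t) +
        wedge _ (𝔏.verticalLift s) (𝔏.completeLift t) :=
  bisectionLift_wedge _ _ _ s t

/-- The complete lift of complex bisections. -/
def LieAlgebroid.completeLiftBisectionC (𝔏 : LieAlgebroid EB F V) :
    ℂ ⊗[ℝ] ⋀[C^∞⟮𝓘(ℝ, EB), M; ℝ⟯]^2 Cₛ^∞⟮𝓘(ℝ, EB); F, V⟯ →ₗ[ℂ]
      ℂ ⊗[ℝ] ⋀[C^∞⟮𝓘(ℝ, EB).prod 𝓘(ℝ, F), TotalSpace F V; ℝ⟯]^2 𝔏.prolongSections :=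
  𝔏.completeLiftBisection.baseChange ℂ
end LiftBisection

end

/-!
The proof rests on two facts about a Lie algebroid and its prolongation: the three bracket rules
`[s^v, t^v] = 0`, `[s^v, t^c] = [s, t]^v`, `[s^c, t^c] = [s, t]^c`, and the principle that a map of
sections of the prolongation which is linear over the functions on the total space vanishes as soon
as it vanishes on vertical and complete lifts. Both are collected in the structure `BracketLift`,
and everything else is algebra over such a structure.

Sections of the prolongation are tested against fibrewise linear functions `g` on the total space.
A vertical lift acts on them by `s^v g = (g ∘ s) ∘ p`, and a complete lift by the Lie derivative
`(s^c g) ∘ t = ρ(s)(g ∘ t) - g ∘ [s, t]` (`compSection_anchor_completeLift`). As the anchor of the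
prolongation respects brackets, the bracket rules follow by commuting these actions; for two
complete lifts the computation is the Jacobi identity of the given algebroid. The principle about
linear maps holds because, after multiplication by a cutoff function on the base, every section of
the prolongation is a finite combination of lifts (`exists_smul_eq_sum_lifts`).

The Jacobiator is tensorial once the anchor respects brackets, and the Nijenhuis tensor is tensorial
once `J² = -1`. On lifts each of them is either zero or a lift of the corresponding expression on
the given algebroid. This yields the Jacobi identity, and the equivalence of integrability of `J^c`
and of `J`, the vertical lift being injective.

For the Schouten-Nijenhuis bracket, `f ↦ f^v + ε f^c` and `s ↦ s^v + ε s^c` define a ring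
homomorphism from the exterior algebra of the given algebroid to the dual numbers over the exterior
algebra of the prolongation (`BracketLift.dualLift`). Its `ε`-component extends the complete lift to
trisections, and on decomposable bisections the bracket rules give `[P^c, Q^c] = [P, Q]^c`
(`BracketLift.schouten_lift`). The vanishing of `[P, P]` and `[P, conj P]` therefore passes to the
complete lifts.
-/

noncomputable section

set_option linter.unusedSectionVars false

/-! ### The Jacobiator and the Nijenhuis tensor of an anchored bracket -/

namespace AnchoredBracket

variable {A L : Type*} [CommRing A] [Algebra ℝ A] [AddCommGroup L] [Module A L] [Module ℝ L]
  [IsScalarTower ℝ A L] (𝔟 : AnchoredBracket A L)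

/-- The Jacobiator, which measures the failure of the Jacobi identity. -/
def jacobiator (s t u : L) : L :=
  𝔟.bracket s (𝔟.bracket t u) - 𝔟.bracket (𝔟.bracket s t) u - 𝔟.bracket t (𝔟.bracket s u)

lemma jacobiator_add (s t u u' : L) :
    𝔟.jacobiator s t (u + u') = 𝔟.jacobiator s t u + 𝔟.jacobiator s t u' := by
  simp only [jacobiator, map_add]
  abel

/-- When the anchor respects brackets, the terms in which `f` is differentiated cancel. -/
lemma jacobiator_smul (h : ∀ s t, 𝔟.anchor (𝔟.bracket s t) = ⁅𝔟.anchor s, 𝔟.anchor t⁆)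
    (s t u : L) (f : A) : 𝔟.jacobiator s t (f • u) = f • 𝔟.jacobiator s t u := by
  simp only [jacobiator, bracket_smul, map_add, h, Derivation.commutator_apply, sub_smul, smul_sub]
  abel

lemma jacobiator_swap_left (s t u : L) : 𝔟.jacobiator s t u = -𝔟.jacobiator t s u := by
  simp only [jacobiator, 𝔟.bracket_swap s t, map_neg, LinearMap.neg_apply]
  abel

lemma jacobiator_swap_right (s t u : L) : 𝔟.jacobiator s t u = -𝔟.jacobiator s u t := by
  simp only [jacobiator, 𝔟.bracket_swap u t, 𝔟.bracket_swap (𝔟.bracket s t) u,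
    𝔟.bracket_swap (𝔟.bracket s u) t, map_neg]
  abel

lemma nijenhuis_swap (J : L →ₗ[A] L) (s t : L) : 𝔟.nijenhuis J s t = -𝔟.nijenhuis J t s := by
  simp only [nijenhuis, 𝔟.bracket_swap (J s) (J t), 𝔟.bracket_swap s (J t),
    𝔟.bracket_swap (J s) t, 𝔟.bracket_swap s t, map_neg]
  abel

lemma nijenhuis_add (J : L →ₗ[A] L) (s t t' : L) :
    𝔟.nijenhuis J s (t + t') = 𝔟.nijenhuis J s t + 𝔟.nijenhuis J s t' := by
  simp only [nijenhuis, map_add]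
  abel

/-- The terms in which `f` is differentiated cancel because `J² = -1`. -/
lemma nijenhuis_smul {J : L →ₗ[A] L} (hJ : IsAlmostComplex J) (s t : L) (f : A) :
    𝔟.nijenhuis J s (f • t) = f • 𝔟.nijenhuis J s t := by
  simp only [nijenhuis, bracket_smul, map_add, map_smul, smul_sub, hJ t, smul_neg]
  abel

end AnchoredBracket

/-! ### Lifts between anchored brackets -/

/-- Vertical and complete lifts from the functions `A` and sections `L` of one anchored bracket to
the functions `A'` and sections `L'` of another. The last field says that an `A'`-linear map is
determined by its values on lifts. -/
structure BracketLift {A L A' L' : Type*} [CommRing A] [Algebra ℝ A] [AddCommGroup L] [Module A L]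
    [Module ℝ L] [CommRing A'] [Algebra ℝ A'] [AddCommGroup L'] [Module A' L'] [Module ℝ L']
    (𝔟 : AnchoredBracket A L) (𝔟' : AnchoredBracket A' L') where
  vFun : A →ₐ[ℝ] A'
  cFun : A →ₗ[ℝ] A'
  cFun_mul : ∀ f g, cFun (f * g) = vFun f * cFun g + cFun f * vFun g
  v : L →ₗ[ℝ] L'
  c : L →ₗ[ℝ] L'
  v_smul : ∀ f s, v (f • s) = vFun f • v s
  c_smul : ∀ f s, c (f • s) = vFun f • c s + cFun f • v s
  v_injective : Function.Injective v
  bracket_v_v : ∀ s t, 𝔟'.bracket (v s) (v t) = 0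
  bracket_v_c : ∀ s t, 𝔟'.bracket (v s) (c t) = v (𝔟.bracket s t)
  bracket_c_c : ∀ s t, 𝔟'.bracket (c s) (c t) = c (𝔟.bracket s t)
  eq_zero_of_lifts : ∀ T : L' → L', (∀ σ τ, T (σ + τ) = T σ + T τ) →
    (∀ (f : A') σ, T (f • σ) = f • T σ) → (∀ s, T (v s) = 0) → (∀ s, T (c s) = 0) → ∀ σ, T σ = 0

namespace BracketLift

variable {A L A' L' : Type*} [CommRing A] [Algebra ℝ A] [AddCommGroup L] [Module A L]
  [Module ℝ L] [IsScalarTower ℝ A L] [CommRing A'] [Algebra ℝ A'] [AddCommGroup L'] [Module A' L']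
  [Module ℝ L'] [IsScalarTower ℝ A' L']
  {𝔟 : AnchoredBracket A L} {𝔟' : AnchoredBracket A' L'} (Λ : BracketLift 𝔟 𝔟')


lemma bracket_c_v (s t : L) : 𝔟'.bracket (Λ.c s) (Λ.v t) = Λ.v (𝔟.bracket s t) := by
  rw [𝔟'.bracket_swap, Λ.bracket_v_c, 𝔟.bracket_swap t s, map_neg, neg_neg]

/-- The Jacobiator of lifts is the lift of the Jacobiator; as it is tensorial, it vanishes. -/
lemma isLie (Λ : BracketLift 𝔟 𝔟') (h : 𝔟.IsLie)
    (h' : ∀ σ τ, 𝔟'.anchor (𝔟'.bracket σ τ) = ⁅𝔟'.anchor σ, 𝔟'.anchor τ⁆) : 𝔟'.IsLie := by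
  refine ⟨fun σ τ υ => ?_, h'⟩
  have hb : ∀ s t u, 𝔟.bracket s (𝔟.bracket t u) - 𝔟.bracket (𝔟.bracket s t) u -
      𝔟.bracket t (𝔟.bracket s u) = 0 := fun s t u => by rw [h.jacobi s t u]; abel
  have hc : ∀ s t u, 𝔟'.jacobiator (Λ.c s) (Λ.c t) (Λ.c u) = 0 := fun s t u => by
    simp only [AnchoredBracket.jacobiator, Λ.bracket_c_c, ← map_sub, hb, map_zero]
  have hv : ∀ s t u, 𝔟'.jacobiator (Λ.c s) (Λ.c t) (Λ.v u) = 0 := fun s t u => by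
    simp only [AnchoredBracket.jacobiator, Λ.bracket_c_v, Λ.bracket_c_c, ← map_sub, hb, map_zero]
  have hvv : ∀ s t u, 𝔟'.jacobiator (Λ.c s) (Λ.v t) (Λ.v u) = 0 := fun s t u => by
    simp only [AnchoredBracket.jacobiator, Λ.bracket_c_v, Λ.bracket_v_v, map_zero, sub_zero]
  have hvvv : ∀ s t u, 𝔟'.jacobiator (Λ.v s) (Λ.v t) (Λ.v u) = 0 := fun s t u => by
    simp only [AnchoredBracket.jacobiator, Λ.bracket_v_v, map_zero, LinearMap.zero_apply, sub_zero]
  -- Tensoriality in the last argument, moved to the other arguments by antisymmetry.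
  have ext3 : ∀ σ τ, (∀ u, 𝔟'.jacobiator σ τ (Λ.v u) = 0) → (∀ u, 𝔟'.jacobiator σ τ (Λ.c u) = 0) →
      ∀ υ, 𝔟'.jacobiator σ τ υ = 0 := fun σ τ =>
    Λ.eq_zero_of_lifts _ (𝔟'.jacobiator_add σ τ) fun f υ => 𝔟'.jacobiator_smul h' σ τ υ f
  have ext2 : ∀ σ, (∀ t υ, 𝔟'.jacobiator σ (Λ.v t) υ = 0) →
      (∀ t υ, 𝔟'.jacobiator σ (Λ.c t) υ = 0) → ∀ τ υ, 𝔟'.jacobiator σ τ υ = 0 := by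
    intro σ h1 h2 τ υ
    rw [𝔟'.jacobiator_swap_right, neg_eq_zero]
    refine ext3 σ υ (fun t => ?_) (fun t => ?_) τ
    · rw [𝔟'.jacobiator_swap_right, h1, neg_zero]
    · rw [𝔟'.jacobiator_swap_right, h2, neg_zero]
  have hcc : ∀ s t υ, 𝔟'.jacobiator (Λ.c s) (Λ.c t) υ = 0 := fun s t => ext3 _ _ (hv s t) (hc s t)
  have hcv : ∀ s t υ, 𝔟'.jacobiator (Λ.c s) (Λ.v t) υ = 0 := fun s t =>
    ext3 _ _ (hvv s t) fun u => by rw [𝔟'.jacobiator_swap_right, hv, neg_zero]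
  have hvv' : ∀ s t υ, 𝔟'.jacobiator (Λ.v s) (Λ.v t) υ = 0 := fun s t =>
    ext3 _ _ (hvvv s t) fun u => by
      rw [𝔟'.jacobiator_swap_right, 𝔟'.jacobiator_swap_left, hcv, neg_zero, neg_zero]
  have h1 : ∀ s τ υ, 𝔟'.jacobiator (Λ.c s) τ υ = 0 := fun s => ext2 _ (hcv s) (hcc s)
  have h2 : ∀ s τ υ, 𝔟'.jacobiator (Λ.v s) τ υ = 0 := fun s => ext2 _ (hvv' s) fun t υ => by
    rw [𝔟'.jacobiator_swap_left, h1, neg_zero]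
  have main : 𝔟'.jacobiator σ τ υ = 0 := ext2 σ
    (fun t υ => by rw [𝔟'.jacobiator_swap_left, h2, neg_zero])
    (fun t υ => by rw [𝔟'.jacobiator_swap_left, h1, neg_zero]) τ υ
  rw [AnchoredBracket.jacobiator, sub_sub, sub_eq_zero] at main
  exact main

section Endomorphisms

variable {J : L →ₗ[A] L} {J' : L' →ₗ[A'] L'}

/-- An endomorphism that restricts to `J` on both kinds of lifts squares to `-1` if `J` does. -/
lemma isAlmostComplex (hv : ∀ s, J' (Λ.v s) = Λ.v (J s)) (hc : ∀ s, J' (Λ.c s) = Λ.c (J s))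
    (hJ : IsAlmostComplex J) : IsAlmostComplex J' := by
  have h := Λ.eq_zero_of_lifts (fun σ => J' (J' σ) + σ)
    (fun σ τ => by simp only [map_add]; abel) (fun f σ => by simp only [map_smul, smul_add])
    (fun s => by rw [hv, hv, hJ, map_neg, neg_add_cancel])
    (fun s => by rw [hc, hc, hJ, map_neg, neg_add_cancel])
  exact fun σ => eq_neg_of_add_eq_zero_left (h σ)

lemma isIntegrable_iff (hv : ∀ s, J' (Λ.v s) = Λ.v (J s)) (hc : ∀ s, J' (Λ.c s) = Λ.c (J s))
    (hJ : IsAlmostComplex J) : 𝔟'.IsIntegrable J' ↔ 𝔟.IsIntegrable J := by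
  have hcc : ∀ s t, 𝔟'.nijenhuis J' (Λ.c s) (Λ.c t) = Λ.c (𝔟.nijenhuis J s t) := fun s t => by
    simp only [AnchoredBracket.nijenhuis, hc, Λ.bracket_c_c, map_sub]
  have hcv : ∀ s t, 𝔟'.nijenhuis J' (Λ.c s) (Λ.v t) = Λ.v (𝔟.nijenhuis J s t) := fun s t => by
    simp only [AnchoredBracket.nijenhuis, hc, hv, Λ.bracket_c_v, map_sub]
  have hvv : ∀ s t, 𝔟'.nijenhuis J' (Λ.v s) (Λ.v t) = 0 := fun s t => by
    simp only [AnchoredBracket.nijenhuis, hv, Λ.bracket_v_v, map_zero, sub_zero]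
  constructor
  · intro h s t
    apply Λ.v_injective
    rw [← hcv, h, map_zero]
  · intro h
    have hJ' := Λ.isAlmostComplex hv hc hJ
    have ext : ∀ σ, (∀ t, 𝔟'.nijenhuis J' σ (Λ.v t) = 0) → (∀ t, 𝔟'.nijenhuis J' σ (Λ.c t) = 0) →
        ∀ τ, 𝔟'.nijenhuis J' σ τ = 0 := fun σ =>
      Λ.eq_zero_of_lifts _ (𝔟'.nijenhuis_add J' σ) fun f τ => 𝔟'.nijenhuis_smul hJ' σ τ f
    have h1 : ∀ s τ, 𝔟'.nijenhuis J' (Λ.c s) τ = 0 := fun s => ext _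
      (fun t => by rw [hcv, h, map_zero]) (fun t => by rw [hcc, h, map_zero])
    have h2 : ∀ s τ, 𝔟'.nijenhuis J' (Λ.v s) τ = 0 := fun s => ext _ (hvv s)
      (fun t => by rw [𝔟'.nijenhuis_swap, h1, neg_zero])
    exact fun σ => ext σ (fun t => by rw [𝔟'.nijenhuis_swap, h2, neg_zero])
      (fun t => by rw [𝔟'.nijenhuis_swap, h1, neg_zero])

end Endomorphisms

end BracketLift

/-! ### Complete lifts of multisections and the Schouten-Nijenhuis bracket -/

namespace BracketLift

variable {A L A' L' : Type*} [CommRing A] [Algebra ℝ A] [AddCommGroup L] [Module A L]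
  [Module ℝ L] [IsScalarTower ℝ A L] [CommRing A'] [Algebra ℝ A'] [AddCommGroup L'] [Module A' L']
  [Module ℝ L'] [IsScalarTower ℝ A' L']
  {𝔟 : AnchoredBracket A L} {𝔟' : AnchoredBracket A' L'} (Λ : BracketLift 𝔟 𝔟')

lemma cFun_algebraMap (r : ℝ) : Λ.cFun (algebraMap ℝ A r) = 0 := by
  have h := Λ.cFun_mul 1 1
  rw [mul_one, map_one Λ.vFun, one_mul, mul_one, left_eq_add] at h
  rw [Algebra.algebraMap_eq_smul_one, map_smul, h, smul_zero]

/-- The ring homomorphism `f ↦ f^v + ε f^c` into the dual numbers. It is multiplicative because the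
complete lift of functions is a derivation along the vertical lift. -/
def dualFun : A →+* DualNumber (ExteriorAlgebra A' L') where
  toFun f := TrivSqZeroExt.inl (algebraMap A' _ (Λ.vFun f)) +
    TrivSqZeroExt.inr (algebraMap A' _ (Λ.cFun f))
  map_one' := by
    have h := Λ.cFun_algebraMap 1
    rw [map_one] at h
    ext <;> simp [h]
  map_mul' f g := by
    ext
    · simp
    · simp only [Λ.cFun_mul, TrivSqZeroExt.snd_mul, TrivSqZeroExt.fst_add, TrivSqZeroExt.snd_add,
        TrivSqZeroExt.fst_inl, TrivSqZeroExt.fst_inr, TrivSqZeroExt.snd_inl, TrivSqZeroExt.snd_inr,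
        map_add, map_mul, smul_eq_mul, MulOpposite.smul_eq_mul_unop, MulOpposite.unop_op, add_zero,
        zero_add]
  map_zero' := by ext <;> simp
  map_add' f g := by
    ext <;> simp [Algebra.algebraMap_eq_smul_one, add_smul]

lemma fst_dualFun (f : A) : (Λ.dualFun f).fst = algebraMap A' _ (Λ.vFun f) := by
  simp [dualFun]

lemma snd_dualFun (f : A) : (Λ.dualFun f).snd = algebraMap A' _ (Λ.cFun f) := by
  simp [dualFun, Algebra.algebraMap_eq_smul_one]

/-- The dual numbers over the exterior algebra of `L'`, as an algebra over `A` by way of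
`f ↦ f^v + ε f^c`. -/
@[reducible]
def dualAlgebra : Algebra A (DualNumber (ExteriorAlgebra A' L')) :=
  Λ.dualFun.toAlgebra' fun f x => by
    refine TrivSqZeroExt.ext ?_ ?_
    · rw [TrivSqZeroExt.fst_mul, TrivSqZeroExt.fst_mul, fst_dualFun, Algebra.commutes]
    · rw [TrivSqZeroExt.snd_mul, TrivSqZeroExt.snd_mul, fst_dualFun, snd_dualFun]
      simp only [smul_eq_mul, MulOpposite.smul_eq_mul_unop, MulOpposite.unop_op,
        Algebra.commutes (Λ.vFun f), Algebra.commutes (Λ.cFun f)]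
      exact add_comm _ _

/-- The assignment `s ↦ s^v + ε s^c` is semilinear over `f ↦ f^v + ε f^c`, and its values square to
zero, so it extends to the exterior algebra. -/
lemma exists_dualLift : ∃ Φ : ExteriorAlgebra A L →+* DualNumber (ExteriorAlgebra A' L'),
    (∀ f, Φ (algebraMap A _ f) = Λ.dualFun f) ∧
    (∀ s, (Φ (ExteriorAlgebra.ι A s)).fst = ExteriorAlgebra.ι A' (Λ.v s)) ∧
    ∀ s, (Φ (ExteriorAlgebra.ι A s)).snd = ExteriorAlgebra.ι A' (Λ.c s) := by
  let _ := Λ.dualAlgebra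
  have hsmul : ∀ (f : A) (x : DualNumber (ExteriorAlgebra A' L')), f • x = Λ.dualFun f * x :=
    fun f x => Algebra.smul_def f x
  let φ : L →ₗ[A] DualNumber (ExteriorAlgebra A' L') :=
    { toFun := fun s => TrivSqZeroExt.inl (ExteriorAlgebra.ι A' (Λ.v s)) +
        TrivSqZeroExt.inr (ExteriorAlgebra.ι A' (Λ.c s))
      map_add' := fun s t => by ext <;> simp
      map_smul' := fun f s => by
        rw [RingHom.id_apply, hsmul]
        ext <;> simp [v_smul, c_smul, fst_dualFun, snd_dualFun, Algebra.smul_def] }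
  have hφ : ∀ s, φ s * φ s = 0 := fun s => by
    ext <;> simp [φ, ExteriorAlgebra.ι_add_mul_swap]
  refine ⟨(ExteriorAlgebra.lift A ⟨φ, hφ⟩).toRingHom, fun f => ?_, fun s => ?_, fun s => ?_⟩
  · exact AlgHom.commutes _ f
  · exact (congrArg TrivSqZeroExt.fst (ExteriorAlgebra.lift_ι_apply A φ hφ s)).trans (by simp [φ])
  · exact (congrArg TrivSqZeroExt.snd (ExteriorAlgebra.lift_ι_apply A φ hφ s)).trans (by simp [φ])

/-- The ring homomorphism on multisections that extends `f ↦ f^v + ε f^c` and `s ↦ s^v + ε s^c`. -/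
def dualLift : ExteriorAlgebra A L →+* DualNumber (ExteriorAlgebra A' L') :=
  Λ.exists_dualLift.choose

lemma dualLift_algebraMap (f : A) : Λ.dualLift (algebraMap A _ f) = Λ.dualFun f :=
  Λ.exists_dualLift.choose_spec.1 f

lemma fst_dualLift_ι (s : L) :
    (Λ.dualLift (ExteriorAlgebra.ι A s)).fst = ExteriorAlgebra.ι A' (Λ.v s) :=
  Λ.exists_dualLift.choose_spec.2.1 s

lemma snd_dualLift_ι (s : L) :
    (Λ.dualLift (ExteriorAlgebra.ι A s)).snd = ExteriorAlgebra.ι A' (Λ.c s) :=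
  Λ.exists_dualLift.choose_spec.2.2 s

/-- The complete lift of multisections, the `ε`-component of `s ↦ s^v + ε s^c`. On trisections it is
`(s ∧ t ∧ u)^c = s^c ∧ t^v ∧ u^v + s^v ∧ t^c ∧ u^v + s^v ∧ t^v ∧ u^c`. -/
def multisectionLift : ExteriorAlgebra A L →ₗ[ℝ] ExteriorAlgebra A' L' where
  toFun x := (Λ.dualLift x).snd
  map_add' x y := by rw [map_add, TrivSqZeroExt.snd_add]
  map_smul' r x := by
    rw [Algebra.smul_def, map_mul, IsScalarTower.algebraMap_apply ℝ A (ExteriorAlgebra A L),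
      dualLift_algebraMap, TrivSqZeroExt.snd_mul, fst_dualFun, snd_dualFun, cFun_algebraMap,
      map_zero, AlgHom.commutes, ← IsScalarTower.algebraMap_apply, smul_zero, add_zero, smul_eq_mul, ← Algebra.smul_def, RingHom.id_apply]

lemma multisectionLift_mul₃ (s t u : L) : Λ.multisectionLift
    (ExteriorAlgebra.ι A s * ExteriorAlgebra.ι A t * ExteriorAlgebra.ι A u) =
      ExteriorAlgebra.ι A' (Λ.v s) * ExteriorAlgebra.ι A' (Λ.v t) * ExteriorAlgebra.ι A' (Λ.c u) +
      ExteriorAlgebra.ι A' (Λ.v s) * ExteriorAlgebra.ι A' (Λ.c t) * ExteriorAlgebra.ι A' (Λ.v u) +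
      ExteriorAlgebra.ι A' (Λ.c s) * ExteriorAlgebra.ι A' (Λ.v t) *
        ExteriorAlgebra.ι A' (Λ.v u) := by
  change (Λ.dualLift (_ * _ * _)).snd = _
  simp only [map_mul, TrivSqZeroExt.snd_mul, TrivSqZeroExt.fst_mul, fst_dualLift_ι, snd_dualLift_ι,
    smul_eq_mul, MulOpposite.smul_eq_mul_unop, MulOpposite.unop_op, add_mul, add_assoc]

/-- The complete lift of bisections is compatible with the Schouten-Nijenhuis bracket. -/
lemma schouten_lift {Ψ : ⋀[A]^2 L →ₗ[ℝ] ⋀[A']^2 L'}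
    (hΨ : ∀ s t, Ψ (wedge A s t) = wedge A' (Λ.c s) (Λ.v t) + wedge A' (Λ.v s) (Λ.c t))
    (P Q : ⋀[A]^2 L) :
    𝔟'.schouten (Ψ P) (Ψ Q) = Λ.multisectionLift (𝔟.schouten P Q) := by
  induction P using bisection_induction with
  | h_zero => simp
  | h_add P P' h h' => simp only [map_add, LinearMap.add_apply, h, h']
  | h_wedge s s' =>
  induction Q using bisection_induction with
  | h_zero => simp
  | h_add Q Q' h h' => simp only [map_add, h, h']
  | h_wedge t t' =>
    simp only [hΨ, map_add, LinearMap.add_apply, AnchoredBracket.schouten_wedge,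
      AnchoredBracket.schoutenWedge, map_neg, map_sub, multisectionLift_mul₃, Λ.bracket_c_c,
      Λ.bracket_c_v, Λ.bracket_v_c, Λ.bracket_v_v, map_zero, zero_mul]
    abel

section Complex

variable {Ψ : ⋀[A]^2 L →ₗ[ℝ] ⋀[A']^2 L'} {J : L →ₗ[A] L} {J' : L' →ₗ[A'] L'}

lemma schoutenC_lift
    (hΨ : ∀ s t, Ψ (wedge A s t) = wedge A' (Λ.c s) (Λ.v t) + wedge A' (Λ.v s) (Λ.c t))
    (P Q : ℂ ⊗[ℝ] ⋀[A]^2 L) :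
    𝔟'.schoutenC (Ψ.baseChange ℂ P) (Ψ.baseChange ℂ Q) =
      Λ.multisectionLift.baseChange ℂ (𝔟.schoutenC P Q) := by
  induction P using TensorProduct.induction_on with
  | zero => simp
  | add P P' h h' => simp only [map_add, LinearMap.add_apply, h, h']
  | tmul z P =>
  induction Q using TensorProduct.induction_on with
  | zero => simp
  | add Q Q' h h' => simp only [map_add, h, h']
  | tmul w Q =>
    simp only [AnchoredBracket.schoutenC, LinearMap.baseChange_tmul,
      LinearMap.BilinMap.baseChange_tmul, Λ.schouten_lift hΨ]

lemma complexConj_baseChange {X Y : Type*} [AddCommGroup X] [Module ℝ X] [AddCommGroup Y]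
    [Module ℝ Y] (φ : X →ₗ[ℝ] Y) (x : ℂ ⊗[ℝ] X) :
    complexConj Y (φ.baseChange ℂ x) = φ.baseChange ℂ (complexConj X x) := by
  induction x using TensorProduct.induction_on with
  | zero => simp
  | add x y h h' => simp only [map_add, h, h']
  | tmul z x => simp [complexConj]

/-- The complete lift of a bisection of type `(2,0)` is of type `(2,0)`, because both lifts of
sections carry `s - i J s` to a section of type `(1,0)`. -/
lemma baseChange_mem_bisections20 (hv : ∀ s, J' (Λ.v s) = Λ.v (J s))
    (hc : ∀ s, J' (Λ.c s) = Λ.c (J s))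
    (hΨ : ∀ s t, Ψ (wedge A s t) = wedge A' (Λ.c s) (Λ.v t) + wedge A' (Λ.v s) (Λ.c t))
    {P : ℂ ⊗[ℝ] ⋀[A]^2 L} (hP : P ∈ bisections20 J) : Ψ.baseChange ℂ P ∈ bisections20 J' := by
  have key : ∀ x y : ℂ ⊗[ℝ] L, Ψ.baseChange ℂ (wedgeC A L x y) =
      wedgeC A' L' (Λ.c.baseChange ℂ x) (Λ.v.baseChange ℂ y) +
        wedgeC A' L' (Λ.v.baseChange ℂ x) (Λ.c.baseChange ℂ y) := by
    intro x y
    induction x using TensorProduct.induction_on with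
    | zero => simp
    | add x x' h h' =>
      simp only [map_add, LinearMap.add_apply, h, h']
      abel
    | tmul z s =>
    induction y using TensorProduct.induction_on with
    | zero => simp
    | add y y' h h' =>
      simp only [map_add, h, h']
      abel
    | tmul w t =>
      simp only [wedgeC, LinearMap.baseChange_tmul, LinearMap.BilinMap.baseChange_tmul]
      rw [← TensorProduct.tmul_add]
      exact congrArg _ (hΨ s t)
  have h10v : ∀ s, Λ.v.baseChange ℂ (section10 J s) = section10 J' (Λ.v s) := fun s => by
    simp only [section10, map_sub, LinearMap.baseChange_tmul, hv]
  have h10c : ∀ s, Λ.c.baseChange ℂ (section10 J s) = section10 J' (Λ.c s) := fun s => by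
    simp only [section10, map_sub, LinearMap.baseChange_tmul, hc]
  induction hP using Submodule.span_induction with
  | mem P h =>
    obtain ⟨s, t, rfl⟩ := h
    rw [key, h10v, h10v, h10c, h10c]
    -- Both summands of the lift of a generator are generators again.
    exact add_mem (Submodule.subset_span ⟨_, _, rfl⟩) (Submodule.subset_span ⟨_, _, rfl⟩)
  | zero => rw [map_zero]; exact zero_mem _
  | add P Q _ _ h h' => rw [map_add]; exact add_mem h h'
  | smul z P _ h => rw [map_smul]; exact Submodule.smul_mem _ _ h

lemma isAlmostComplexPoisson (hv : ∀ s, J' (Λ.v s) = Λ.v (J s))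
    (hc : ∀ s, J' (Λ.c s) = Λ.c (J s))
    (hΨ : ∀ s t, Ψ (wedge A s t) = wedge A' (Λ.c s) (Λ.v t) + wedge A' (Λ.v s) (Λ.c t))
    {P : ℂ ⊗[ℝ] ⋀[A]^2 L} (h : 𝔟.IsAlmostComplexPoisson J P) :
    𝔟'.IsAlmostComplexPoisson J' (Ψ.baseChange ℂ P) where
  almostComplex := Λ.isAlmostComplex hv hc h.almostComplex
  mem := Λ.baseChange_mem_bisections20 hv hc hΨ h.mem
  schouten_self := by rw [Λ.schoutenC_lift hΨ, h.schouten_self, map_zero]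
  schouten_conj := by
    rw [complexConj_baseChange, Λ.schoutenC_lift hΨ, h.schouten_conj, map_zero]

end Complex

end BracketLift

/-! ### Anchors of lifts and fibrewise linear functions -/

section FibreLinear

variable {EB : Type*} [NormedAddCommGroup EB] [NormedSpace ℝ EB]
  {M : Type*} [TopologicalSpace M] [ChartedSpace EB M] [IsManifold 𝓘(ℝ, EB) ∞ M]
  {F : Type*} [NormedAddCommGroup F] [NormedSpace ℝ F]
  {V : M → Type*} [TopologicalSpace (TotalSpace F V)] [∀ x, AddCommGroup (V x)]
  [∀ x, Module ℝ (V x)] [∀ x, TopologicalSpace (V x)] [FiberBundle F V] [VectorBundle ℝ F V]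
  [ContMDiffVectorBundle ∞ F V 𝓘(ℝ, EB)]

/-- A smooth function on the total space of `V` that is linear on every fibre, that is, a smooth
section of the dual bundle. -/
structure IsFibreLinear (g : C^∞⟮𝓘(ℝ, EB).prod 𝓘(ℝ, F), TotalSpace F V; ℝ⟯) : Prop where
  map_add : ∀ (x : M) (u v : V x), g ⟨x, u + v⟩ = g ⟨x, u⟩ + g ⟨x, v⟩
  map_smul : ∀ (x : M) (r : ℝ) (u : V x), g ⟨x, r • u⟩ = r * g ⟨x, u⟩

lemma IsFibreLinear.map_sub {g : C^∞⟮𝓘(ℝ, EB).prod 𝓘(ℝ, F), TotalSpace F V; ℝ⟯}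
    (hg : IsFibreLinear g) (x : M) (u v : V x) : g ⟨x, u - v⟩ = g ⟨x, u⟩ - g ⟨x, v⟩ := by
  rw [eq_sub_iff_add_eq, ← hg.map_add, sub_add_cancel]

/-- The function `g ∘ s` on the base. -/
def compSection (g : C^∞⟮𝓘(ℝ, EB).prod 𝓘(ℝ, F), TotalSpace F V; ℝ⟯) (s : Cₛ^∞⟮𝓘(ℝ, EB); F, V⟯) :
    C^∞⟮𝓘(ℝ, EB), M; ℝ⟯ :=
  ⟨fun x => g ⟨x, s x⟩, g.contMDiff.comp s.contMDiff⟩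

lemma compSection_add_section {g : C^∞⟮𝓘(ℝ, EB).prod 𝓘(ℝ, F), TotalSpace F V; ℝ⟯}
    (hg : IsFibreLinear g) (s t : Cₛ^∞⟮𝓘(ℝ, EB); F, V⟯) :
    compSection g (s + t) = compSection g s + compSection g t := by
  ext x
  exact hg.map_add x (s x) (t x)

lemma compSection_sub_section {g : C^∞⟮𝓘(ℝ, EB).prod 𝓘(ℝ, F), TotalSpace F V; ℝ⟯}
    (hg : IsFibreLinear g) (s t : Cₛ^∞⟮𝓘(ℝ, EB); F, V⟯) :
    compSection g (s - t) = compSection g s - compSection g t := by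
  ext x
  exact hg.map_sub x (s x) (t x)

lemma compSection_smul_section {g : C^∞⟮𝓘(ℝ, EB).prod 𝓘(ℝ, F), TotalSpace F V; ℝ⟯}
    (hg : IsFibreLinear g) (r : ℝ) (s : Cₛ^∞⟮𝓘(ℝ, EB); F, V⟯) :
    compSection g (r • s) = r • compSection g s := by
  ext x
  exact hg.map_smul x r (s x)

lemma compSection_sub (g h : C^∞⟮𝓘(ℝ, EB).prod 𝓘(ℝ, F), TotalSpace F V; ℝ⟯)
    (s : Cₛ^∞⟮𝓘(ℝ, EB); F, V⟯) :
    compSection (g - h) s = compSection g s - compSection h s := rfl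

lemma mvfderiv_verticalVector {g : C^∞⟮𝓘(ℝ, EB).prod 𝓘(ℝ, F), TotalSpace F V; ℝ⟯}
    (hg : IsFibreLinear g) (y : TotalSpace F V) (w : V y.proj) :
    mvfderiv (𝓘(ℝ, EB).prod 𝓘(ℝ, F)) g y (verticalVector EB y w) = g ⟨y.proj, w⟩ := by
  have h1 := mvfderiv_comp_apply_of_eq (x := (0 : ℝ)) (y := y)
    (f := fun ε : ℝ => (⟨y.proj, y.2 + ε • w⟩ : TotalSpace F V))
    (g.contMDiff.mdifferentiable (by simp) y) (mdiff_line (EB := EB) y w) (line_zero y w) (1 : ℝ)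
  refine h1.symm.trans ?_
  have h : HasFDerivAt (fun ε : ℝ => g y + ε • g ⟨y.proj, w⟩)
      ((ContinuousLinearMap.id ℝ ℝ).smulRight (g ⟨y.proj, w⟩)) 0 :=
    ((hasFDerivAt_id (0 : ℝ)).smul_const _).const_add _
  have h3 : (g ∘ fun ε : ℝ => (⟨y.proj, y.2 + ε • w⟩ : TotalSpace F V)) =
      fun ε : ℝ => g y + ε • g ⟨y.proj, w⟩ := by
    ext ε
    exact (hg.map_add _ _ _).trans (congrArg _ (hg.map_smul _ _ _))
  rw [h3]
  exact (DFunLike.congr_fun h.hasMFDerivAt.mfderiv (1 : ℝ)).trans (one_smul ℝ _)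

lemma mvfderiv_verticalLiftFun (f : C^∞⟮𝓘(ℝ, EB), M; ℝ⟯) (y : TotalSpace F V)
    (z : TangentSpace (𝓘(ℝ, EB).prod 𝓘(ℝ, F)) y) :
    mvfderiv (𝓘(ℝ, EB).prod 𝓘(ℝ, F)) (verticalLiftFun F V f) y z =
      mvfderiv 𝓘(ℝ, EB) f y.proj (dproj EB y z) :=
  mvfderiv_comp_apply (f := (TotalSpace.proj : TotalSpace F V → M)) y
    (f.contMDiff.mdifferentiable (by simp) _)
    ((Bundle.contMDiff_proj (n := ∞) (IB := 𝓘(ℝ, EB)) V).mdifferentiable (by simp) y) z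

variable [T2Space M] [FiniteDimensional ℝ EB] {𝔏 : LieAlgebroid EB F V}

/-- Smooth functions on the total space are determined by their compositions with sections, because
there is a section through every point. -/
lemma fun_ext_compSection {g h : C^∞⟮𝓘(ℝ, EB).prod 𝓘(ℝ, F), TotalSpace F V; ℝ⟯}
    (H : ∀ s : Cₛ^∞⟮𝓘(ℝ, EB); F, V⟯, compSection g s = compSection h s) : g = h := by
  ext y
  obtain ⟨s, hs⟩ := exists_section_eq EB y
  have h1 : g ⟨y.proj, s y.proj⟩ = h ⟨y.proj, s y.proj⟩ := DFunLike.congr_fun (H s) y.proj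
  rwa [hs] at h1

/-- Fibrewise linearity can be tested on global sections. -/
lemma isFibreLinear_of_compSection {g : C^∞⟮𝓘(ℝ, EB).prod 𝓘(ℝ, F), TotalSpace F V; ℝ⟯}
    (hadd : ∀ s t : Cₛ^∞⟮𝓘(ℝ, EB); F, V⟯,
      compSection g (s + t) = compSection g s + compSection g t)
    (hsmul : ∀ (r : ℝ) (s : Cₛ^∞⟮𝓘(ℝ, EB); F, V⟯), compSection g (r • s) = r • compSection g s) :
    IsFibreLinear g := by
  refine ⟨fun x u v => ?_, fun x r u => ?_⟩
  · obtain ⟨s, hs⟩ : ∃ s : Cₛ^∞⟮𝓘(ℝ, EB); F, V⟯, s x = u :=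
      exists_section_eq EB (⟨x, u⟩ : TotalSpace F V)
    subst hs
    obtain ⟨t, ht⟩ : ∃ t : Cₛ^∞⟮𝓘(ℝ, EB); F, V⟯, t x = v :=
      exists_section_eq EB (⟨x, v⟩ : TotalSpace F V)
    subst ht
    exact DFunLike.congr_fun (hadd s t) x
  · obtain ⟨s, hs⟩ : ∃ s : Cₛ^∞⟮𝓘(ℝ, EB); F, V⟯, s x = u :=
      exists_section_eq EB (⟨x, u⟩ : TotalSpace F V)
    subst hs
    exact DFunLike.congr_fun (hsmul r s) x

/-- A function on the preimage of an open set becomes global and smooth when it is multiplied by a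
cutoff function on the base. -/
lemma contMDiff_cutoff {χ : C^∞⟮𝓘(ℝ, EB), M; ℝ⟯} {U : Set M} (hU : tsupport χ ⊆ U)
    {a : TotalSpace F V → ℝ}
    (ha : ∀ y : TotalSpace F V, y.proj ∈ U → ContMDiffAt (𝓘(ℝ, EB).prod 𝓘(ℝ, F)) 𝓘(ℝ) ∞ a y) :
    ContMDiff (𝓘(ℝ, EB).prod 𝓘(ℝ, F)) 𝓘(ℝ) ∞ (fun y => χ y.proj * a y) := by
  intro y
  by_cases hy : y.proj ∈ tsupport χ
  · exact ((verticalLiftFun F V χ).contMDiff y).mul (ha y (hU hy))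
  · refine (contMDiffAt_const (c := (0 : ℝ))).congr_of_eventuallyEq ?_
    have h1 : ∀ᶠ x in nhds y.proj, x ∉ tsupport χ := (isClosed_tsupport χ).isOpen_compl.mem_nhds hy
    filter_upwards [(FiberBundle.continuous_proj F V).continuousAt.eventually h1] with y' hy'
    rw [image_eq_zero_of_notMem_tsupport hy', zero_mul]

/-- Near a given fibre, every coordinate of a local trivialization agrees with a global fibrewise
linear function. -/
lemma exists_isFibreLinear (e : Trivialization F (TotalSpace.proj : TotalSpace F V → M))
    [MemTrivializationAtlas e] {y : TotalSpace F V} (hy : y.proj ∈ e.baseSet) (l : F →L[ℝ] ℝ) :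
    ∃ g : C^∞⟮𝓘(ℝ, EB).prod 𝓘(ℝ, F), TotalSpace F V; ℝ⟯, IsFibreLinear g ∧
      ∀ᶠ y' in nhds y, g y' = l (e y').2 := by
  obtain ⟨χ, h1, h2⟩ := exists_bump (EB := EB) (e.open_baseSet.mem_nhds hy)
  have hχ : ∀ x, x ∉ e.baseSet → χ x = 0 := fun x hx =>
    image_eq_zero_of_notMem_tsupport fun h => hx (h2 h)
  refine ⟨⟨fun y => χ y.proj * l (e y).2, contMDiff_cutoff h2 fun y' hy' =>
    l.contMDiff.contMDiffAt.comp y' (contMDiffAt_fib e hy')⟩, ⟨fun x u v => ?_, fun x r u => ?_⟩, ?_⟩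
  · change χ x * l (e ⟨x, u + v⟩).2 = χ x * l (e ⟨x, u⟩).2 + χ x * l (e ⟨x, v⟩).2
    by_cases hx : x ∈ e.baseSet
    · rw [fib_add e hx, map_add, mul_add]
    · simp only [hχ x hx, zero_mul, add_zero]
  · change χ x * l (e ⟨x, r • u⟩).2 = r * (χ x * l (e ⟨x, u⟩).2)
    by_cases hx : x ∈ e.baseSet
    · rw [fib_smul e hx, map_smul, smul_eq_mul, mul_left_comm]
    · simp only [hχ x hx, zero_mul, mul_zero]
  · filter_upwards [(FiberBundle.continuous_proj F V).continuousAt.eventually h1] with y' hy'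
    change χ y'.proj * l (e y').2 = _
    rw [hy', one_mul]

/-- A tangent vector of the total space is determined by its projection and by the derivatives of
fibrewise linear functions along it. -/
lemma tot_ext_of_isFibreLinear {y : TotalSpace F V}
    {z z' : TangentSpace (𝓘(ℝ, EB).prod 𝓘(ℝ, F)) y} (h1 : dproj EB y z = dproj EB y z')
    (h2 : ∀ g : C^∞⟮𝓘(ℝ, EB).prod 𝓘(ℝ, F), TotalSpace F V; ℝ⟯, IsFibreLinear g →
      mvfderiv (𝓘(ℝ, EB).prod 𝓘(ℝ, F)) g y z = mvfderiv (𝓘(ℝ, EB).prod 𝓘(ℝ, F)) g y z') :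
    z = z' := by
  have hy := mem_baseSet_trivializationAt F V y.proj
  refine tot_ext _ hy h1 ?_
  set e := trivializationAt F V y.proj
  by_contra hne
  obtain ⟨l, hl⟩ := SeparatingDual.exists_separating_of_ne (R := ℝ) hne
  obtain ⟨g, hg, hge⟩ := exists_isFibreLinear (EB := EB) e hy l
  have hd : ∀ z, mvfderiv (𝓘(ℝ, EB).prod 𝓘(ℝ, F)) g y z = l (dfib EB e y z) := fun z => by
    have h3 : mvfderiv (𝓘(ℝ, EB).prod 𝓘(ℝ, F)) g y =
        mvfderiv (𝓘(ℝ, EB).prod 𝓘(ℝ, F)) (l ∘ fun y => (e y).2) y :=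
      Filter.EventuallyEq.mfderiv_eq hge
    have h4 := mvfderiv_comp_apply y (l.contMDiff.mdifferentiable (n := ∞) (by simp) (e y).2)
      ((contMDiffAt_fib (EB := EB) e hy).mdifferentiableAt (by simp)) z
    rw [h3]
    refine h4.trans ?_
    exact DFunLike.congr_fun (ContinuousLinearMap.mfderiv_eq l) (dfib EB e y z)
  apply hl
  rw [← hd, ← hd, h2 g hg]

variable [FiniteDimensional ℝ F]

lemma prolongation_anchor_apply (σ : 𝔏.prolongSections)
    (g : C^∞⟮𝓘(ℝ, EB).prod 𝓘(ℝ, F), TotalSpace F V; ℝ⟯) (y : TotalSpace F V) :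
    𝔏.prolongation.anchor σ g y = mvfderiv (𝓘(ℝ, EB).prod 𝓘(ℝ, F)) g y (σ.1 y).2 := rfl

lemma anchoredBracket_anchor_apply (s : Cₛ^∞⟮𝓘(ℝ, EB); F, V⟯) (f : C^∞⟮𝓘(ℝ, EB), M; ℝ⟯) (x : M) :
    𝔏.anchoredBracket.anchor s f x = mvfderiv 𝓘(ℝ, EB) f x (𝔏.anchor x (s x)) := rfl

variable (𝔏) in
lemma LieAlgebroid.isLie_anchoredBracket : 𝔏.anchoredBracket.IsLie where
  jacobi := 𝔏.jacobi
  anchor_bracket s t := by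
    have : CompleteSpace EB := FiniteDimensional.complete ℝ EB
    ext f x
    rw [anchoredBracket_anchor_apply]
    change mvfderiv 𝓘(ℝ, EB) f x (𝔏.anchor x (𝔏.bracket s t x)) = _
    rw [𝔏.anchor_bracket]
    exact mvfderiv_mlieBracket (𝔏.contMDiff_anchor_section s) (𝔏.contMDiff_anchor_section t) f x

/-- The anchor of the prolongation respects brackets, because the second component of the bracket is
the Lie bracket of vector fields. -/
lemma prolongation_anchor_bracket (σ τ : 𝔏.prolongSections) :
    𝔏.prolongation.anchor (𝔏.prolongation.bracket σ τ) =
      ⁅𝔏.prolongation.anchor σ, 𝔏.prolongation.anchor τ⁆ := by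
  have : CompleteSpace EB := FiniteDimensional.complete ℝ EB
  have : CompleteSpace F := FiniteDimensional.complete ℝ F
  ext g y
  exact mvfderiv_mlieBracket σ.2.2.2 τ.2.2.2 g y

/-- A section of the prolongation is determined by its component in `V` and by its action on
fibrewise linear functions. -/
lemma prolong_ext_of_isFibreLinear {σ τ : 𝔏.prolongSections} (h1 : ∀ y, (σ.1 y).1 = (τ.1 y).1)
    (h2 : ∀ g, IsFibreLinear g → 𝔏.prolongation.anchor σ g = 𝔏.prolongation.anchor τ g) :
    σ = τ := by
  refine Subtype.ext <| funext fun y => Prod.ext (h1 y) (tot_ext_of_isFibreLinear ?_ ?_)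
  · rw [← (σ.2.1 y : 𝔏.anchor y.proj (σ.1 y).1 = _), h1]
    exact τ.2.1 y
  · exact fun g hg => DFunLike.congr_fun (h2 g hg) y

lemma anchor_verticalLift {g : C^∞⟮𝓘(ℝ, EB).prod 𝓘(ℝ, F), TotalSpace F V; ℝ⟯}
    (hg : IsFibreLinear g) (s : Cₛ^∞⟮𝓘(ℝ, EB); F, V⟯) :
    𝔏.prolongation.anchor (𝔏.verticalLift s) g = verticalLiftFun F V (compSection g s) := by
  ext y
  exact mvfderiv_verticalVector hg y (s y.proj)

lemma anchor_verticalLift_verticalLiftFun (s : Cₛ^∞⟮𝓘(ℝ, EB); F, V⟯) (f : C^∞⟮𝓘(ℝ, EB), M; ℝ⟯) :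
    𝔏.prolongation.anchor (𝔏.verticalLift s) (verticalLiftFun F V f) = 0 := by
  ext y
  rw [prolongation_anchor_apply, mvfderiv_verticalLiftFun, verticalLift_snd, dproj_verticalVector,
    map_zero]
  rfl

lemma anchor_completeLift_verticalLiftFun (s : Cₛ^∞⟮𝓘(ℝ, EB); F, V⟯) (f : C^∞⟮𝓘(ℝ, EB), M; ℝ⟯) :
    𝔏.prolongation.anchor (𝔏.completeLift s) (verticalLiftFun F V f) =
      verticalLiftFun F V (𝔏.anchoredBracket.anchor s f) := by
  ext y
  rw [prolongation_anchor_apply, mvfderiv_verticalLiftFun, completeLift_snd, dproj_completeVector]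
  rfl

/-- Any section through `y` may be used to compute the complete lift at `y`. -/
lemma completeVector_eq (s t : Cₛ^∞⟮𝓘(ℝ, EB); F, V⟯) {y : TotalSpace F V} (h : t y.proj = y.2) :
    𝔏.completeVector s y = sectionTangent t y (𝔏.anchor y.proj (s y.proj)) -
      verticalVector EB y (𝔏.bracket s t y.proj) := by
  have hy := mem_baseSet_trivializationAt F V y.proj
  refine tot_ext _ hy ?_ ?_
  · rw [dproj_completeVector, map_sub, dproj_verticalVector, sub_zero,
      dproj_tangentSection t h]
  · rw [dfib_completeVector _ 𝔏 s t hy h, map_sub, dfib_verticalVector _ hy,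
      dfib_tangentSection _ t h hy]

/-- Complete lifts act on fibrewise linear functions, that is, on sections of the dual bundle, as
Lie derivatives. -/
lemma compSection_anchor_completeLift {g : C^∞⟮𝓘(ℝ, EB).prod 𝓘(ℝ, F), TotalSpace F V; ℝ⟯}
    (hg : IsFibreLinear g) (s t : Cₛ^∞⟮𝓘(ℝ, EB); F, V⟯) :
    compSection (𝔏.prolongation.anchor (𝔏.completeLift s) g) t =
      𝔏.anchoredBracket.anchor s (compSection g t) - compSection g (𝔏.bracket s t) := by
  ext x
  change mvfderiv (𝓘(ℝ, EB).prod 𝓘(ℝ, F)) g ⟨x, t x⟩ (𝔏.completeVector s ⟨x, t x⟩) =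
    mvfderiv 𝓘(ℝ, EB) (compSection g t) x (𝔏.anchor x (s x)) - g ⟨x, 𝔏.bracket s t x⟩
  rw [completeVector_eq s t rfl, map_sub, mvfderiv_verticalVector hg]
  congr 1
  exact (mvfderiv_comp_apply (f := fun x => (⟨x, t x⟩ : TotalSpace F V)) x
    (g.contMDiff.mdifferentiable (by simp) _) (t.contMDiff.mdifferentiable (by simp) x) _).symm

lemma isFibreLinear_anchor_completeLift
    {g : C^∞⟮𝓘(ℝ, EB).prod 𝓘(ℝ, F), TotalSpace F V; ℝ⟯}
    (hg : IsFibreLinear g) (s : Cₛ^∞⟮𝓘(ℝ, EB); F, V⟯) :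
    IsFibreLinear (𝔏.prolongation.anchor (𝔏.completeLift s) g) := by
  refine isFibreLinear_of_compSection (fun t u => ?_) fun r t => ?_
  · simp only [compSection_anchor_completeLift hg, map_add, compSection_add_section hg]
    abel
  · simp only [compSection_anchor_completeLift hg, map_smul, compSection_smul_section hg,
      smul_sub]
    exact congrArg (· - _) ((𝔏.anchoredBracket.anchor s).map_smul r _)

/-! ### Brackets of lifts -/

/-- If two sections of the prolongation project to sections `s` and `t` of `V`, then their bracket
projects to `[s, t]`. -/
lemma fst_bracket {σ τ : 𝔏.prolongSections} {s t : Cₛ^∞⟮𝓘(ℝ, EB); F, V⟯}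
    (hs : ∀ y, (σ.1 y).1 = s y.proj) (ht : ∀ y, (τ.1 y).1 = t y.proj) (y : TotalSpace F V) :
    ((𝔏.prolongation.bracket σ τ).1 y).1 = 𝔏.bracket s t y.proj := by
  have hy := mem_baseSet_trivializationAt F V y.proj
  set e := trivializationAt F V y.proj
  have key : ∀ (σ τ : 𝔏.prolongSections) (s t : Cₛ^∞⟮𝓘(ℝ, EB); F, V⟯),
      (∀ y, (σ.1 y).1 = s y.proj) → (∀ y, (τ.1 y).1 = t y.proj) →
      mvfderiv (𝓘(ℝ, EB).prod 𝓘(ℝ, F)) (fun y => (e ⟨y.proj, (τ.1 y).1⟩).2) y (σ.1 y).2 =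
        mvfderiv 𝓘(ℝ, EB) (fun x => (e ⟨x, t x⟩).2) y.proj (𝔏.anchor y.proj (s y.proj)) := by
    intro σ τ s t hs ht
    simp only [ht]
    rw [← hs, (σ.2.1 y : 𝔏.anchor y.proj (σ.1 y).1 = _)]
    exact DFunLike.congr_fun (mfderiv_comp (f := (TotalSpace.proj : TotalSpace F V → M)) y
      ((contMDiffAt_fib_section e t hy).mdifferentiableAt (by simp))
      ((Bundle.contMDiff_proj (n := ∞) (IB := 𝓘(ℝ, EB)) V).mdifferentiable (by simp) y)) _
  apply fib_inj e hy
  refine (fib_prolongBracketBase e σ τ hy (hs y).symm (ht y).symm).trans ?_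
  rw [key σ τ s t hs ht, key τ σ t s ht hs, sub_self, sub_self, add_zero, sub_zero]

lemma bracket_verticalLift_verticalLift (s t : Cₛ^∞⟮𝓘(ℝ, EB); F, V⟯) :
    𝔏.prolongation.bracket (𝔏.verticalLift s) (𝔏.verticalLift t) = 0 := by
  refine prolong_ext_of_isFibreLinear (fun y => ?_) fun g hg => ?_
  · rw [fst_bracket (s := 0) (t := 0) (fun _ => rfl) fun _ => rfl, map_zero]
    rfl
  · rw [prolongation_anchor_bracket, Derivation.commutator_apply, anchor_verticalLift hg,
      anchor_verticalLift hg, anchor_verticalLift_verticalLiftFun,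
      anchor_verticalLift_verticalLiftFun, sub_zero, map_zero]
    rfl

lemma bracket_verticalLift_completeLift (s t : Cₛ^∞⟮𝓘(ℝ, EB); F, V⟯) :
    𝔏.prolongation.bracket (𝔏.verticalLift s) (𝔏.completeLift t) =
      𝔏.verticalLift (𝔏.bracket s t) := by
  refine prolong_ext_of_isFibreLinear (fun y => ?_) fun g hg => ?_
  · rw [fst_bracket (s := 0) (t := t) (fun _ => rfl) fun _ => rfl, map_zero]
    rfl
  · rw [prolongation_anchor_bracket, Derivation.commutator_apply, anchor_verticalLift hg,
      anchor_verticalLift hg, anchor_verticalLift (isFibreLinear_anchor_completeLift hg t),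
      anchor_completeLift_verticalLiftFun, compSection_anchor_completeLift hg]
    -- As `t^c (s^v g)` cancels the derivative in `s^v (t^c g)`, only `-g ∘ [t, s]` remains.
    have h : 𝔏.bracket t s = 0 - 𝔏.bracket s t :=
      (𝔏.anchoredBracket.bracket_swap t s).trans (zero_sub _).symm
    have h0 : compSection g (0 : Cₛ^∞⟮𝓘(ℝ, EB); F, V⟯) = 0 := by
      rw [← sub_self (0 : Cₛ^∞⟮𝓘(ℝ, EB); F, V⟯), compSection_sub_section hg, sub_self]
    rw [h, compSection_sub_section hg, h0]
    ext y
    change (𝔏.anchoredBracket.anchor t (compSection g s) y.proj -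
      (0 - compSection g (𝔏.bracket s t) y.proj)) -
        𝔏.anchoredBracket.anchor t (compSection g s) y.proj = compSection g (𝔏.bracket s t) y.proj
    ring

/-- On fibrewise linear functions this is the Jacobi identity of the Lie algebroid. -/
lemma bracket_completeLift_completeLift (s t : Cₛ^∞⟮𝓘(ℝ, EB); F, V⟯) :
    𝔏.prolongation.bracket (𝔏.completeLift s) (𝔏.completeLift t) =
      𝔏.completeLift (𝔏.bracket s t) := by
  refine prolong_ext_of_isFibreLinear (fun y => ?_) fun g hg => ?_
  · rw [fst_bracket (s := s) (t := t) (fun _ => rfl) fun _ => rfl]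
    rfl
  · refine fun_ext_compSection fun u => ?_
    have h1 : 𝔏.anchoredBracket.anchor (𝔏.bracket s t) (compSection g u) =
        𝔏.anchoredBracket.anchor s (𝔏.anchoredBracket.anchor t (compSection g u)) -
        𝔏.anchoredBracket.anchor t (𝔏.anchoredBracket.anchor s (compSection g u)) :=
      (DFunLike.congr_fun (𝔏.isLie_anchoredBracket.anchor_bracket s t) _).trans
        (Derivation.commutator_apply _)
    have h2 : compSection g (𝔏.bracket (𝔏.bracket s t) u) =
        compSection g (𝔏.bracket s (𝔏.bracket t u)) -
          compSection g (𝔏.bracket t (𝔏.bracket s u)) := by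
      rw [← compSection_sub_section hg, 𝔏.jacobi s t u, add_sub_cancel_right]
    rw [prolongation_anchor_bracket, Derivation.commutator_apply, compSection_sub,
      compSection_anchor_completeLift (isFibreLinear_anchor_completeLift hg t),
      compSection_anchor_completeLift (isFibreLinear_anchor_completeLift hg s),
      compSection_anchor_completeLift hg, compSection_anchor_completeLift hg,
      compSection_anchor_completeLift hg, compSection_anchor_completeLift hg,
      compSection_anchor_completeLift hg, map_sub, map_sub, h1, h2]
    abel

end FibreLinear

/-! ### Lifts generate the sections of the prolongation -/

section Generation

variable {EB : Type*} [NormedAddCommGroup EB] [NormedSpace ℝ EB] [FiniteDimensional ℝ EB]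
  {M : Type*} [TopologicalSpace M] [ChartedSpace EB M] [IsManifold 𝓘(ℝ, EB) ∞ M] [T2Space M]
  {F : Type*} [NormedAddCommGroup F] [NormedSpace ℝ F] [FiniteDimensional ℝ F]
  {V : M → Type*} [TopologicalSpace (TotalSpace F V)] [∀ x, AddCommGroup (V x)]
  [∀ x, Module ℝ (V x)] [∀ x, TopologicalSpace (V x)] [FiberBundle F V] [VectorBundle ℝ F V]
  [ContMDiffVectorBundle ∞ F V 𝓘(ℝ, EB)] {𝔏 : LieAlgebroid EB F V}

/-- Near the fibre through `y₀`, a section of the prolongation is a combination of lifts of a local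
frame of `V`. Cutting off with a function on the base makes the coefficients global. -/
lemma exists_smul_eq_sum_lifts (σ : 𝔏.prolongSections) (y₀ : TotalSpace F V) :
    ∃ (n : ℕ) (χ : C^∞⟮𝓘(ℝ, EB).prod 𝓘(ℝ, F), TotalSpace F V; ℝ⟯)
      (a c : Fin n → C^∞⟮𝓘(ℝ, EB).prod 𝓘(ℝ, F), TotalSpace F V; ℝ⟯)
      (E : Fin n → Cₛ^∞⟮𝓘(ℝ, EB); F, V⟯), χ y₀ = 1 ∧
      χ • σ = (∑ i, a i • 𝔏.completeLift (E i)) + ∑ i, c i • 𝔏.verticalLift (E i) := by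
  have hx := mem_baseSet_trivializationAt F V y₀.proj
  set e := trivializationAt F V y₀.proj
  let b := Module.finBasis ℝ F
  choose E hE using fun i => exists_const_section (EB := EB) e hx (b i)
  obtain ⟨χ, hχ, hχU⟩ := exists_bump (EB := EB)
    (Filter.inter_mem (e.open_baseSet.mem_nhds hx) (Filter.eventually_all.mpr hE))
  -- The coefficients `a` match the components in `V`. After subtraction of the corresponding
  -- complete lifts a vertical vector remains, with fibre coordinate `w` and coefficients `c`.
  let a : Fin (Module.finrank ℝ F) → TotalSpace F V → ℝ := fun i y =>
    (b.coord i).toContinuousLinearMap (e ⟨y.proj, (σ.1 y).1⟩).2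
  let w : TotalSpace F V → F := fun y =>
    dfib EB e y (σ.1 y).2 - ∑ i, a i y • dfib EB e y (𝔏.completeVector (E i) y)
  let c : Fin (Module.finrank ℝ F) → TotalSpace F V → ℝ := fun i y =>
    (b.coord i).toContinuousLinearMap (w y)
  have hU : IsOpen {y : TotalSpace F V | y.proj ∈ e.baseSet} :=
    e.open_baseSet.preimage (FiberBundle.continuous_proj F V)
  have hfib : ContMDiffOn (𝓘(ℝ, EB).prod 𝓘(ℝ, F)) 𝓘(ℝ, F) ∞ (fun y : TotalSpace F V => (e y).2)
      {y : TotalSpace F V | y.proj ∈ e.baseSet} :=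
    fun y hy => (contMDiffAt_fib e hy).contMDiffWithinAt
  have ha : ∀ i (y : TotalSpace F V), y.proj ∈ e.baseSet →
      ContMDiffAt (𝓘(ℝ, EB).prod 𝓘(ℝ, F)) 𝓘(ℝ) ∞ (a i) y := fun i y hy =>
    (b.coord i).toContinuousLinearMap.contMDiff.contMDiffAt.comp y
      (contMDiffAt_fib_base e σ.2.2.1 hy)
  have hw : ∀ y : TotalSpace F V, y.proj ∈ e.baseSet →
      ContMDiffAt (𝓘(ℝ, EB).prod 𝓘(ℝ, F)) 𝓘(ℝ, F) ∞ w y := fun y hy =>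
    (contMDiffAt_mvfderiv hU hfib hy (σ.2.2.2 y)).sub (ContMDiffAt.sum fun i _ =>
      (ha i y hy).smul (contMDiffAt_mvfderiv hU hfib hy (contMDiff_completeVector 𝔏 (E i) y)))
  have hc : ∀ i (y : TotalSpace F V), y.proj ∈ e.baseSet →
      ContMDiffAt (𝓘(ℝ, EB).prod 𝓘(ℝ, F)) 𝓘(ℝ) ∞ (c i) y := fun i y hy =>
    (b.coord i).toContinuousLinearMap.contMDiff.contMDiffAt.comp y (hw y hy)
  have hχB : tsupport χ ⊆ e.baseSet := fun x h => (hχU h).1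
  have main : ∀ y : TotalSpace F V, y.proj ∈ tsupport χ → σ.1 y =
      (∑ i, a i y • (𝔏.completeLift (E i)).1 y) + ∑ i, c i y • (𝔏.verticalLift (E i)).1 y := by
    intro y h
    have hy : y.proj ∈ e.baseSet := hχB h
    have h1 : ∀ i, (e ⟨y.proj, E i y.proj⟩).2 = b i := (hχU h).2
    have hb1 : (σ.1 y).1 = ∑ i, a i y • E i y.proj := by
      apply fib_inj e hy
      rw [fib_sum e hy]
      simp only [fib_smul e hy, h1]
      exact (b.sum_repr _).symm
    change σ.1 y = (∑ i, a i y • (E i y.proj, 𝔏.completeVector (E i) y)) +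
      ∑ i, c i y • ((0 : V y.proj), verticalVector EB y (E i y.proj))
    refine Prod.ext ?_ (tot_ext e hy ?_ ?_)
    · simp only [Prod.fst_add, Prod.fst_sum, Prod.smul_fst, smul_zero, Finset.sum_const_zero,
        add_zero]
      exact hb1
    · simp only [Prod.snd_add, Prod.snd_sum, Prod.smul_snd, map_add, map_sum, map_smul,
        dproj_completeVector, dproj_verticalVector, smul_zero, Finset.sum_const_zero, add_zero]
      rw [← (σ.2.1 y : 𝔏.anchor y.proj (σ.1 y).1 = _), hb1, map_sum]
      simp only [map_smul]
    · simp only [Prod.snd_add, Prod.snd_sum, Prod.smul_snd, map_add, map_sum, map_smul,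
        dfib_verticalVector e hy, h1]
      have hsum : ∑ i, c i y • b i = w y := b.sum_repr (w y)
      rw [hsum]
      exact (add_sub_cancel _ _).symm
  refine ⟨_, verticalLiftFun F V χ,
    fun i => ⟨fun y => χ y.proj * a i y, contMDiff_cutoff hχB (ha i)⟩,
    fun i => ⟨fun y => χ y.proj * c i y, contMDiff_cutoff hχB (hc i)⟩, E, hχ.self_of_nhds, ?_⟩
  refine Subtype.ext <| funext fun y => ?_
  have hadd : ∀ α β : 𝔏.prolongSections, (α + β).1 y = α.1 y + β.1 y := fun _ _ => rfl
  rw [hadd, prolong_sum, prolong_sum]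
  change χ y.proj • σ.1 y = (∑ i, (χ y.proj * a i y) • (𝔏.completeLift (E i)).1 y) +
    ∑ i, (χ y.proj * c i y) • (𝔏.verticalLift (E i)).1 y
  simp only [mul_smul, ← Finset.smul_sum, ← smul_add]
  by_cases h : y.proj ∈ tsupport χ
  · rw [main y h]
  · rw [image_eq_zero_of_notMem_tsupport h, zero_smul, zero_smul]

/-- A tensorial map on sections of the prolongation vanishes if it vanishes on lifts. -/
lemma eq_zero_of_lifts {T : 𝔏.prolongSections → 𝔏.prolongSections}
    (hadd : ∀ σ τ, T (σ + τ) = T σ + T τ)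
    (hsmul : ∀ (f : C^∞⟮𝓘(ℝ, EB).prod 𝓘(ℝ, F), TotalSpace F V; ℝ⟯) σ, T (f • σ) = f • T σ)
    (hv : ∀ s, T (𝔏.verticalLift s) = 0) (hc : ∀ s, T (𝔏.completeLift s) = 0)
    (σ : 𝔏.prolongSections) : T σ = 0 := by
  let T' : 𝔏.prolongSections →ₗ[C^∞⟮𝓘(ℝ, EB).prod 𝓘(ℝ, F), TotalSpace F V; ℝ⟯]
      𝔏.prolongSections := { toFun := T, map_add' := hadd, map_smul' := hsmul }
  have hv' : ∀ s, T' (𝔏.verticalLift s) = 0 := hv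
  have hc' : ∀ s, T' (𝔏.completeLift s) = 0 := hc
  refine Subtype.ext <| funext fun y => ?_
  obtain ⟨n, χ, a, c, E, hχ, h⟩ := exists_smul_eq_sum_lifts σ y
  have h1 : χ • T' σ = 0 := by
    rw [← map_smul, h]
    simp only [map_add, map_sum, map_smul, hv', hc', smul_zero, Finset.sum_const_zero, add_zero]
  have h2 : χ y • (T' σ).1 y = 0 := congrFun (congrArg Subtype.val h1) y
  rw [hχ, one_smul] at h2
  exact h2

/-- Through a section `s` with `s(x) = y`, the complete lift of functions inherits linearity and the
product rule from the derivation `ρ(s)`. -/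
lemma completeLiftFun_eq_anchor (f : C^∞⟮𝓘(ℝ, EB), M; ℝ⟯) {s : Cₛ^∞⟮𝓘(ℝ, EB); F, V⟯}
    {y : TotalSpace F V} (h : s y.proj = y.2) :
    𝔏.completeLiftFun f y = 𝔏.anchoredBracket.anchor s f y.proj := by
  rw [anchoredBracket_anchor_apply, h]
  rfl

/-- The vertical and complete lifts from a Lie algebroid to its prolongation. -/
def LieAlgebroid.bracketLift (𝔏 : LieAlgebroid EB F V) :
    BracketLift 𝔏.anchoredBracket 𝔏.prolongation where
  vFun :=
    { toFun := verticalLiftFun F V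
      map_one' := rfl
      map_mul' := fun _ _ => rfl
      map_zero' := rfl
      map_add' := fun _ _ => rfl
      commutes' := fun _ => rfl }
  cFun :=
    { toFun := 𝔏.completeLiftFun
      map_add' := fun f g => by
        ext y
        obtain ⟨s, hs⟩ := exists_section_eq EB y
        change 𝔏.completeLiftFun (f + g) y = 𝔏.completeLiftFun f y + 𝔏.completeLiftFun g y
        rw [completeLiftFun_eq_anchor _ hs, completeLiftFun_eq_anchor _ hs,
          completeLiftFun_eq_anchor _ hs, map_add]
        rfl
      map_smul' := fun r f => by
        ext y
        obtain ⟨s, hs⟩ := exists_section_eq EB y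
        change 𝔏.completeLiftFun (r • f) y = r • 𝔏.completeLiftFun f y
        rw [completeLiftFun_eq_anchor _ hs, completeLiftFun_eq_anchor _ hs, Derivation.map_smul]
        rfl }
  cFun_mul f g := by
    ext y
    obtain ⟨s, hs⟩ := exists_section_eq EB y
    change 𝔏.completeLiftFun (f * g) y =
      f y.proj * 𝔏.completeLiftFun g y + 𝔏.completeLiftFun f y * g y.proj
    rw [completeLiftFun_eq_anchor _ hs, completeLiftFun_eq_anchor _ hs,
      completeLiftFun_eq_anchor _ hs, Derivation.leibniz, mul_comm _ (g y.proj)]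
    rfl
  v := 𝔏.verticalLift
  c := 𝔏.completeLift
  v_smul := verticalLift_smul 𝔏
  c_smul := completeLift_smul 𝔏
  v_injective s t h := by
    ext x
    exact verticalLift_inj (y := (⟨x, 0⟩ : TotalSpace F V)) (congrFun (congrArg Subtype.val h) _)
  bracket_v_v := bracket_verticalLift_verticalLift
  bracket_v_c := bracket_verticalLift_completeLift
  bracket_c_c := bracket_completeLift_completeLift
  eq_zero_of_lifts _ hadd hsmul hv hc := eq_zero_of_lifts hadd hsmul hv hc

end Generation

end

theorem mainTheorem8
    {EB : Type*} [NormedAddCommGroup EB] [NormedSpace ℝ EB] [FiniteDimensional ℝ EB]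
    {M : Type*} [TopologicalSpace M] [ChartedSpace EB M] [IsManifold 𝓘(ℝ, EB) ∞ M]
    [T2Space M] [SecondCountableTopology M]
    {F : Type*} [NormedAddCommGroup F] [NormedSpace ℝ F] [FiniteDimensional ℝ F]
    {V : M → Type*} [TopologicalSpace (TotalSpace F V)] [∀ x, AddCommGroup (V x)]
    [∀ x, Module ℝ (V x)] [∀ x, TopologicalSpace (V x)] [FiberBundle F V] [VectorBundle ℝ F V]
    [ContMDiffVectorBundle ∞ F V 𝓘(ℝ, EB)]
    (𝔏 : LieAlgebroid EB F V)
    (J : Cₛ^∞⟮𝓘(ℝ, EB); F, V⟯ →ₗ[C^∞⟮𝓘(ℝ, EB), M; ℝ⟯] Cₛ^∞⟮𝓘(ℝ, EB); F, V⟯)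
    (hJ : IsAlmostComplex J) :
    𝔏.prolongation.IsLie ∧
      IsAlmostComplex (𝔏.completeLiftEndo J) ∧
      (𝔏.prolongation.IsIntegrable (𝔏.completeLiftEndo J) ↔ 𝔏.anchoredBracket.IsIntegrable J) ∧
      ∀ P : ℂ ⊗[ℝ] ⋀[C^∞⟮𝓘(ℝ, EB), M; ℝ⟯]^2 Cₛ^∞⟮𝓘(ℝ, EB); F, V⟯,
        𝔏.anchoredBracket.IsAlmostComplexPoisson J P →
          𝔏.prolongation.IsAlmostComplexPoisson (𝔏.completeLiftEndo J)
            (𝔏.completeLiftBisectionC P) := by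
  have hv := fun s => completeLiftEndo_verticalLift (𝔏 := 𝔏) J s
  have hc := fun s => completeLiftEndo_completeLift (𝔏 := 𝔏) J s
  exact ⟨𝔏.bracketLift.isLie 𝔏.isLie_anchoredBracket prolongation_anchor_bracket,
    𝔏.bracketLift.isAlmostComplex hv hc hJ, 𝔏.bracketLift.isIntegrable_iff hv hc hJ,
    fun P hP => 𝔏.bracketLift.isAlmostComplexPoisson hv hc (completeLiftBisection_wedge 𝔏) hP⟩
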